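/- Let $P$ be the hyperbolic pair of pants with geodesic boundary curves $\delta_1,\delta_2,\delta_3$, each of length $9/10$; that is, $P$ is obtained from two copies (the faces of $P$) of a convex right-angled hyperbolic hexagon by gluing them along three alternate sides (the seams), where each of the other three sides has length $9/20$. Fix marked points $p_k\in\delta_k$ ($k=1,2,3$), all three lying in one face. An arc joining marked points is simple if it has no self-intersection, except that its two endpoints may coincide, and it is essential if it cannot be homotoped into $\partial P$ with its endpoints fixed. For each pair of (not necessarily distinct) marked points $p_i,p_j$ let $c_{ij}$ (a canonical arc) be a shortest simple essential arc joining $p_i$ and $p_j$. For an arc $a$ joining marked points let $l_h(a)$ be the infimum of the lengths of the arcs homotopic to $a$ with endpoints fixed. A multiarc is a finite family $C$ of simple essential arcs with endpoints in $\{p_1,p_2,p_3\}$ that are pairwise disjoint away from the marked points (homotopic arcs are allowed), and $l_h(C)$ is the sum of the $l_h(a)$ over the arcs $a$ of $C$. The Dehn-Thurston parameters $(m_1,m_2,m_3)\times(t_1,t_2,t_3)$ of a multiarc $C$ are the following: $m_k$ is the number of ends of arcs of $C$ on $\delta_k$; and if every arc $a$ of $C$, joining $p_i$ to $p_j$, is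 homotopic with endpoints fixed to $\delta_i^{s_a}\cdot c_{ij}^{\pm1}\cdot\delta_j^{r_a}$ with $s_a,r_a\in\mathbb Z$ (the boundary curves being regarded as loops at the marked points, and $c_{ij}$ being run through in either direction if $i=j$, from $p_i$ to $p_j$ otherwise), then $|t_k|$ is the sum of $|s_a|$ over the arcs $a$ that start on $\delta_k$ and of $|r_a|$ over the arcs $a$ that end on $\delta_k$. The combinatorial length is $l_p(C)=\sum_k m_k+\sum_k|t_k|$. (i) Every simple essential arc $a$ in $P$ with endpoints in $\{p_1,p_2,p_3\}$ satisfies, for its Dehn-Thurston parameters, $l_p(a)\le\frac{20}{9}\,l_h(a)$. (ii) Every multiarc $C$ in $P$ with endpoints in $\{p_1,p_2,p_3\}$ satisfies, for its Dehn-Thurston parameters, $l_p(C)\le\frac{20}{9}\,l_h(C)$. -/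

import Mathlib

open scoped ENNReal UpperHalfPlane

noncomputable section

/-! ### Geodesics and right-angled hexagons in the hyperbolic plane -/

/-- The geodesic segment between two points of the hyperbolic plane: the points at which the
triangle inequality is an equality. -/
def geodSegment (x y : ℍ) : Set ℍ := {z | dist x z + dist z y = dist x y}

/-- The complete geodesic line through two distinct points of the hyperbolic plane. -/
def geodLine (x y : ℍ) : Set ℍ :=
  {z | z ∈ geodSegment x y ∨ y ∈ geodSegment x z ∨ x ∈ geodSegment z y}

/-- Geodesic convexity. -/
def GeodConvex (S : Set ℍ) : Prop := ∀ x ∈ S, ∀ y ∈ S, geodSegment x y ⊆ S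

/-- The geodesic convex hull of a set. -/
def geodHull (T : Set ℍ) : Set ℍ := ⋂₀ {S | GeodConvex S ∧ T ⊆ S}

/-- `v 0, …, v 5` (indices modulo `6`) are the consecutive vertices of a convex hyperbolic hexagon
all of whose interior angles are right angles. -/
structure IsRightAngledHexagon (v : Fin 6 → ℍ) : Prop where
  /-- consecutive vertices are distinct -/
  ne : ∀ i, v i ≠ v (i + 1)
  /-- The angle at `v i` is `π / 2`: by the hyperbolic law of cosines
  `cosh c = cosh a * cosh b - sinh a * sinh b * cos γ` this is the hyperbolic Pythagorean
  relation. -/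
  right_angle : ∀ i, Real.cosh (dist (v (i - 1)) (v (i + 1))) =
    Real.cosh (dist (v (i - 1)) (v i)) * Real.cosh (dist (v i) (v (i + 1)))
  /-- Convexity: the four vertices off a side lie strictly on one side of the geodesic line that
  carries that side. -/
  convex : ∀ i j k, j ≠ i → j ≠ i + 1 → k ≠ i → k ≠ i + 1 →
    Disjoint (geodLine (v i) (v (i + 1))) (geodSegment (v j) (v k))

/-- The hexagonal region with vertices `v`. -/
def hexRegion (v : Fin 6 → ℍ) : Set ℍ := geodHull (Set.range v)

/-- The sides `[v 0, v 1]`, `[v 2, v 3]`, `[v 4, v 5]`, which become the boundary curves. -/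
def boundarySide (v : Fin 6 → ℍ) (k : Fin 3) : Set ℍ :=
  geodSegment (v (![0, 2, 4] k)) (v (![1, 3, 5] k))

/-- The other three sides `[v 1, v 2]`, `[v 3, v 4]`, `[v 5, v 0]`, which become the seams. -/
def seamSide (v : Fin 6 → ℍ) (k : Fin 3) : Set ℍ :=
  geodSegment (v (![1, 3, 5] k)) (v (![2, 4, 0] k))

/-- The union of the three seams. -/
def seams (v : Fin 6 → ℍ) : Set ℍ := ⋃ k, seamSide v k

theorem seams_subset_hexRegion (v : Fin 6 → ℍ) : seams v ⊆ hexRegion v := by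
  intro z hz
  obtain ⟨k, hk⟩ := Set.mem_iUnion.1 hz
  rintro S ⟨hS, hv⟩
  exact hS _ (hv ⟨_, rfl⟩) _ (hv ⟨_, rfl⟩) hk

instance seams_nonempty (v : Fin 6 → ℍ) : Nonempty (seams v) :=
  ⟨⟨v 1, Set.mem_iUnion.2 ⟨0, by simp [seamSide, geodSegment]⟩⟩⟩

/-- The inclusion of the seams in the hexagonal region. -/
def seamInclusion (v : Fin 6 → ℍ) : seams v → hexRegion v :=
  Set.inclusion (seams_subset_hexRegion v)

theorem seamInclusion_isometry (v : Fin 6 → ℍ) : Isometry (seamInclusion v) :=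
  Isometry.of_dist_eq fun _ _ => rfl

/-! ### Hyperbolic pairs of pants -/

/-- The pair of pants obtained from two copies of the hexagon with vertices `v` by gluing them
along their three seams, with the metric of the gluing: the distance of two points of one copy is
their distance in the hexagon, and the distance of `x` in the first copy to `y` in the second is
the infimum of `dist x z + dist z y` over the points `z` of the seams. -/
abbrev Pants (v : Fin 6 → ℍ) : Type :=
  Metric.GlueSpace (seamInclusion_isometry v) (seamInclusion_isometry v)

namespace Pants

variable {v : Fin 6 → ℍ}

/-- The first copy of the hexagon in the pair of pants. -/
def inFront (x : hexRegion v) : Pants v :=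
  Metric.toGlueL (seamInclusion_isometry v) (seamInclusion_isometry v) x

/-- The second copy of the hexagon in the pair of pants. -/
def inBack (x : hexRegion v) : Pants v :=
  Metric.toGlueR (seamInclusion_isometry v) (seamInclusion_isometry v) x

variable (v) in
/-- The `k`-th boundary curve, as a set: the two copies of the `k`-th boundary side. -/
def bdry (k : Fin 3) : Set (Pants v) :=
  inFront '' {x | (x : ℍ) ∈ boundarySide v k} ∪ inBack '' {x | (x : ℍ) ∈ boundarySide v k}

variable (v) in
/-- The length of the `k`-th boundary curve, which consists of two copies of a geodesic segment. -/
def bdryLength (k : Fin 3) : ℝ := 2 * dist (v (![0, 2, 4] k)) (v (![1, 3, 5] k))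

/-! ### Arcs, length, homotopy -/

/-- The length of a path. -/
def length {x y : Pants v} (a : Path x y) : ℝ≥0∞ := eVariationOn a Set.univ

/-- `l_h(a)`: the infimum of the lengths of the paths homotopic to `a` with endpoints fixed. -/
def hypLength {x y : Pants v} (a : Path x y) : ℝ≥0∞ :=
  ⨅ (b : Path x y) (_ : Path.Homotopic a b), length b

/-- A path is simple if it has no self-intersection, except that its two endpoints may coincide. -/
def IsSimple {x y : Pants v} (a : Path x y) : Prop :=
  ∀ r s, a r = a s → r = s ∨ (r = 0 ∧ s = 1) ∨ (r = 1 ∧ s = 0)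

/-- A path is essential if it cannot be homotoped into the boundary with endpoints fixed. -/
def IsEssential {x y : Pants v} (a : Path x y) : Prop :=
  ¬ ∃ b : Path x y, Path.Homotopic a b ∧ Set.range b ⊆ ⋃ k, bdry v k

/-! ### Dehn-Thurston parameters -/

/-- One marked point on each boundary curve, all three in the same face (copy of the hexagon). -/
def IsMarking (p : Fin 3 → Pants v) : Prop :=
  (∀ k, p k ∈ bdry v k) ∧
    ((∀ k, p k ∈ Set.range (inFront (v := v))) ∨ ∀ k, p k ∈ Set.range (inBack (v := v)))

/-- `d k` runs once around the `k`-th boundary curve, in either direction, starting from the marked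
point. -/
def IsBdryLoops {p : Fin 3 → Pants v} (d : ∀ k, Path (p k) (p k)) : Prop :=
  ∀ k, IsSimple (d k) ∧ Set.range (d k) = bdry v k

/-- `c` is a choice of canonical arcs: for each pair of (not necessarily distinct) marked points
a shortest essential simple arc that joins them. The arcs `c i j` and `c j i` with `i ≠ j` are the
same arc in its two directions. -/
def IsCanonical {p : Fin 3 → Pants v} (c : ∀ i j, Path (p i) (p j)) : Prop :=
  (∀ i j, IsSimple (c i j) ∧ IsEssential (c i j) ∧
    ∀ a : Path (p i) (p j), IsSimple a → IsEssential a → length (c i j) ≤ length a) ∧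
  ∀ i j, i ≠ j → c j i = (c i j).symm

/-- An arc whose endpoints are marked points. -/
structure MarkedArc (p : Fin 3 → Pants v) where
  /-- index of the boundary curve on which the arc starts -/
  src : Fin 3
  /-- index of the boundary curve on which the arc ends -/
  tgt : Fin 3
  /-- the arc itself -/
  path : Path (p src) (p tgt)

/-- The class of the loop that runs `n` times along the loop `d`. -/
def loopPow {x : Pants v} (d : Path x x) (n : ℤ) : Path.Homotopic.Quotient x x :=
  FundamentalGroup.toPath (FundamentalGroup.fromPath (Path.Homotopic.Quotient.mk d) ^ n)

/-- The arc `a` is homotopic, with endpoints fixed, to the path which turns `s` times around the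
boundary curve on which `a` starts, then follows the canonical arc between the endpoints of `a`
(in either direction, which only matters if the endpoints coincide), and then turns `r` times around
the boundary curve on which `a` ends. -/
def MarkedArc.IsCarried {p : Fin 3 → Pants v} (d : ∀ k, Path (p k) (p k))
    (c : ∀ i j, Path (p i) (p j)) (a : MarkedArc p) (s r : ℤ) : Prop :=
  ∃ e : Path (p a.src) (p a.tgt), (e = c a.src a.tgt ∨ e = (c a.tgt a.src).symm) ∧
    Path.Homotopic.Quotient.mk a.path =
      ((loopPow (d a.src) s).trans (Path.Homotopic.Quotient.mk e)).trans (loopPow (d a.tgt) r)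

/-- A multiarc: finitely many essential simple arcs with endpoints at the marked points, pairwise
disjoint away from the marked points (parallel arcs are allowed). -/
def IsMultiarc {p : Fin 3 → Pants v} {n : ℕ} (C : Fin n → MarkedArc p) : Prop :=
  (∀ x, IsSimple (C x).path ∧ IsEssential (C x).path) ∧
    ∀ x y, x ≠ y → Set.range (C x).path ∩ Set.range (C y).path ⊆ Set.range p

/-- `m k` is the intersection number of the multiarc `C` with the `k`-th boundary curve, that is the
number of its ends there, and `t k` is the absolute value of its `k`-th twisting parameter, that is
the total number of turns that its strands make around the `k`-th boundary curve once its arcs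
are carried by the canonical arcs and the boundary curves. (A turn crosses each of the two edges
of a window once, so this is half the number of crossings with these edges.) -/
def IsDehnThurston {p : Fin 3 → Pants v} (d : ∀ k, Path (p k) (p k))
    (c : ∀ i j, Path (p i) (p j)) {n : ℕ} (C : Fin n → MarkedArc p) (m t : Fin 3 → ℕ) : Prop :=
  (∀ k, m k = ∑ x, ((if (C x).src = k then 1 else 0) + (if (C x).tgt = k then 1 else 0))) ∧
  ∃ s r : Fin n → ℤ, (∀ x, (C x).IsCarried d c (s x) (r x)) ∧
    ∀ k, t k = ∑ x, ((if (C x).src = k then (s x).natAbs else 0) +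
      (if (C x).tgt = k then (r x).natAbs else 0))

/-- The combinatorial length `l_p`, from the Dehn-Thurston parameters. -/
def combLength (m t : Fin 3 → ℕ) : ℕ := ∑ k, m k + ∑ k, t k

end Pants

end

/-!
The proof is a comparison in the universal cover. The pair of pants develops into the hyperbolic
plane: in one face the developing map is the identity, and crossing the `k`-th seam composes it with
the reflection `seamRefl H k` in the line of this seam. The germs of developing maps form a covering
space `DevSpace`, in which paths are lifted; `dev` does not increase lengths along lifts, so the
length of every path homotopic to an arc is at least the distance of the developed endpoints of the
arc (`edist_dev_le_length`). Up to homotopy a path is a reduced word of seam crossings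
(`exists_reduced_word`), and the holonomy of a simple loop around a boundary curve is a translation
by `9 / 10` along the line of a boundary side (`exists_continues_of_isSimple`). This reduces the
estimate for an arc homotopic to `δᵢ ^ s * c * δⱼ ^ r` to the claim
`9 / 10 + 9 / 20 * (|s| + |r|) ≤ dist (ℓ (x + X)) (w (ℓ' (y + Y)))` for the lines `ℓ`, `ℓ'` of two
boundary sides, a reduced word `w`, and `|X| = 9 / 10 * |s|`, `|Y| = 9 / 10 * |r|`, where
`dist (ℓ x) (w (ℓ' y))` is at most the length of the canonical arc `c`.

In the hyperboloid model the unit normals of `ℓ` and `w ℓ'` have a product at least `C`, where the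
constant `C > 1` comes from the hexagon and a ping-pong argument (`le_mink_wordAct_sideNormal`,
`le_mink_wordAct_sideNormal_self`; the second one is for arcs that return to their boundary curve,
and needs that the canonical arc is essential). The hyperbolic cosine of the distance of points of
the two lines is a combination of four exponentials `exp (± x ± y)` with nonnegative coefficients,
whose two products of opposite coefficients are at least `((C - 1) / 4) ^ 2`. Hence it is at least
`C - 1`, and it grows like `exp (|X| + |Y|)` relative to its value at `(x, y)` (`lineGram_bounds`).
The first bound serves for few turns; for many turns the growth is twice as fast as needed, and it
remains to bound the canonical arcs from above, by comparison with explicit simple essential arcs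
(`exists_arc_of_ne`, `exists_short_arc_self`). Crude numerical bounds suffice, and no topology of
simple arcs is needed.
-/

noncomputable section

open Set Topology
open scoped unitInterval UpperHalfPlane ENNReal

namespace PantsLength

/-! ### The hyperboloid model -/

/-- Vectors of the three-dimensional Minkowski space. -/
abbrev Vec : Type := Fin 3 → ℝ

/-- The Minkowski form `u₀ u₂ - u₁²` of signature `(1, 2)`, polarized. -/
def mink (u w : Vec) : ℝ := (u 0 * w 2 + u 2 * w 0) / 2 - u 1 * w 1

theorem mink_comm (u w : Vec) : mink u w = mink w u := by simp only [mink]; ring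

theorem mink_add_left (u u' w : Vec) : mink (u + u') w = mink u w + mink u' w := by
  simp only [mink, Pi.add_apply]; ring

theorem mink_sub_left (u u' w : Vec) : mink (u - u') w = mink u w - mink u' w := by
  simp only [mink, Pi.sub_apply]; ring

theorem mink_neg_left (u w : Vec) : mink (-u) w = -mink u w := by
  simp only [mink, Pi.neg_apply]; ring

theorem mink_smul_left (c : ℝ) (u w : Vec) : mink (c • u) w = c * mink u w := by
  simp only [mink, Pi.smul_apply, smul_eq_mul]; ring

theorem mink_add_right (u w w' : Vec) : mink u (w + w') = mink u w + mink u w' := by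
  simp only [mink, Pi.add_apply]; ring

theorem mink_sub_right (u w w' : Vec) : mink u (w - w') = mink u w - mink u w' := by
  simp only [mink, Pi.sub_apply]; ring

theorem mink_neg_right (u w : Vec) : mink u (-w) = -mink u w := by
  simp only [mink, Pi.neg_apply]; ring

theorem mink_smul_right (c : ℝ) (u w : Vec) : mink u (c • w) = c * mink u w := by
  simp only [mink, Pi.smul_apply, smul_eq_mul]; ring

/-- The point of the hyperboloid `mink u u = 1`, `0 < u 0` which represents a point of `ℍ`. -/
def vec (z : ℍ) : Vec := ![1 / z.im, z.re / z.im, (z.re ^ 2 + z.im ^ 2) / z.im]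

@[simp] theorem mink_vec_self (z : ℍ) : mink (vec z) (vec z) = 1 := by
  have := z.im_pos.ne'
  simp [mink, vec]; field_simp; ring

theorem cosh_dist_eq (z w : ℍ) : Real.cosh (dist z w) = mink (vec z) (vec w) := by
  have hz := z.im_pos.ne'
  have hw := w.im_pos.ne'
  rw [UpperHalfPlane.cosh_dist, Complex.dist_eq, Complex.sq_norm, Complex.normSq_apply]
  simp [mink, vec]; field_simp; ring

/-- The open future cone. -/
def Future (u : Vec) : Prop := 0 < u 0 ∧ 0 < mink u u

theorem future_vec (z : ℍ) : Future (vec z) := by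
  refine ⟨?_, by simp⟩
  have := z.im_pos
  simp [vec, this]

open Classical in
/-- The point of `ℍ` on the ray of a vector of the future cone (a junk value for other vectors). -/
def ofVec (u : Vec) : ℍ :=
  if h : Future u then ⟨⟨u 1 / u 0, √(mink u u) / u 0⟩, div_pos (Real.sqrt_pos.2 h.2) h.1⟩
  else UpperHalfPlane.I

theorem vec_ofVec {u : Vec} (h : Future u) : vec (ofVec u) = (√(mink u u))⁻¹ • u := by
  have h0 := h.1.ne'
  have hs := (Real.sqrt_pos.2 h.2).ne'
  have hsq : √(mink u u) ^ 2 = u 0 * u 2 - u 1 ^ 2 := by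
    rw [Real.sq_sqrt h.2.le, mink]; ring
  have him : (ofVec u).im = √(mink u u) / u 0 := by rw [ofVec, dif_pos h]; rfl
  have hre : (ofVec u).re = u 1 / u 0 := by rw [ofVec, dif_pos h]; rfl
  funext i
  fin_cases i
  · simp [vec, him, hre]; field_simp
  · simp [vec, him, hre]; field_simp
  · simp [vec, him, hre]; field_simp; rw [hsq]; ring

theorem vec_ofVec_of_unit {u : Vec} (h0 : 0 < u 0) (h : mink u u = 1) : vec (ofVec u) = u := by
  rw [vec_ofVec ⟨h0, by rw [h]; exact one_pos⟩, h]; simp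

theorem dist_eq_zero_of_cosh {z w : ℍ} (h : Real.cosh (dist z w) = 1) : z = w := by
  by_contra hne
  exact (Real.one_lt_cosh.2 (dist_pos.2 hne).ne').ne' h

theorem vec_injective : Function.Injective vec := by
  intro z w h
  have : Real.cosh (dist z w) = 1 := by rw [cosh_dist_eq, h, mink_vec_self]
  exact dist_eq_zero_of_cosh this

theorem ofVec_vec (z : ℍ) : ofVec (vec z) = z :=
  vec_injective (vec_ofVec_of_unit (future_vec z).1 (mink_vec_self z))

theorem Future.smul {u : Vec} (h : Future u) {c : ℝ} (hc : 0 < c) : Future (c • u) :=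
  ⟨by simpa using mul_pos hc h.1, by rw [mink_smul_left, mink_smul_right]; have := h.2; positivity⟩

theorem Future.pos_two {u : Vec} (h : Future u) : 0 < u 2 := by
  have h1 := h.1
  have h2 := h.2
  simp only [mink] at h2
  by_contra hc
  nlinarith [sq_nonneg (u 1), mul_nonneg h1.le (not_lt.1 hc |> neg_nonneg.2)]

theorem Future.mink_pos {u w : Vec} (hu : Future u) (hw : Future w) : 0 < mink u w := by
  obtain ⟨hu0, hu⟩ := id hu
  obtain ⟨hw0, hw'⟩ := id hw
  have hu2 := Future.pos_two ⟨hu0, hu⟩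
  have hw2 := Future.pos_two hw
  simp only [mink] at *
  have h1 : (u 1 * w 1) ^ 2 < (u 0 * u 2) * (w 0 * w 2) := by
    have : (u 1 * w 1) ^ 2 = u 1 ^ 2 * w 1 ^ 2 := by ring
    rw [this]
    exact mul_lt_mul'' (by linarith [sq (u 1)]) (by linarith [sq (w 1)]) (sq_nonneg _) (sq_nonneg _)
  have h2 : |u 1 * w 1| < (u 0 * w 2 + u 2 * w 0) / 2 := by
    apply abs_lt_of_sq_lt_sq
    · nlinarith [sq_nonneg (u 0 * w 2 - u 2 * w 0)]
    · positivity
  linarith [le_abs_self (u 1 * w 1)]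

theorem Future.add {u w : Vec} (hu : Future u) (hw : Future w) : Future (u + w) := by
  refine ⟨add_pos hu.1 hw.1, ?_⟩
  rw [mink_add_left, mink_add_right, mink_add_right, mink_comm w u]
  have := hu.mink_pos hw
  linarith [hu.2, hw.2]

theorem Future.comb {u w : Vec} (hu : Future u) (hw : Future w) {α β : ℝ} (hα : 0 ≤ α)
    (hβ : 0 ≤ β) (h : 0 < α + β) : Future (α • u + β • w) := by
  rcases hα.eq_or_lt with rfl | hα
  · simpa using hw.smul (by simpa using h)
  rcases hβ.eq_or_lt with rfl | hβ
  · simpa using hu.smul hα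
  exact (hu.smul hα).add (hw.smul hβ)

/-- A timelike vector with positive product with a future vector is itself future. -/
theorem future_of_mink_pos {u w : Vec} (hw : 0 < mink w w) (hu : Future u) (h : 0 < mink w u) :
    Future w := by
  refine ⟨?_, hw⟩
  by_contra hc
  have h0 : w 0 ≠ 0 := by
    intro h0
    simp only [mink, h0] at hw
    nlinarith [sq_nonneg (w 1)]
  have hneg : Future (-w) := by
    refine ⟨?_, by rwa [mink_neg_left, mink_neg_right, neg_neg]⟩
    simpa using lt_of_le_of_ne (not_lt.1 hc) h0
  have := hneg.mink_pos hu
  rw [mink_neg_left] at this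
  linarith

/-- The orthogonal complement of a future vector is negative semidefinite. -/
theorem mink_self_nonpos_of_orthogonal {u w : Vec} (hu : Future u) (h : mink u w = 0) :
    mink w w ≤ 0 := by
  by_contra hc
  push Not at hc
  have h0 := hu.1
  have h2 := hu.pos_two
  have huu := hu.2
  -- one of `w`, `-w` would be future
  have hw0 : w 0 ≠ 0 := by
    intro h0
    simp only [mink, h0] at hc
    nlinarith [sq_nonneg (w 1)]
  rcases lt_or_gt_of_ne hw0 with hw | hw
  · have : Future (-w) := ⟨by simpa using hw, by rwa [mink_neg_left, mink_neg_right, neg_neg]⟩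
    have := hu.mink_pos this
    rw [mink_neg_right] at this
    linarith
  · have := hu.mink_pos ⟨hw, hc⟩
    linarith

theorem eq_of_mink_eq_one {u : Vec} {z : ℍ} (hu : mink u u = 1) (h : mink u (vec z) = 1) :
    u = vec z := by
  have hf := future_of_mink_pos (by rw [hu]; exact one_pos) (future_vec z)
    (by rw [h]; exact one_pos)
  have h1 := vec_ofVec_of_unit hf.1 hu
  have : Real.cosh (dist (ofVec u) z) = 1 := by rw [cosh_dist_eq, h1, h]
  rw [← dist_eq_zero_of_cosh this, h1]

theorem continuous_vec : Continuous vec := by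
  have h : ∀ z : ℍ, z.im ≠ 0 := fun z => z.im_pos.ne'
  have h1 : Continuous fun z : ℍ => z.im := UpperHalfPlane.continuous_im
  have h2 : Continuous fun z : ℍ => z.re := UpperHalfPlane.continuous_re
  refine continuous_pi fun i => ?_
  fin_cases i
  · have := h1.inv₀ h
    simpa [vec, Pi.inv_def] using this
  · have := h2.div h1 h
    simpa [vec, Pi.div_def] using this
  · have := ((h2.pow 2).add (h1.pow 2)).div h1 h
    simpa [vec, Pi.div_def, Pi.add_def, Pi.pow_def] using this

theorem continuous_mink {X : Type*} [TopologicalSpace X] {f g : X → Vec} (hf : Continuous f)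
    (hg : Continuous g) : Continuous fun x => mink (f x) (g x) := by
  simp only [mink]; fun_prop

theorem continuous_ofVec {X : Type*} [TopologicalSpace X] {f : X → Vec} (hf : Continuous f)
    (h : ∀ x, Future (f x)) : Continuous fun x => ofVec (f x) := by
  rw [UpperHalfPlane.isEmbedding_coe.continuous_iff]
  have : ((fun z : ℍ => (z : ℂ)) ∘ fun x => ofVec (f x)) = fun x =>
      ((f x 1 / f x 0 : ℝ) : ℂ) + ((√(mink (f x) (f x)) / f x 0 : ℝ) : ℂ) * Complex.I := by
    funext x
    rw [Function.comp_apply, ofVec, dif_pos (h x)]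
    exact Complex.mk_eq_add_mul_I _ _
  have h0 : ∀ x, f x 0 ≠ 0 := fun x => (h x).1.ne'
  have hi : ∀ i, Continuous fun x => f x i := fun i => (continuous_apply i).comp hf
  have hm := continuous_mink hf hf
  rw [this]
  exact (Complex.continuous_ofReal.comp ((hi 1).div (hi 0) h0)).add
    ((Complex.continuous_ofReal.comp ((hm.sqrt).div (hi 0) h0)).mul continuous_const)

/-- Expansion of the Minkowski form in an orthonormal frame. -/
theorem mink_eq_frame {F M n : Vec} (hF : mink F F = 1) (hM : mink M M = -1) (hn : mink n n = -1)
    (hFM : mink F M = 0) (hFn : mink F n = 0) (hMn : mink M n = 0) (u w : Vec) :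
    mink u w = mink u F * mink w F - mink u M * mink w M - mink u n * mink w n := by
  -- `A` is the matrix of the frame, `B` its Minkowski adjoint; `A * B = 1` gives `B * A = 1`.
  let A : Matrix (Fin 3) (Fin 3) ℝ := !![F 0, F 1, F 2; M 0, M 1, M 2; n 0, n 1, n 2]
  let B : Matrix (Fin 3) (Fin 3) ℝ :=
    !![F 2 / 2, -M 2 / 2, -n 2 / 2; -F 1, M 1, n 1; F 0 / 2, -M 0 / 2, -n 0 / 2]
  simp only [mink] at hF hM hn hFM hFn hMn
  have hAB : A * B = 1 := by
    ext i j
    fin_cases i <;> fin_cases j <;>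
      simp [A, B, Matrix.mul_apply, Fin.sum_univ_three] <;> linarith
  have hBA := mul_eq_one_comm.1 hAB
  have h := fun i j => congrFun (congrFun hBA i) j
  have h00 := h 0 0
  have h01 := h 0 1
  have h02 := h 0 2
  have h10 := h 1 0
  have h11 := h 1 1
  have h12 := h 1 2
  have h20 := h 2 0
  have h21 := h 2 1
  have h22 := h 2 2
  simp [A, B, Matrix.mul_apply, Fin.sum_univ_three] at h00 h01 h02 h10 h11 h12 h20 h21 h22
  simp only [mink]
  linear_combination -u 0 * (w 0 / 2 * h02 - w 1 * h01 + w 2 / 2 * h00)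
    - u 1 * (w 0 / 2 * h12 - w 1 * h11 + w 2 / 2 * h10)
    - u 2 * (w 0 / 2 * h22 - w 1 * h21 + w 2 / 2 * h20)

theorem mink_ext {u w : Vec} (h : ∀ x, mink u x = mink w x) : u = w := by
  funext i
  have h0 := h ![1, 0, 0]
  have h1 := h ![0, 1, 0]
  have h2 := h ![0, 0, 1]
  simp [mink] at h0 h1 h2
  fin_cases i
  · simpa using h2
  · simpa using h1
  · simpa using h0

/-- Expansion of a vector in an orthonormal frame. -/
theorem eq_frame {F M n : Vec} (hF : mink F F = 1) (hM : mink M M = -1) (hn : mink n n = -1)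
    (hFM : mink F M = 0) (hFn : mink F n = 0) (hMn : mink M n = 0) (u : Vec) :
    u = mink u F • F - mink u M • M - mink u n • n := by
  refine mink_ext fun x => ?_
  rw [mink_eq_frame hF hM hn hFM hFn hMn u x]
  simp only [mink_sub_left, mink_smul_left, mink_comm x]

/-! ### Geodesic segments and lines -/

theorem mem_geodSegment_of_comb {x y z : ℍ} {α β : ℝ} (hα : 0 ≤ α) (hβ : 0 ≤ β)
    (h : vec z = α • vec x + β • vec y) : z ∈ geodSegment x y := by
  have hc := cosh_dist_eq x y
  have hx := cosh_dist_eq x z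
  have hy := cosh_dist_eq z y
  have h1 := mink_vec_self z
  rw [h] at hx hy h1
  simp only [mink_add_left, mink_add_right, mink_smul_left, mink_smul_right, mink_vec_self,
    mink_comm (vec y) (vec x), ← hc] at hx hy h1
  have hd1 : 0 ≤ Real.sinh (dist x z) := Real.sinh_nonneg_iff.2 dist_nonneg
  have hd2 : 0 ≤ Real.sinh (dist z y) := Real.sinh_nonneg_iff.2 dist_nonneg
  have hs1 := Real.cosh_sq (dist x z)
  have hs2 := Real.cosh_sq (dist z y)
  have hs := Real.cosh_sq (dist x y)
  have hd : 0 ≤ Real.sinh (dist x y) := Real.sinh_nonneg_iff.2 dist_nonneg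
  set C := Real.cosh (dist x y)
  set S := Real.sinh (dist x y)
  have e1 : Real.sinh (dist x z) = β * S := by
    refine (pow_left_inj₀ hd1 (by positivity) two_ne_zero).1 ?_
    rw [eq_sub_of_add_eq hs1.symm, hx, mul_pow, eq_sub_of_add_eq hs.symm]
    linear_combination h1
  have e2 : Real.sinh (dist z y) = α * S := by
    refine (pow_left_inj₀ hd2 (by positivity) two_ne_zero).1 ?_
    rw [eq_sub_of_add_eq hs2.symm, hy, mul_pow, eq_sub_of_add_eq hs.symm]
    linear_combination h1
  have : Real.cosh (dist x z + dist z y) = Real.cosh (dist x y) := by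
    rw [Real.cosh_add, hx, hy, e1, e2]
    change _ = C
    linear_combination C * h1 - α * β * hs
  exact Real.cosh_strictMonoOn.injOn (add_nonneg dist_nonneg dist_nonneg : (0:ℝ) ≤ _)
    (dist_nonneg : (0:ℝ) ≤ _) this

theorem exists_comb_of_mem_geodSegment {x y z : ℍ} (h : z ∈ geodSegment x y) :
    ∃ α β : ℝ, 0 ≤ α ∧ 0 ≤ β ∧ vec z = α • vec x + β • vec y := by
  change dist x z + dist z y = dist x y at h
  rcases eq_or_ne x y with rfl | hne
  · refine ⟨1, 0, zero_le_one, le_rfl, ?_⟩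
    have : dist x z = 0 := by
      rw [dist_self] at h; linarith [dist_nonneg (x := x) (y := z), dist_nonneg (x := z) (y := x)]
    rw [dist_eq_zero.1 this]; simp
  have hS : 0 < Real.sinh (dist x y) := Real.sinh_pos_iff.2 (dist_pos.2 hne)
  have hd1 : 0 ≤ Real.sinh (dist x z) := Real.sinh_nonneg_iff.2 dist_nonneg
  have hd2 : 0 ≤ Real.sinh (dist z y) := Real.sinh_nonneg_iff.2 dist_nonneg
  refine ⟨Real.sinh (dist z y) / Real.sinh (dist x y), Real.sinh (dist x z) / Real.sinh (dist x y),
    by positivity, by positivity, ?_⟩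
  have hadd := Real.sinh_add (dist x z) (dist z y)
  have hcadd := Real.cosh_add (dist x z) (dist z y)
  rw [h] at hadd hcadd
  have hs1 := Real.cosh_sq (dist x z)
  have hs2 := Real.cosh_sq (dist z y)
  have hne' := hS.ne'
  refine (eq_of_mink_eq_one ?_ ?_).symm
  · simp only [mink_add_left, mink_add_right, mink_smul_left, mink_smul_right, mink_vec_self,
      mink_comm (vec y) (vec x), ← cosh_dist_eq]
    field_simp
    rw [hadd, hcadd]
    linear_combination -(Real.sinh (dist z y)^2) * hs1 - (Real.sinh (dist x z)^2) * hs2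
  · simp only [mink_add_left, mink_smul_left, ← cosh_dist_eq]
    rw [dist_comm y z]
    field_simp
    rw [hadd]; ring

theorem self_mem_geodSegment_left (x y : ℍ) : x ∈ geodSegment x y := by simp [geodSegment]

theorem self_mem_geodSegment_right (x y : ℍ) : y ∈ geodSegment x y := by simp [geodSegment]

/-- A point orthogonal to a unit normal vector of a geodesic line lies on this line. -/
theorem mem_geodLine_of_orthogonal {x y z : ℍ} (hxy : x ≠ y) {N : Vec} (hN : mink N N = -1)
    (hx : mink (vec x) N = 0) (hy : mink (vec y) N = 0) (hz : mink (vec z) N = 0) :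
    z ∈ geodLine x y := by
  have hd := dist_pos.2 hxy
  have hS : 0 < Real.sinh (dist x y) := Real.sinh_pos_iff.2 hd
  have hcs := Real.cosh_sq (dist x y)
  -- `M` is the unit tangent vector at `x` towards `y`
  set M : Vec := (Real.sinh (dist x y))⁻¹ • (vec y - Real.cosh (dist x y) • vec x) with hM
  have hxM : mink (vec x) M = 0 := by
    rw [hM, mink_smul_right, mink_sub_right, mink_smul_right, mink_vec_self, ← cosh_dist_eq]; ring
  have hMM : mink M M = -1 := by
    rw [hM]
    simp only [mink_smul_right, mink_sub_right, mink_smul_left, mink_sub_left, mink_vec_self,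
      mink_comm (vec y) (vec x), ← cosh_dist_eq]
    field_simp; linear_combination -hcs
  have hMN : mink M N = 0 := by
    rw [hM, mink_smul_left, mink_sub_left, mink_smul_left, hx, hy]; ring
  have hyM : mink (vec y) M = -Real.sinh (dist x y) := by
    rw [hM, mink_smul_right, mink_sub_right, mink_smul_right, mink_vec_self,
      mink_comm (vec y) (vec x), ← cosh_dist_eq]
    field_simp; linear_combination -hcs
  have hzz := mink_eq_frame (mink_vec_self x) hMM hN hxM hx hMN (vec z) (vec z)
  have hzy := mink_eq_frame (mink_vec_self x) hMM hN hxM hx hMN (vec z) (vec y)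
  rw [mink_vec_self, hz, mink_comm _ (vec x), ← cosh_dist_eq] at hzz
  rw [hy, hyM, mink_comm _ (vec x), mink_comm (vec y) (vec x), ← cosh_dist_eq, ← cosh_dist_eq,
    ← cosh_dist_eq] at hzy
  have hcs' := Real.cosh_sq (dist x z)
  have hsq : (mink (vec z) M) ^ 2 = Real.sinh (dist x z) ^ 2 := by linear_combination hcs' + hzz
  rcases sq_eq_sq_iff_eq_or_eq_neg.1 hsq with h | h
  · -- `x` is between `z` and `y`
    right; right
    have : Real.cosh (dist z x + dist x y) = Real.cosh (dist z y) := by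
      rw [Real.cosh_add, hzy, h, dist_comm z x]; ring
    exact Real.cosh_strictMonoOn.injOn (add_nonneg dist_nonneg dist_nonneg : (0:ℝ) ≤ _)
      (dist_nonneg : (0:ℝ) ≤ _) this
  · have h1 : Real.cosh (dist x y - dist x z) = Real.cosh (dist z y) := by
      rw [Real.cosh_sub, hzy, h]; ring
    rcases le_total (dist x z) (dist x y) with hle | hle
    · left
      have := Real.cosh_strictMonoOn.injOn (sub_nonneg.2 hle : (0:ℝ) ≤ _)
        (dist_nonneg : (0:ℝ) ≤ _) h1
      change dist x z + dist z y = dist x y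
      linarith
    · right; left
      rw [← Real.cosh_neg, neg_sub] at h1
      have := Real.cosh_strictMonoOn.injOn (sub_nonneg.2 hle : (0:ℝ) ≤ _)
        (dist_nonneg : (0:ℝ) ≤ _) h1
      change dist x y + dist y z = dist x z
      rw [dist_comm y z]
      linarith

/-- Closed half-planes are geodesically convex. -/
theorem geodConvex_halfPlane (N : Vec) : GeodConvex {z | 0 ≤ mink (vec z) N} := by
  intro x hx y hy z hz
  obtain ⟨α, β, hα, hβ, h⟩ := exists_comb_of_mem_geodSegment hz
  change 0 ≤ mink (vec _) N at *
  rw [h, mink_add_left, mink_smul_left, mink_smul_left]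
  positivity

/-! ### Reflections -/

/-- The reflection in the orthogonal complement of a vector `N` with `mink N N = -1`. -/
def reflect (N u : Vec) : Vec := u + (2 * mink u N) • N

theorem mink_reflect {N : Vec} (hN : mink N N = -1) (u w : Vec) :
    mink (reflect N u) (reflect N w) = mink u w := by
  simp only [reflect, mink_add_left, mink_add_right, mink_smul_left, mink_smul_right, hN,
    mink_comm N]
  ring

theorem reflect_reflect {N : Vec} (hN : mink N N = -1) (u : Vec) :
    reflect N (reflect N u) = u := by
  simp only [reflect, mink_add_left, mink_smul_left, hN]
  module

theorem reflect_add (N u w : Vec) : reflect N (u + w) = reflect N u + reflect N w := by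
  simp only [reflect, mink_add_left]; module

theorem reflect_smul (N : Vec) (c : ℝ) (u : Vec) : reflect N (c • u) = c • reflect N u := by
  simp only [reflect, mink_smul_left]; module

theorem reflect_vec_pos {N : Vec} (hN : mink N N = -1) (z : ℍ) : 0 < reflect N (vec z) 0 := by
  refine (future_of_mink_pos (u := vec z) ?_ (future_vec z) ?_).1
  · rw [mink_reflect hN, mink_vec_self]; exact one_pos
  · rw [reflect, mink_add_left, mink_smul_left, mink_vec_self, mink_comm N]
    nlinarith [sq_nonneg (mink (vec z) N)]

theorem vec_ofVec_reflect {N : Vec} (hN : mink N N = -1) (z : ℍ) :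
    vec (ofVec (reflect N (vec z))) = reflect N (vec z) :=
  vec_ofVec_of_unit (reflect_vec_pos hN z) (by rw [mink_reflect hN, mink_vec_self])

/-- The reflection of `ℍ` in the geodesic line with unit normal vector `N`. -/
def reflIso (N : Vec) (hN : mink N N = -1) : ℍ ≃ᵢ ℍ where
  toFun z := ofVec (reflect N (vec z))
  invFun z := ofVec (reflect N (vec z))
  left_inv z := by beta_reduce; rw [vec_ofVec_reflect hN, reflect_reflect hN, ofVec_vec]
  right_inv z := by beta_reduce; rw [vec_ofVec_reflect hN, reflect_reflect hN, ofVec_vec]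
  isometry_toFun := Isometry.of_dist_eq fun z w => by
    refine Real.cosh_strictMonoOn.injOn (dist_nonneg : (0:ℝ) ≤ _) (dist_nonneg : (0:ℝ) ≤ _) ?_
    rw [cosh_dist_eq, cosh_dist_eq, vec_ofVec_reflect hN, vec_ofVec_reflect hN, mink_reflect hN]

theorem vec_reflIso {N : Vec} (hN : mink N N = -1) (z : ℍ) :
    vec (reflIso N hN z) = reflect N (vec z) := vec_ofVec_reflect hN z

theorem reflIso_mul_self {N : Vec} (hN : mink N N = -1) : reflIso N hN * reflIso N hN = 1 := by
  ext1 z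
  exact (reflIso N hN).left_inv z

theorem reflIso_apply_of_orthogonal {N : Vec} (hN : mink N N = -1) {z : ℍ}
    (h : mink (vec z) N = 0) : reflIso N hN z = z := by
  apply vec_injective
  rw [vec_reflIso, reflect, h]; simp

section

/-! ### The seam lines of the hexagon -/

/-- `cosh a`, where `a = 9 / 20` is the length of the boundary sides. -/
def chA : ℝ := Real.cosh (9 / 20)

/-- `sinh a`, where `a = 9 / 20` is the length of the boundary sides. -/
def shA : ℝ := Real.sinh (9 / 20)

theorem shA_pos : 0 < shA := Real.sinh_pos_iff.2 (by norm_num)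

theorem one_lt_chA : 1 < chA := Real.one_lt_cosh.2 (by norm_num)

theorem chA_sq : chA ^ 2 = shA ^ 2 + 1 := Real.cosh_sq _

/-- First vertex of the `k`-th boundary side. -/
def vs (v : Fin 6 → ℍ) (k : Fin 3) : ℍ := v (![0, 2, 4] k)

/-- Second vertex of the `k`-th boundary side. -/
def ve (v : Fin 6 → ℍ) (k : Fin 3) : ℍ := v (![1, 3, 5] k)

theorem boundarySide_eq (v : Fin 6 → ℍ) (k : Fin 3) :
    boundarySide v k = geodSegment (vs v k) (ve v k) := rfl

theorem seamSide_eq (v : Fin 6 → ℍ) (k : Fin 3) :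
    seamSide v k = geodSegment (ve v k) (vs v (k + 1)) := by
  fin_cases k <;> rfl

/-- The unit normal vector of the line that carries the `k`-th seam, which points to the side of
the hexagon: the outer tangent vector of the `k`-th boundary side at its second vertex. -/
def seamNormal (v : Fin 6 → ℍ) (k : Fin 3) : Vec := shA⁻¹ • (chA • vec (ve v k) - vec (vs v k))

/-- The seam normals of the hexagon form a basis with a known Gram matrix, in which the vertices
have known coordinates. (Indices are modulo `3`; `k + 2` stands for `k - 1`.) -/
structure IsHexFrame (v : Fin 6 → ℍ) : Prop where
  self : ∀ k, mink (seamNormal v k) (seamNormal v k) = -1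
  ne : ∀ k l, k ≠ l → mink (seamNormal v k) (seamNormal v l) = chA
  vs_eq : ∀ k, vec (vs v k) = shA⁻¹ • (chA • seamNormal v (k + 2) + seamNormal v k)
  ve_eq : ∀ k, vec (ve v k) = shA⁻¹ • (chA • seamNormal v k + seamNormal v (k + 2))

/-- Uniqueness up to sign of the unit normal vector of a line. -/
theorem eq_or_eq_neg_of_orthogonal {x y : ℍ} (hxy : x ≠ y) {N N' : Vec} (hN : mink N N = -1)
    (hN' : mink N' N' = -1) (hx : mink (vec x) N = 0) (hy : mink (vec y) N = 0)
    (hx' : mink (vec x) N' = 0) (hy' : mink (vec y) N' = 0) : N' = N ∨ N' = -N := by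
  have hd := dist_pos.2 hxy
  have hS : 0 < Real.sinh (dist x y) := Real.sinh_pos_iff.2 hd
  have hcs := Real.cosh_sq (dist x y)
  set M : Vec := (Real.sinh (dist x y))⁻¹ • (vec y - Real.cosh (dist x y) • vec x) with hM
  have hxM : mink (vec x) M = 0 := by
    rw [hM, mink_smul_right, mink_sub_right, mink_smul_right, mink_vec_self, ← cosh_dist_eq]; ring
  have hMM : mink M M = -1 := by
    rw [hM]
    simp only [mink_smul_right, mink_sub_right, mink_smul_left, mink_sub_left, mink_vec_self,
      mink_comm (vec y) (vec x), ← cosh_dist_eq]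
    field_simp; linear_combination -hcs
  have hMN : mink M N = 0 := by
    rw [hM, mink_smul_left, mink_sub_left, mink_smul_left, hx, hy]; ring
  have hMN' : mink M N' = 0 := by
    rw [hM, mink_smul_left, mink_sub_left, mink_smul_left, hx', hy']; ring
  have h := eq_frame (mink_vec_self x) hMM hN hxM hx hMN N'
  rw [mink_comm N' (vec x), mink_comm N' M, hx', hMN'] at h
  have h2 : N' = (-mink N' N) • N := by
    conv_lhs => rw [h]
    module
  have h3 : (-mink N' N) ^ 2 = 1 := by
    have := hN'
    rw [h2, mink_smul_left, mink_smul_right, hN] at this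
    linear_combination -this
  rcases mul_self_eq_one_iff.1 ((sq _).symm.trans h3) with h4 | h4
  · left; rw [h2, h4, one_smul]
  · right; rw [h2, h4, neg_smul, one_smul]

variable {v : Fin 6 → ℍ}

theorem isHexFrame (hv : IsRightAngledHexagon v) (hlen : ∀ k, Pants.bdryLength v k = 9 / 10) :
    IsHexFrame v := by
  have hσ := shA_pos
  have hσ' := hσ.ne'
  have hκσ := chA_sq
  have hd : ∀ k, mink (vec (vs v k)) (vec (ve v k)) = chA := fun k => by
    rw [← cosh_dist_eq, chA]
    have := hlen k
    rw [Pants.bdryLength] at this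
    congr 1
    change dist (v (![0, 2, 4] k)) (v (![1, 3, 5] k)) = _
    linarith
  have hd' : ∀ k, mink (vec (ve v k)) (vec (vs v k)) = chA := fun k => by rw [mink_comm, hd]
  -- the right angles, in terms of the two boundary sides adjacent to a seam
  have hre : ∀ k, mink (vec (vs v k)) (vec (vs v (k + 1))) =
      chA * mink (vec (ve v k)) (vec (vs v (k + 1))) := fun k => by
    rw [← hd k, ← cosh_dist_eq, ← cosh_dist_eq, ← cosh_dist_eq]
    fin_cases k
    exacts [hv.right_angle 1, hv.right_angle 3, hv.right_angle 5]
  have hrs : ∀ k, mink (vec (ve v k)) (vec (ve v (k + 1))) =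
      chA * mink (vec (ve v k)) (vec (vs v (k + 1))) := fun k => by
    rw [← hd (k + 1), mul_comm, ← cosh_dist_eq, ← cosh_dist_eq, ← cosh_dist_eq]
    fin_cases k
    exacts [hv.right_angle 2, hv.right_angle 4, hv.right_angle 0]
  have hne : ∀ k, ve v k ≠ vs v (k + 1) := fun k => by
    fin_cases k
    exacts [hv.ne 1, hv.ne 3, hv.ne 5]
  have hconv : ∀ k, Disjoint (geodLine (ve v k) (vs v (k + 1)))
      (geodSegment (vs v k) (ve v (k + 1))) := fun k => by
    fin_cases k
    · exact hv.convex 1 0 3 (by decide) (by decide) (by decide) (by decide)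
    · exact hv.convex 3 2 5 (by decide) (by decide) (by decide) (by decide)
    · exact hv.convex 5 4 1 (by decide) (by decide) (by decide) (by decide)
  have self : ∀ k, mink (seamNormal v k) (seamNormal v k) = -1 := fun k => by
    simp only [seamNormal, mink_smul_left, mink_smul_right, mink_sub_left, mink_sub_right, hd, hd',
      mink_vec_self]
    field_simp
    linear_combination -hκσ
  -- the same normal vector, from the boundary side at the other end of the seam
  set N' : Fin 3 → Vec := fun k => shA⁻¹ • (chA • vec (vs v (k + 1)) - vec (ve v (k + 1))) with hN'
  have self' : ∀ k, mink (N' k) (N' k) = -1 := fun k => by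
    simp only [hN', mink_smul_left, mink_smul_right, mink_sub_left, mink_sub_right, hd, hd',
      mink_vec_self]
    field_simp
    linear_combination -hκσ
  have h1 : ∀ k, mink (vec (ve v k)) (seamNormal v k) = 0 := fun k => by
    simp only [seamNormal, mink_smul_right, mink_sub_right, hd', mink_vec_self]; ring
  have h2 : ∀ k, mink (vec (vs v (k + 1))) (seamNormal v k) = 0 := fun k => by
    simp only [seamNormal, mink_smul_right, mink_sub_right]
    rw [mink_comm _ (vec (ve v k)), mink_comm _ (vec (vs v k)), hre]; ring
  have h1' : ∀ k, mink (vec (ve v k)) (N' k) = 0 := fun k => by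
    simp only [hN', mink_smul_right, mink_sub_right]
    rw [hrs]; ring
  have h2' : ∀ k, mink (vec (vs v (k + 1))) (N' k) = 0 := fun k => by
    simp only [hN', mink_smul_right, mink_sub_right, hd, mink_vec_self]; ring
  have hNN : ∀ k, N' k = seamNormal v k := fun k => by
    rcases eq_or_eq_neg_of_orthogonal (hne k) (self k) (self' k) (h1 k) (h2 k) (h1' k) (h2' k)
      with h | h
    · exact h
    · exfalso
      -- otherwise the midpoint of the two outer vertices would lie on the line of the seam
      have hf := (future_vec (vs v k)).add (future_vec (ve v (k + 1)))
      have hvec := vec_ofVec hf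
      have hc : 0 < (√(mink (vec (vs v k) + vec (ve v (k + 1)))
        (vec (vs v k) + vec (ve v (k + 1)))))⁻¹ := inv_pos.2 (Real.sqrt_pos.2 hf.2)
      refine Set.disjoint_left.1 (hconv k) (mem_geodLine_of_orthogonal (hne k) (self k) (h1 k) (h2 k)
        (z := ofVec (vec (vs v k) + vec (ve v (k + 1)))) ?_)
        (mem_geodSegment_of_comb hc.le hc.le (by rw [hvec, smul_add]))
      have e1 : mink (vec (vs v k)) (seamNormal v k) = shA := by
        simp only [seamNormal, mink_smul_right, mink_sub_right, hd, mink_vec_self]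
        field_simp; linear_combination hκσ
      have e2 : mink (vec (ve v (k + 1))) (N' k) = shA := by
        simp only [hN', mink_smul_right, mink_sub_right, hd', mink_vec_self]
        field_simp; linear_combination hκσ
      rw [h, mink_neg_right] at e2
      rw [hvec, mink_smul_left, mink_add_left (vec (vs v k)) _ (seamNormal v k), e1]
      have : mink (vec (ve v (k + 1))) (seamNormal v k) = -shA := by linarith
      rw [this]; ring
  have hprev : ∀ k, seamNormal v (k + 2) = shA⁻¹ • (chA • vec (vs v k) - vec (ve v k)) := fun k => by
    rw [← hNN (k + 2)]
    have : k + 2 + 1 = k := by fin_cases k <;> rfl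
    simp only [hN', this]
  have hadj : ∀ k, mink (seamNormal v (k + 2)) (seamNormal v k) = chA := fun k => by
    rw [hprev k]
    simp only [seamNormal, mink_smul_left, mink_smul_right, mink_sub_left, mink_sub_right, hd, hd',
      mink_vec_self]
    field_simp
    linear_combination chA * hκσ
  refine ⟨self, fun k l hkl => ?_, fun k => ?_, fun k => ?_⟩
  · have : k = l + 2 ∨ l = k + 2 := by revert k l; decide
    rcases this with rfl | rfl
    · exact hadj l
    · rw [mink_comm]; exact hadj k
  · rw [hprev k, seamNormal]
    have : chA ^ 2 - 1 = shA ^ 2 := by linarith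
    have h : shA⁻¹ • (chA • shA⁻¹ • (chA • vec (vs v k) - vec (ve v k)) +
      shA⁻¹ • (chA • vec (ve v k) - vec (vs v k))) = ((shA⁻¹) ^ 2 * (chA ^ 2 - 1)) • vec (vs v k) := by
      module
    rw [h, this]
    field_simp
    simp
  · rw [hprev k, seamNormal]
    have : chA ^ 2 - 1 = shA ^ 2 := by linarith
    have h : shA⁻¹ • (chA • shA⁻¹ • (chA • vec (ve v k) - vec (vs v k)) +
      shA⁻¹ • (chA • vec (vs v k) - vec (ve v k))) = ((shA⁻¹) ^ 2 * (chA ^ 2 - 1)) • vec (ve v k) := by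
      module
    rw [h, this]
    field_simp
    simp

/-- The function whose sign tells on which side of the `k`-th seam line a point lies. -/
def seamFn (v : Fin 6 → ℍ) (k : Fin 3) (z : ℍ) : ℝ := mink (vec z) (seamNormal v k)

theorem continuous_seamFn (k : Fin 3) : Continuous (seamFn v k) :=
  continuous_mink continuous_vec continuous_const

theorem fin3_cases (i l : Fin 3) : l = i ∨ l = i + 1 ∨ l = i + 2 := by revert i l; decide

theorem fin3_add_one_add_two (k : Fin 3) : k + 1 + 2 = k := by revert k; decide

namespace IsHexFrame

variable (H : IsHexFrame v)
include H

theorem seamFn_vs_self (k : Fin 3) : seamFn v k (vs v k) = shA := by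
  have := shA_pos.ne'
  rw [seamFn, H.vs_eq, mink_smul_left, mink_add_left, mink_smul_left, H.self,
    H.ne _ _ (by revert k; decide)]
  field_simp; linear_combination chA_sq

theorem seamFn_vs_prev (k : Fin 3) : seamFn v (k + 2) (vs v k) = 0 := by
  rw [seamFn, H.vs_eq, mink_smul_left, mink_add_left, mink_smul_left, H.self,
    H.ne _ _ (by revert k; decide)]
  ring

theorem seamFn_vs_opp (k : Fin 3) : seamFn v (k + 1) (vs v k) = chA * (chA + 1) / shA := by
  rw [seamFn, H.vs_eq, mink_smul_left, mink_add_left, mink_smul_left,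
    H.ne _ _ (by revert k; decide), H.ne _ _ (by revert k; decide)]
  ring

theorem seamFn_ve_self (k : Fin 3) : seamFn v k (ve v k) = 0 := by
  rw [seamFn, H.ve_eq, mink_smul_left, mink_add_left, mink_smul_left, H.self,
    H.ne _ _ (by revert k; decide)]
  ring

theorem seamFn_ve_prev (k : Fin 3) : seamFn v (k + 2) (ve v k) = shA := by
  have := shA_pos.ne'
  rw [seamFn, H.ve_eq, mink_smul_left, mink_add_left, mink_smul_left, H.self,
    H.ne _ _ (by revert k; decide)]
  field_simp; linear_combination chA_sq

theorem seamFn_ve_opp (k : Fin 3) : seamFn v (k + 1) (ve v k) = chA * (chA + 1) / shA := by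
  rw [seamFn, H.ve_eq, mink_smul_left, mink_add_left, mink_smul_left,
    H.ne _ _ (by revert k; decide), H.ne _ _ (by revert k; decide)]
  ring

theorem seamFn_vs_nonneg (k l : Fin 3) : 0 ≤ seamFn v l (vs v k) := by
  have := shA_pos
  have := one_lt_chA
  rcases fin3_cases k l with rfl | rfl | rfl
  · rw [H.seamFn_vs_self]; positivity
  · rw [H.seamFn_vs_opp]; positivity
  · rw [H.seamFn_vs_prev]

theorem seamFn_ve_nonneg (k l : Fin 3) : 0 ≤ seamFn v l (ve v k) := by
  have := shA_pos
  have := one_lt_chA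
  rcases fin3_cases k l with rfl | rfl | rfl
  · rw [H.seamFn_ve_self]
  · rw [H.seamFn_ve_opp]; positivity
  · rw [H.seamFn_ve_prev]; positivity

theorem seamFn_nonneg {z : ℍ} (hz : z ∈ hexRegion v) (k : Fin 3) : 0 ≤ seamFn v k z := by
  refine hz _ ⟨geodConvex_halfPlane (seamNormal v k), ?_⟩
  rintro _ ⟨j, rfl⟩
  change 0 ≤ seamFn v k (v j)
  fin_cases j
  exacts [H.seamFn_vs_nonneg 0 k, H.seamFn_ve_nonneg 0 k, H.seamFn_vs_nonneg 1 k,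
    H.seamFn_ve_nonneg 1 k, H.seamFn_vs_nonneg 2 k, H.seamFn_ve_nonneg 2 k]

theorem seamFn_eq_zero {z : ℍ} {k : Fin 3} (hz : z ∈ seamSide v k) : seamFn v k z = 0 := by
  rw [seamSide_eq] at hz
  obtain ⟨α, β, -, -, h⟩ := exists_comb_of_mem_geodSegment hz
  have h1 := H.seamFn_ve_self k
  have h2 := H.seamFn_vs_prev (k + 1)
  rw [fin3_add_one_add_two] at h2
  simp only [seamFn] at *
  rw [h, mink_add_left, mink_smul_left, mink_smul_left, h1, h2]; ring

/-- Distinct seam lines are disjoint. -/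
theorem not_seamFn_eq_zero {z : ℍ} {k l : Fin 3} (hkl : k ≠ l) (hk : seamFn v k z = 0)
    (hl : seamFn v l z = 0) : False := by
  have h := mink_self_nonpos_of_orthogonal (w := seamNormal v k + seamNormal v l) (future_vec z)
    (by rw [mink_add_right]; simp only [seamFn] at hk hl; rw [hk, hl]; ring)
  rw [mink_add_left, mink_add_right, mink_add_right, H.self, H.self, H.ne _ _ hkl,
    H.ne _ _ hkl.symm] at h
  linarith [one_lt_chA]

theorem seamFn_pos_of_mem_seamSide {z : ℍ} {k l : Fin 3} (hz : z ∈ seamSide v k) (hkl : l ≠ k) :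
    0 < seamFn v l z := by
  refine lt_of_le_of_ne (H.seamFn_nonneg (seams_subset_hexRegion v (mem_iUnion.2 ⟨k, hz⟩)) l) ?_
  intro h
  exact H.not_seamFn_eq_zero hkl h.symm (H.seamFn_eq_zero hz)

end IsHexFrame

/-- The reflection in the line that carries the `k`-th seam. -/
def seamRefl (H : IsHexFrame v) (k : Fin 3) : ℍ ≃ᵢ ℍ := reflIso (seamNormal v k) (H.self k)

theorem vec_seamRefl (H : IsHexFrame v) (k : Fin 3) (z : ℍ) :
    vec (seamRefl H k z) = reflect (seamNormal v k) (vec z) := vec_reflIso _ _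

theorem seamRefl_mul_self (H : IsHexFrame v) (k : Fin 3) : seamRefl H k * seamRefl H k = 1 :=
  reflIso_mul_self _

theorem seamRefl_apply_of_mem (H : IsHexFrame v) {k : Fin 3} {z : ℍ} (hz : z ∈ seamSide v k) :
    seamRefl H k z = z := reflIso_apply_of_orthogonal _ (H.seamFn_eq_zero hz)

end

section

variable {v : Fin 6 → ℍ}

/-! ### The two faces of the pair of pants -/

/-- The two faces, indexed by the booleans: `true` is the face `Pants.inFront`. -/
def inFace : Bool → hexRegion v → Pants v
  | true => Pants.inFront
  | false => Pants.inBack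

theorem isometry_inFace (ε : Bool) : Isometry (inFace (v := v) ε) := by
  cases ε
  · exact Metric.toGlueR_isometry _ _
  · exact Metric.toGlueL_isometry _ _

theorem dist_inFace (ε : Bool) (x y : hexRegion v) :
    dist (inFace ε x) (inFace ε y) = dist (x : ℍ) y := (isometry_inFace ε).dist_eq x y

theorem dist_inFace_not (ε : Bool) (x y : hexRegion v) :
    dist (inFace ε x) (inFace (!ε) y) = ⨅ q : seams v, dist (x : ℍ) q + dist (y : ℍ) q := by
  have h : ∀ x y : hexRegion v, dist (Pants.inFront x) (Pants.inBack y) =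
      ⨅ q : seams v, dist (x : ℍ) q + dist (y : ℍ) q := fun x y => by
    change (⨅ q : seams v, dist (x : ℍ) q + dist (y : ℍ) q) + 0 = _
    rw [add_zero]
  cases ε
  · change dist (Pants.inBack x) (Pants.inFront y) = _
    rw [dist_comm, h]
    simp only [add_comm]
  · exact h x y

theorem bddBelow_range_dist_add (x y : ℍ) :
    BddBelow (range fun q : seams v => dist x q + dist y q) :=
  ⟨0, by rintro _ ⟨q, rfl⟩; positivity⟩

theorem exists_seam_of_dist_lt {ε : Bool} {x y : hexRegion v} {r : ℝ}
    (h : dist (inFace ε x) (inFace (!ε) y) < r) :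
    ∃ q ∈ seams v, dist (x : ℍ) q + dist (y : ℍ) q < r := by
  rw [dist_inFace_not] at h
  obtain ⟨q, hq⟩ := exists_lt_of_ciInf_lt h
  exact ⟨q, q.2, hq⟩

theorem dist_le_dist_inFace (ε ε' : Bool) (x y : hexRegion v) :
    dist (x : ℍ) y ≤ dist (inFace ε x) (inFace ε' y) := by
  by_cases h : ε' = ε
  · rw [h, dist_inFace]
  · obtain rfl : ε' = !ε := by cases ε <;> cases ε' <;> simp_all
    rw [dist_inFace_not]
    exact le_ciInf fun q => dist_triangle_right _ _ _

theorem inFace_eq_of_mem_seams {x : hexRegion v} (hx : (x : ℍ) ∈ seams v) (ε ε' : Bool) :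
    inFace ε x = inFace ε' x := by
  have h : ∀ ε, inFace ε x = inFace (!ε) x := fun ε => by
    refine dist_le_zero.1 ?_
    rw [dist_inFace_not]
    exact (ciInf_le (bddBelow_range_dist_add _ _) ⟨x, hx⟩).trans (by simp)
  cases ε <;> cases ε'
  exacts [rfl, h false, h true, rfl]

theorem isClosed_geodSegment (x y : ℍ) : IsClosed (geodSegment x y) :=
  isClosed_eq (by fun_prop) continuous_const

theorem isClosed_seams (v : Fin 6 → ℍ) : IsClosed (seams v) :=
  isClosed_iUnion_of_finite fun _ => isClosed_geodSegment _ _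

theorem eq_of_inFace_eq {ε ε' : Bool} {x y : hexRegion v} (h : inFace ε x = inFace ε' y) :
    x = y := by
  have := dist_le_dist_inFace ε ε' x y
  rw [h, dist_self] at this
  exact Subtype.ext (dist_le_zero.1 this)

theorem mem_seams_of_inFace_eq {ε : Bool} {x y : hexRegion v} (h : inFace ε x = inFace (!ε) y) :
    (x : ℍ) ∈ seams v := by
  rw [← (isClosed_seams v).closure_eq, Metric.mem_closure_iff]
  intro r hr
  obtain ⟨q, hq, hlt⟩ := exists_seam_of_dist_lt (r := r) (ε := ε) (x := x) (y := y)
    (by rw [h, dist_self]; exact hr)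
  exact ⟨q, hq, by linarith [dist_nonneg (x := (y : ℍ)) (y := q)]⟩

theorem exists_eq_inFace (x : Pants v) : ∃ ε z, x = inFace ε z := by
  obtain ⟨x, rfl⟩ := Quot.exists_rep x
  rcases x with x | x
  · exact ⟨true, x, rfl⟩
  · exact ⟨false, x, rfl⟩

theorem exists_eq_inFace_of (ε : Bool) (x : Pants v) :
    ∃ z, x = inFace ε z ∨ x = inFace (!ε) z := by
  obtain ⟨ε', z, rfl⟩ := exists_eq_inFace x
  refine ⟨z, ?_⟩
  cases ε <;> cases ε' <;> simp

/-- The map that folds the pair of pants onto the hexagon. -/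
def fold (x : Pants v) : hexRegion v := (exists_eq_inFace x).choose_spec.choose

@[simp] theorem fold_inFace (ε : Bool) (z : hexRegion v) : fold (inFace ε z) = z :=
  (eq_of_inFace_eq (exists_eq_inFace (inFace ε z)).choose_spec.choose_spec).symm

theorem eq_inFace_fold {ε : Bool} {x : Pants v} (h : x ∈ range (inFace ε)) :
    x = inFace ε (fold x) := by
  obtain ⟨z, rfl⟩ := h
  rw [fold_inFace]

theorem eq_inFace_not_fold {ε : Bool} {x : Pants v} (h : x ∉ range (inFace ε)) :
    x = inFace (!ε) (fold x) := by
  obtain ⟨z, rfl | rfl⟩ := exists_eq_inFace_of ε x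
  · exact absurd ⟨z, rfl⟩ h
  · rw [fold_inFace]

theorem dist_fold_le (x y : Pants v) : dist (fold x : ℍ) (fold y) ≤ dist x y := by
  obtain ⟨ε, z, rfl⟩ := exists_eq_inFace x
  obtain ⟨ε', w, rfl⟩ := exists_eq_inFace y
  simpa using dist_le_dist_inFace ε ε' z w

theorem continuous_fold : Continuous (fold (v := v)) :=
  (LipschitzWith.of_dist_le_mul (K := 1) fun x y => by
    rw [NNReal.coe_one, one_mul]
    exact dist_fold_le x y).continuous

theorem isClosed_range_inFace (ε : Bool) : IsClosed (range (inFace (v := v) ε)) := by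
  rw [← isOpen_compl_iff, Metric.isOpen_iff]
  intro x hx
  have hx' := eq_inFace_not_fold hx
  have hs : (fold x : ℍ) ∉ seams v := fun h => hx ⟨fold x, by
    conv_rhs => rw [hx']
    exact inFace_eq_of_mem_seams h _ _⟩
  obtain ⟨r, hr, hball⟩ := Metric.isOpen_iff.1 (isClosed_seams v).isOpen_compl _ hs
  refine ⟨r, hr, ?_⟩
  rintro _ hy ⟨z, rfl⟩
  rw [Metric.mem_ball, hx'] at hy
  obtain ⟨q, hq, hlt⟩ := exists_seam_of_dist_lt hy
  refine hball (?_ : q ∈ _) hq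
  rw [Metric.mem_ball, dist_comm]
  linarith [dist_nonneg (x := (z : ℍ)) (y := q)]

/-! ### The neighbourhoods of the seams -/

/-- The complement of the two seams other than the `k`-th one, an open neighbourhood of the `k`-th
seam. -/
def seamNhd (v : Fin 6 → ℍ) (k : Fin 3) : Set (Pants v) :=
  {x | ∀ l, l ≠ k → 0 < seamFn v l (fold x)}

theorem isOpen_seamNhd (k : Fin 3) : IsOpen (seamNhd v k) := by
  have : seamNhd v k = ⋂ l, {x | l ≠ k → 0 < seamFn v l (fold x)} := by
    ext x; simp [seamNhd]
  rw [this]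
  refine isOpen_iInter_of_finite fun l => ?_
  by_cases h : l = k
  · simp [h]
  · simp only [ne_eq, h, not_false_eq_true, true_imp_iff]
    exact isOpen_lt continuous_const ((continuous_seamFn l).comp
      (continuous_subtype_val.comp continuous_fold))

theorem IsHexFrame.exists_mem_seamNhd (H : IsHexFrame v) (x : Pants v) : ∃ k, x ∈ seamNhd v k := by
  by_contra! h
  simp only [seamNhd, mem_ofPred_eq, not_forall] at h
  obtain ⟨k, -, hk⟩ := h 0
  obtain ⟨l, hl, hl'⟩ := h k
  exact H.not_seamFn_eq_zero hl (le_antisymm (not_lt.1 hl') (H.seamFn_nonneg (fold x).2 _))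
    (le_antisymm (not_lt.1 hk) (H.seamFn_nonneg (fold x).2 _))

theorem IsHexFrame.mem_seamSide_of_mem_seamNhd (H : IsHexFrame v) {x : Pants v} {k : Fin 3}
    (hx : x ∈ seamNhd v k) (hs : (fold x : ℍ) ∈ seams v) : (fold x : ℍ) ∈ seamSide v k := by
  obtain ⟨l, hl⟩ := mem_iUnion.1 hs
  by_cases h : l = k
  · rwa [← h]
  · have := hx l h
    rw [H.seamFn_eq_zero hl] at this
    exact absurd this (lt_irrefl _)

/-! ### Geodesic interpolation in the hexagon -/

theorem future_lerp (z w : ℍ) (t : I) : Future ((1 - t : ℝ) • vec z + (t : ℝ) • vec w) :=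
  (future_vec z).comb (future_vec w) (sub_nonneg.2 t.2.2) t.2.1 (by simp)

/-- A point that runs along the geodesic segment from `z` to `w` (at a variable speed). -/
def lerp (z w : ℍ) (t : I) : ℍ := ofVec ((1 - t : ℝ) • vec z + (t : ℝ) • vec w)

theorem vec_lerp (z w : ℍ) (t : I) : ∃ c > 0, vec (lerp z w t) =
    (c * (1 - t : ℝ)) • vec z + (c * (t : ℝ)) • vec w := by
  have h := future_lerp z w t
  refine ⟨_, inv_pos.2 (Real.sqrt_pos.2 h.2), ?_⟩
  rw [lerp, vec_ofVec h, smul_add, smul_smul, smul_smul]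

theorem lerp_mem_geodSegment (z w : ℍ) (t : I) : lerp z w t ∈ geodSegment z w := by
  obtain ⟨c, hc, h⟩ := vec_lerp z w t
  exact mem_geodSegment_of_comb (mul_nonneg hc.le (sub_nonneg.2 t.2.2)) (mul_nonneg hc.le t.2.1) h

@[simp] theorem lerp_zero (z w : ℍ) : lerp z w 0 = z := by simp [lerp, ofVec_vec]

@[simp] theorem lerp_one (z w : ℍ) : lerp z w 1 = w := by simp [lerp, ofVec_vec]

theorem continuous_lerp : Continuous fun p : ℍ × ℍ × I => lerp p.1 p.2.1 p.2.2 := by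
  refine continuous_ofVec ?_ fun p => future_lerp _ _ _
  have h1 : Continuous fun p : ℍ × ℍ × I => vec p.1 := continuous_vec.comp continuous_fst
  have h2 : Continuous fun p : ℍ × ℍ × I => vec p.2.1 :=
    continuous_vec.comp (continuous_fst.comp continuous_snd)
  fun_prop

theorem geodConvex_hexRegion (v : Fin 6 → ℍ) : GeodConvex (hexRegion v) :=
  fun _ hx _ hy _ hz _ hS => hS.1 _ (hx _ hS) _ (hy _ hS) hz

theorem geodConvex_geodSegment (x y : ℍ) : GeodConvex (geodSegment x y) := by
  intro z hz w hw u hu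
  obtain ⟨α, β, hα, hβ, h⟩ := exists_comb_of_mem_geodSegment hz
  obtain ⟨α', β', hα', hβ', h'⟩ := exists_comb_of_mem_geodSegment hw
  obtain ⟨a, b, ha, hb, hu⟩ := exists_comb_of_mem_geodSegment hu
  refine mem_geodSegment_of_comb (α := a * α + b * α') (β := a * β + b * β') (by positivity)
    (by positivity) ?_
  rw [hu, h, h']; module

theorem lerp_mem_hexRegion (z w : hexRegion v) (t : I) : lerp z w t ∈ hexRegion v :=
  geodConvex_hexRegion v _ z.2 _ w.2 (lerp_mem_geodSegment _ _ t)

/-- Geodesic interpolation between points of the hexagon. -/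
def hexLerp (z w : hexRegion v) (t : I) : hexRegion v := ⟨lerp z w t, lerp_mem_hexRegion z w t⟩

theorem continuous_hexLerp : Continuous fun p : hexRegion v × hexRegion v × I =>
    hexLerp p.1 p.2.1 p.2.2 := by
  refine Continuous.subtype_mk ?_ _
  exact continuous_lerp.comp ((continuous_subtype_val.comp continuous_fst).prodMk
    ((continuous_subtype_val.comp (continuous_fst.comp continuous_snd)).prodMk
      (continuous_snd.comp continuous_snd)))

theorem seamFn_lerp_pos {z w : ℍ} {l : Fin 3} (hz : 0 < seamFn v l z) (hw : 0 < seamFn v l w)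
    (t : I) : 0 < seamFn v l (lerp z w t) := by
  obtain ⟨c, hc, h⟩ := vec_lerp z w t
  have h0 := t.2.1
  have h1 : (0 : ℝ) ≤ 1 - t := sub_nonneg.2 t.2.2
  rw [seamFn, h, mink_add_left, mink_smul_left, mink_smul_left]
  change 0 < c * (1 - t : ℝ) * seamFn v l z + c * t * seamFn v l w
  rcases h0.eq_or_lt with h0 | h0
  · rw [← h0]; simp; positivity
  · have := mul_nonneg (mul_nonneg hc.le h1) hz.le
    positivity

/-- The neighbourhood of a seam is contractible: both halves shrink to a point of the seam along
geodesics. -/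
theorem IsHexFrame.contractibleSpace_seamNhd (H : IsHexFrame v) (k : Fin 3) :
    ContractibleSpace (seamNhd v k) := by
  classical
  have hm : ve v k ∈ seamSide v k := by rw [seamSide_eq]; exact self_mem_geodSegment_left _ _
  set m : hexRegion v := ⟨ve v k, seams_subset_hexRegion v (mem_iUnion.2 ⟨k, hm⟩)⟩ with hmdef
  have hms : (m : ℍ) ∈ seams v := mem_iUnion.2 ⟨k, hm⟩
  set F : Bool → seamNhd v k × I → Pants v := fun ε p => inFace ε (hexLerp (fold p.1.1) m p.2)
    with hF
  have hFc : ∀ ε, Continuous (F ε) := fun ε => (isometry_inFace ε).continuous.comp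
    (continuous_hexLerp.comp ((continuous_fold.comp (continuous_subtype_val.comp continuous_fst)).prodMk
      (continuous_const.prodMk continuous_snd)))
  set A : Bool → Set (seamNhd v k × I) := fun ε => {p | p.1.1 ∈ range (inFace ε)} with hA
  have hAc : ∀ ε, IsClosed (A ε) := fun ε =>
    (isClosed_range_inFace ε).preimage (continuous_subtype_val.comp continuous_fst)
  have hAu : A true ∪ A false = univ := by
    refine eq_univ_of_forall fun p => ?_
    obtain ⟨z, h | h⟩ := exists_eq_inFace_of true p.1.1
    · exact Or.inl ⟨z, h.symm⟩
    · exact Or.inr ⟨z, h.symm⟩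
  -- both formulas agree on the seam
  have hagree : ∀ p, p ∈ A true → p ∈ A false → F true p = F false p := by
    rintro p h1 h2
    have hs : (fold p.1.1 : ℍ) ∈ seams v := by
      refine mem_seams_of_inFace_eq (ε := true) (y := fold p.1.1) ?_
      rw [← eq_inFace_fold h1]
      exact eq_inFace_fold h2
    have := H.mem_seamSide_of_mem_seamNhd p.1.2 hs
    refine inFace_eq_of_mem_seams (mem_iUnion.2 ⟨k, ?_⟩) _ _
    exact geodConvex_geodSegment _ _ _ this _ hm (lerp_mem_geodSegment _ _ _)
  set G : seamNhd v k × I → Pants v := fun p => if p ∈ A true then F true p else F false p with hG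
  have hGt : EqOn G (F true) (A true) := fun p hp => if_pos hp
  have hGf : EqOn G (F false) (A false) := fun p hp => by
    by_cases h : p ∈ A true
    · rw [hGt h, hagree p h hp]
    · exact if_neg h
  have hGc : Continuous G := by
    rw [← continuousOn_univ, ← hAu]
    exact ((hFc true).continuousOn.congr hGt).union_of_isClosed ((hFc false).continuousOn.congr hGf)
      (hAc true) (hAc false)
  have hface : ∀ p, ∃ ε, p.1.1 ∈ range (inFace ε) ∧ G p = F ε p := fun p => by
    by_cases h : p ∈ A true
    · exact ⟨true, h, hGt h⟩
    · have h2 : p ∈ A false := by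
        have : p ∈ A true ∪ A false := hAu ▸ mem_univ p
        exact this.resolve_left h
      exact ⟨false, h2, hGf h2⟩
  have hGm : ∀ p, G p ∈ seamNhd v k := fun p l hl => by
    obtain ⟨ε, -, h⟩ := hface p
    rw [h, hF]
    simp only [fold_inFace]
    exact seamFn_lerp_pos (p.1.2 l hl) (H.seamFn_pos_of_mem_seamSide hm hl) _
  rw [contractible_iff_id_nullhomotopic]
  have hmm : inFace true m ∈ seamNhd v k := fun l hl => by
    rw [fold_inFace]; exact H.seamFn_pos_of_mem_seamSide hm hl
  refine ⟨⟨inFace true m, hmm⟩, ⟨{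
    toFun := fun p => ⟨G (p.2, p.1), hGm _⟩
    continuous_toFun := (hGc.comp (continuous_snd.prodMk continuous_fst)).subtype_mk _
    map_zero_left := fun x => Subtype.ext ?_
    map_one_left := fun x => Subtype.ext ?_ }⟩⟩
  · obtain ⟨ε, h1, h2⟩ := hface (x, 0)
    change G (x, 0) = x.1
    rw [h2, hF]
    have : hexLerp (fold x.1) m 0 = fold x.1 := Subtype.ext (lerp_zero _ _)
    simp only [this]
    exact (eq_inFace_fold h1).symm
  · obtain ⟨ε, h1, h2⟩ := hface (x, 1)
    change G (x, 1) = inFace true m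
    rw [h2, hF]
    have : hexLerp (fold x.1) m 1 = m := Subtype.ext (lerp_one _ _)
    simp only [this]
    exact inFace_eq_of_mem_seams hms ε true

/-- Two paths with the same endpoints in the neighbourhood of a seam are homotopic. -/
theorem IsHexFrame.homotopic_of_range_subset (H : IsHexFrame v) {k : Fin 3} {x y : Pants v}
    {b b' : Path x y} (hb : range b ⊆ seamNhd v k) (hb' : range b' ⊆ seamNhd v k) :
    Path.Homotopic b b' := by
  have := H.contractibleSpace_seamNhd k
  have hx : x ∈ seamNhd v k := hb ⟨0, b.source⟩
  have hy : y ∈ seamNhd v k := hb ⟨1, b.target⟩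
  let c : Path (⟨x, hx⟩ : seamNhd v k) ⟨y, hy⟩ :=
    ⟨⟨fun t => ⟨b t, hb ⟨t, rfl⟩⟩, by fun_prop⟩, Subtype.ext b.source, Subtype.ext b.target⟩
  let c' : Path (⟨x, hx⟩ : seamNhd v k) ⟨y, hy⟩ :=
    ⟨⟨fun t => ⟨b' t, hb' ⟨t, rfl⟩⟩, by fun_prop⟩, Subtype.ext b'.source, Subtype.ext b'.target⟩
  have h : c.Homotopic c' := SimplyConnectedSpace.paths_homotopic c c'
  let f : C(seamNhd v k, Pants v) := ⟨Subtype.val, continuous_subtype_val⟩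
  have e : c.map f.continuous = b := by ext; rfl
  have e' : c'.map f.continuous = b' := by ext; rfl
  have := h.map f
  rwa [e, e'] at this

end

section

variable {v : Fin 6 → ℍ}

/-! ### The developing map -/

/-- The isometry group of `ℍ` is used as a discrete structure group. -/
instance instTopologicalSpaceIsom : TopologicalSpace (ℍ ≃ᵢ ℍ) := ⊥

instance instDiscreteTopologyIsom : DiscreteTopology (ℍ ≃ᵢ ℍ) := ⟨rfl⟩

open Classical in
/-- The flat bundle of germs of developing maps of the pair of pants: in the chart `seamNhd v i` the
developing map is the identity on the face `ε₀` and the reflection in the `i`-th seam on the other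
face. -/
def devCore (H : IsHexFrame v) (ε₀ : Bool) : FiberBundleCore (Fin 3) (Pants v) (ℍ ≃ᵢ ℍ) where
  baseSet := seamNhd v
  isOpen_baseSet := isOpen_seamNhd
  indexAt x := (H.exists_mem_seamNhd x).choose
  mem_baseSet_at x := (H.exists_mem_seamNhd x).choose_spec
  coordChange i j x g := if x ∈ range (inFace ε₀) then g else g * (seamRefl H i * seamRefl H j)
  coordChange_self i x _ g := by
    simp only [seamRefl_mul_self, mul_one, ite_self]
  continuousOn_coordChange i j := by
    rcases eq_or_ne i j with rfl | hij
    · simp only [seamRefl_mul_self, mul_one, ite_self]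
      exact continuousOn_snd
    rintro ⟨x, g⟩ ⟨⟨hi, hj⟩, -⟩
    refine ContinuousAt.continuousWithinAt ?_
    by_cases hx : x ∈ range (inFace ε₀)
    · have hx' : x ∉ range (inFace !ε₀) := by
        intro h
        have h1 := eq_inFace_fold hx
        have h2 := eq_inFace_fold h
        have hs : (fold x : ℍ) ∈ seams v := mem_seams_of_inFace_eq (h1.symm.trans h2)
        exact H.not_seamFn_eq_zero hij (H.seamFn_eq_zero (H.mem_seamSide_of_mem_seamNhd hi hs))
          (H.seamFn_eq_zero (H.mem_seamSide_of_mem_seamNhd hj hs))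
      have hev : ∀ᶠ p : Pants v × (ℍ ≃ᵢ ℍ) in 𝓝 (x, g), p.1 ∈ range (inFace ε₀) := by
        filter_upwards [continuous_fst.continuousAt.preimage_mem_nhds
          ((isClosed_range_inFace (!ε₀)).isOpen_compl.mem_nhds hx')] with p hp
        obtain ⟨z, h | h⟩ := exists_eq_inFace_of ε₀ p.1
        · exact ⟨z, h.symm⟩
        · exact absurd ⟨z, h.symm⟩ hp
      refine (continuous_snd.continuousAt).congr ?_
      filter_upwards [hev] with p hp
      rw [if_pos hp]
    · have hev : ∀ᶠ p : Pants v × (ℍ ≃ᵢ ℍ) in 𝓝 (x, g), p.1 ∉ range (inFace ε₀) :=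
        continuous_fst.continuousAt.preimage_mem_nhds
          ((isClosed_range_inFace ε₀).isOpen_compl.mem_nhds (show x ∈ (range (inFace ε₀))ᶜ from hx))
      have hc : Continuous fun p : Pants v × (ℍ ≃ᵢ ℍ) => p.2 * (seamRefl H i * seamRefl H j) :=
        (continuous_of_discreteTopology (f := fun g : ℍ ≃ᵢ ℍ => g * (seamRefl H i * seamRefl H j))).comp
          continuous_snd
      refine hc.continuousAt.congr ?_
      filter_upwards [hev] with p hp
      rw [if_neg hp]
  coordChange_comp i j k x _ g := by
    by_cases hx : x ∈ range (inFace ε₀)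
    · simp only [hx, if_true]
    · simp only [hx, if_false]
      calc g * (seamRefl H i * seamRefl H j) * (seamRefl H j * seamRefl H k)
          = g * (seamRefl H i * (seamRefl H j * seamRefl H j) * seamRefl H k) := by
            simp only [mul_assoc]
        _ = g * (seamRefl H i * seamRefl H k) := by rw [seamRefl_mul_self, mul_one]

/-- The total space of the bundle of germs of developing maps. -/
abbrev DevSpace (H : IsHexFrame v) (ε₀ : Bool) : Type := (devCore H ε₀).TotalSpace

variable {H : IsHexFrame v} {ε₀ : Bool}

/-- The coordinate of a germ of developing maps in the preferred chart at its base point. -/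
def germ (e : DevSpace H ε₀) : ℍ ≃ᵢ ℍ := e.2

/-- The coordinate of a germ of developing maps in the `i`-th chart. -/
def coord (i : Fin 3) (e : DevSpace H ε₀) : ℍ ≃ᵢ ℍ :=
  (devCore H ε₀).coordChange ((devCore H ε₀).indexAt e.proj) i e.proj e.2

open Classical in
theorem coord_def (i : Fin 3) (e : DevSpace H ε₀) : coord i e =
    if e.proj ∈ range (inFace ε₀) then germ e else
      germ e * (seamRefl H ((devCore H ε₀).indexAt e.proj) * seamRefl H i) := rfl

theorem mem_seamNhd_indexAt (x : Pants v) : x ∈ seamNhd v ((devCore H ε₀).indexAt x) :=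
  (devCore H ε₀).mem_baseSet_at x

theorem isCoveringMap_proj (H : IsHexFrame v) (ε₀ : Bool) :
    IsCoveringMap (Bundle.TotalSpace.proj : DevSpace H ε₀ → Pants v) :=
  FiberBundle.isCoveringMap (F := ℍ ≃ᵢ ℍ) (E := (devCore H ε₀).Fiber)

theorem ext_of_coord {e e' : DevSpace H ε₀} {i : Fin 3} (h : e.proj = e'.proj)
    (hi : e.proj ∈ seamNhd v i) (hc : coord i e = coord i e') : e = e' := by
  have h1 : (devCore H ε₀).localTriv i e = (devCore H ε₀).localTriv i e' := Prod.ext h hc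
  exact ((devCore H ε₀).localTriv i).toOpenPartialHomeomorph.injOn hi (h ▸ hi :) h1

theorem eventually_coord_eq {X : Type*} [TopologicalSpace X] {f : X → DevSpace H ε₀}
    (hf : Continuous f) {x₀ : X} {i : Fin 3} (hi : (f x₀).proj ∈ seamNhd v i) :
    ∀ᶠ x in 𝓝 x₀, (f x).proj ∈ seamNhd v i ∧ coord i (f x) = coord i (f x₀) := by
  have h1 : ∀ᶠ x in 𝓝 x₀, (f x).proj ∈ seamNhd v i :=
    (((isCoveringMap_proj H ε₀).continuous.comp hf).continuousAt.preimage_mem_nhds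
      ((isOpen_seamNhd i).mem_nhds hi))
  have h2 : ContinuousAt (fun x => ((devCore H ε₀).localTriv i (f x)).2) x₀ :=
    continuous_snd.continuousAt.comp ((((devCore H ε₀).localTriv i).continuousAt hi).comp
      hf.continuousAt)
  have h3 := h2.preimage_mem_nhds ((isOpen_discrete {((devCore H ε₀).localTriv i (f x₀)).2}).mem_nhds rfl)
  filter_upwards [h1, h3] with x hx hx'
  exact ⟨hx, hx'⟩

theorem continuous_of_coord {X : Type*} [TopologicalSpace X] {f : X → DevSpace H ε₀}
    (hp : Continuous fun x => (f x).proj)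
    (h : ∀ x₀, ∃ i, (f x₀).proj ∈ seamNhd v i ∧ ∀ᶠ x in 𝓝 x₀, coord i (f x) = coord i (f x₀)) :
    Continuous f := by
  refine continuous_iff_continuousAt.2 fun x₀ => ?_
  obtain ⟨i, hi, hev⟩ := h x₀
  have hU : ∀ᶠ x in 𝓝 x₀, (f x).proj ∈ seamNhd v i :=
    hp.continuousAt.preimage_mem_nhds ((isOpen_seamNhd i).mem_nhds hi)
  refine (((devCore H ε₀).localTriv i).toOpenPartialHomeomorph.continuousAt_iff_continuousAt_comp_left
    (f := f) ?_).2 ?_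
  · exact hU
  · have : ContinuousAt (fun x => ((f x).proj, coord i (f x₀))) x₀ :=
      hp.continuousAt.prodMk continuousAt_const
    refine this.congr ?_
    filter_upwards [hev] with x hx
    exact Prod.ext rfl hx.symm

open Classical in
/-- The developing map of the `i`-th chart. -/
def localDev (H : IsHexFrame v) (ε₀ : Bool) (i : Fin 3) (x : Pants v) : ℍ :=
  if x ∈ range (inFace ε₀) then (fold x : ℍ) else seamRefl H i (fold x : ℍ)

theorem localDev_inFace_self (i : Fin 3) (z : hexRegion v) :
    localDev H ε₀ i (inFace ε₀ z) = z := by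
  rw [localDev, if_pos ⟨z, rfl⟩, fold_inFace]

theorem localDev_inFace_not {i : Fin 3} {z : hexRegion v} (h : inFace (!ε₀) z ∈ seamNhd v i) :
    localDev H ε₀ i (inFace (!ε₀) z) = seamRefl H i z := by
  by_cases hx : inFace (!ε₀) z ∈ range (inFace ε₀)
  · rw [localDev, if_pos hx, fold_inFace]
    have hs : (z : ℍ) ∈ seams v := by
      refine mem_seams_of_inFace_eq (ε := ε₀) (y := z) ?_
      have := eq_inFace_fold hx
      rw [fold_inFace] at this
      exact this.symm
    have := H.mem_seamSide_of_mem_seamNhd h (by rwa [fold_inFace])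
    rw [fold_inFace] at this
    exact (seamRefl_apply_of_mem H this).symm
  · rw [localDev, if_neg hx, fold_inFace]

/-- The developing map of a chart is locally distance nonincreasing. -/
theorem exists_localDev_nonexpanding (H : IsHexFrame v) (ε₀ : Bool) {i : Fin 3} {x : Pants v}
    (hx : x ∈ seamNhd v i) : ∃ r > 0, ∀ y ∈ Metric.ball x r, ∀ y' ∈ Metric.ball x r,
      y ∈ seamNhd v i → y' ∈ seamNhd v i →
      dist (localDev H ε₀ i y) (localDev H ε₀ i y') ≤ dist y y' := by
  have hO : IsOpen {q : ℍ | ∀ l, l ≠ i → 0 < seamFn v l q} := by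
    have : {q : ℍ | ∀ l, l ≠ i → 0 < seamFn v l q} = ⋂ l, {q | l ≠ i → 0 < seamFn v l q} := by
      ext; simp
    rw [this]
    refine isOpen_iInter_of_finite fun l => ?_
    by_cases h : l = i
    · simp [h]
    · simp only [ne_eq, h, not_false_eq_true, true_imp_iff]
      exact isOpen_lt continuous_const (continuous_seamFn l)
  obtain ⟨R, hR, hball⟩ := Metric.isOpen_iff.1 hO (fold x : ℍ) hx
  -- a seam which passes close to `fold x` can only be the `i`-th one
  have key : ∀ ε (z z' : hexRegion v), inFace ε z ∈ Metric.ball x (R / 3) →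
      inFace (!ε) z' ∈ Metric.ball x (R / 3) →
      dist (z : ℍ) (seamRefl H i z') ≤ dist (inFace ε z) (inFace (!ε) z') := by
    intro ε z z' hz hz'
    rw [Metric.mem_ball] at hz hz'
    refine le_of_forall_gt_imp_ge_of_dense fun δ hδ => ?_
    have hlt : dist (inFace ε z) (inFace (!ε) z') < R - R / 3 := by
      linarith [dist_triangle_right (inFace ε z) (inFace (!ε) z') x]
    obtain ⟨q, hq, hsum⟩ := exists_seam_of_dist_lt (lt_min hδ hlt)
    have hqi : q ∈ seamSide v i := by
      obtain ⟨l, hl⟩ := mem_iUnion.1 hq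
      by_cases h : l = i
      · rwa [← h]
      · have hqb : q ∈ Metric.ball (fold x : ℍ) R := by
          rw [Metric.mem_ball]
          have h1 := dist_fold_le (inFace ε z) x
          rw [fold_inFace] at h1
          have h2 := (lt_min_iff.1 hsum).2
          linarith [dist_triangle_left q (fold x : ℍ) (z : ℍ), dist_nonneg (x := (z' : ℍ)) (y := q)]
        have := hball hqb l h
        rw [H.seamFn_eq_zero hl] at this
        exact absurd this (lt_irrefl _)
    have h3 : dist q (seamRefl H i z') = dist (z' : ℍ) q := by
      conv_lhs => rw [← seamRefl_apply_of_mem H hqi]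
      rw [IsometryEquiv.dist_eq, dist_comm]
    have := (lt_min_iff.1 hsum).1
    linarith [dist_triangle (z : ℍ) q (seamRefl H i z')]
  refine ⟨R / 3, by positivity, fun y hy y' hy' hyi hyi' => ?_⟩
  obtain ⟨z, rfl | rfl⟩ := exists_eq_inFace_of ε₀ y <;>
  obtain ⟨z', rfl | rfl⟩ := exists_eq_inFace_of ε₀ y'
  · rw [localDev_inFace_self, localDev_inFace_self, dist_inFace]
  · rw [localDev_inFace_self, localDev_inFace_not hyi']
    exact key _ _ _ hy hy'
  · rw [localDev_inFace_self, localDev_inFace_not hyi, dist_comm, dist_comm (inFace _ _)]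
    exact key _ _ _ hy' hy
  · rw [localDev_inFace_not hyi, localDev_inFace_not hyi', IsometryEquiv.dist_eq, dist_inFace]

/-- The developing map of the pair of pants, on the space of its germs. -/
def dev (e : DevSpace H ε₀) : ℍ :=
  coord ((devCore H ε₀).indexAt e.proj) e (localDev H ε₀ ((devCore H ε₀).indexAt e.proj) e.proj)

theorem coord_inFace_self {e : DevSpace H ε₀} (h : e.proj ∈ range (inFace ε₀)) (i : Fin 3) :
    coord i e = germ e := by
  rw [coord_def, if_pos h]

theorem coord_inFace_not {e : DevSpace H ε₀} (h : e.proj ∉ range (inFace ε₀)) (i j : Fin 3) :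
    coord i e = coord j e * (seamRefl H j * seamRefl H i) := by
  rw [coord_def, coord_def, if_neg h, if_neg h]
  simp only [mul_assoc]
  rw [← mul_assoc (seamRefl H j) (seamRefl H j), seamRefl_mul_self, one_mul]

theorem dev_eq {e : DevSpace H ε₀} {i : Fin 3} :
    dev e = coord i e (localDev H ε₀ i e.proj) := by
  set j := (devCore H ε₀).indexAt e.proj with hj
  rw [dev]
  by_cases hx : e.proj ∈ range (inFace ε₀)
  · rw [coord_inFace_self hx, coord_inFace_self hx, localDev, localDev, if_pos hx, if_pos hx]
  · rw [coord_inFace_not hx i j, localDev, localDev, if_neg hx, if_neg hx]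
    have : seamRefl H i * seamRefl H i = 1 := seamRefl_mul_self H i
    calc coord j e (seamRefl H j (fold e.proj))
        = coord j e (seamRefl H j ((seamRefl H i * seamRefl H i) (fold e.proj : ℍ))) := by
          rw [this]; rfl
      _ = _ := rfl

open Classical in
/-- The germ over the point `z` of the face `ε` of the developing map which is equal to `g` on this
face. -/
def sec (H : IsHexFrame v) (ε₀ ε : Bool) (g : ℍ ≃ᵢ ℍ) (z : hexRegion v) : DevSpace H ε₀ :=
  ⟨inFace ε z, if ε = ε₀ then g else g * seamRefl H ((devCore H ε₀).indexAt (inFace ε z))⟩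

@[simp] theorem proj_sec (ε : Bool) (g : ℍ ≃ᵢ ℍ) (z : hexRegion v) :
    (sec H ε₀ ε g z).proj = inFace ε z := rfl

theorem coord_sec_self (g : ℍ ≃ᵢ ℍ) (z : hexRegion v) (i : Fin 3) :
    coord i (sec H ε₀ ε₀ g z) = g := by
  rw [coord_inFace_self ⟨z, rfl⟩]
  exact if_pos rfl

theorem coord_sec_not (g : ℍ ≃ᵢ ℍ) {z : hexRegion v} {i : Fin 3}
    (hi : inFace (!ε₀) z ∈ seamNhd v i) :
    coord i (sec H ε₀ (!ε₀) g z) = g * seamRefl H i := by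
  set j := (devCore H ε₀).indexAt (inFace (!ε₀) z) with hj
  have h2 : germ (sec H ε₀ (!ε₀) g z) = g * seamRefl H j := by
    change (if (!ε₀) = ε₀ then g else g * seamRefl H j) = _
    rw [if_neg (by simp)]
  by_cases hx : inFace (!ε₀) z ∈ range (inFace ε₀)
  · rw [coord_inFace_self hx, h2]
    -- the point is on a seam, so both charts belong to this seam
    have hs : (z : ℍ) ∈ seams v := by
      refine mem_seams_of_inFace_eq (ε := ε₀) (y := z) ?_
      have := eq_inFace_fold hx
      rw [fold_inFace] at this
      exact this.symm
    have hs' : (fold (inFace (!ε₀) z) : ℍ) ∈ seams v := by rwa [fold_inFace]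
    have h1 := H.seamFn_eq_zero (H.mem_seamSide_of_mem_seamNhd hi hs')
    have h2 := H.seamFn_eq_zero (H.mem_seamSide_of_mem_seamNhd
      (mem_seamNhd_indexAt (H := H) (ε₀ := ε₀) (inFace (!ε₀) z)) hs')
    by_contra hne
    exact H.not_seamFn_eq_zero (fun h : i = j => hne (by rw [h])) h1 h2
  · rw [coord_def, proj_sec, if_neg hx, h2, mul_assoc, ← mul_assoc (seamRefl H j),
      seamRefl_mul_self, one_mul]

@[simp] theorem dev_sec (ε : Bool) (g : ℍ ≃ᵢ ℍ) (z : hexRegion v) :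
    dev (sec H ε₀ ε g z) = g z := by
  obtain rfl | rfl : ε = ε₀ ∨ ε = !ε₀ := by cases ε <;> cases ε₀ <;> simp
  · rw [dev_eq (i := 0), coord_sec_self, proj_sec, localDev_inFace_self]
  · obtain ⟨i, hi⟩ := H.exists_mem_seamNhd (inFace (!ε₀) z)
    rw [dev_eq (i := i), coord_sec_not g hi, proj_sec, localDev_inFace_not hi]
    change g ((seamRefl H i * seamRefl H i) (z : ℍ)) = _
    rw [seamRefl_mul_self]; rfl

/-- Across the `k`-th seam, the developing map `g` continues as `g` composed with the reflection in
this seam. -/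
theorem sec_eq_sec_not {k : Fin 3} {z : hexRegion v} (hz : (z : ℍ) ∈ seamSide v k) (ε : Bool)
    (g : ℍ ≃ᵢ ℍ) : sec H ε₀ ε g z = sec H ε₀ (!ε) (g * seamRefl H k) z := by
  have hs : (z : ℍ) ∈ seams v := mem_iUnion.2 ⟨k, hz⟩
  have hk : ∀ ε, inFace ε z ∈ seamNhd v k := fun ε l hl => by
    rw [fold_inFace]; exact H.seamFn_pos_of_mem_seamSide hz hl
  have hp := inFace_eq_of_mem_seams hs ε (!ε)
  refine ext_of_coord (i := k) hp (hk _) ?_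
  obtain rfl | rfl : ε = ε₀ ∨ ε = !ε₀ := by cases ε <;> cases ε₀ <;> simp
  · rw [coord_sec_self, coord_sec_not _ (hk _), mul_assoc, seamRefl_mul_self, mul_one]
  · rw [coord_sec_not _ (hk _), Bool.not_not, coord_sec_self]

theorem continuous_sec (ε : Bool) (g : ℍ ≃ᵢ ℍ) : Continuous (sec H ε₀ ε g) := by
  refine continuous_of_coord (isometry_inFace ε).continuous fun z => ?_
  obtain ⟨i, hi⟩ := H.exists_mem_seamNhd (inFace ε z)
  refine ⟨i, hi, ?_⟩
  have hev : ∀ᶠ w in 𝓝 z, inFace ε w ∈ seamNhd v i :=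
    (isometry_inFace ε).continuous.continuousAt.preimage_mem_nhds ((isOpen_seamNhd i).mem_nhds hi)
  obtain rfl | rfl : ε = ε₀ ∨ ε = !ε₀ := by cases ε <;> cases ε₀ <;> simp
  · exact Filter.Eventually.of_forall fun w => by rw [coord_sec_self, coord_sec_self]
  · filter_upwards [hev] with w hw
    rw [coord_sec_not _ hw, coord_sec_not _ hi]

/-- Left multiplication of germs of developing maps by isometries. -/
def leftMul (g : ℍ ≃ᵢ ℍ) (e : DevSpace H ε₀) : DevSpace H ε₀ := ⟨e.proj, g * germ e⟩

theorem coord_leftMul (g : ℍ ≃ᵢ ℍ) (e : DevSpace H ε₀) (i : Fin 3) :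
    coord i (leftMul g e) = g * coord i e := by
  have h1 : germ (leftMul g e) = g * germ e := rfl
  have h2 : (leftMul g e).proj = e.proj := rfl
  rw [coord_def, coord_def, h1, h2]
  split_ifs
  · rfl
  · simp only [mul_assoc]

theorem continuous_leftMul (g : ℍ ≃ᵢ ℍ) : Continuous (leftMul (H := H) (ε₀ := ε₀) g) := by
  refine continuous_of_coord (isCoveringMap_proj H ε₀).continuous fun e => ?_
  obtain ⟨i, hi⟩ := H.exists_mem_seamNhd e.proj
  refine ⟨i, hi, ?_⟩
  filter_upwards [eventually_coord_eq (f := id) continuous_id hi] with e' he'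
  rw [coord_leftMul, coord_leftMul]
  exact congrArg _ he'.2

theorem leftMul_sec (g g' : ℍ ≃ᵢ ℍ) (ε : Bool) (z : hexRegion v) :
    leftMul g (sec H ε₀ ε g' z) = sec H ε₀ ε (g * g') z := by
  obtain ⟨i, hi⟩ := H.exists_mem_seamNhd (inFace ε z)
  refine ext_of_coord (i := i) rfl hi ?_
  rw [coord_leftMul]
  obtain rfl | rfl : ε = ε₀ ∨ ε = !ε₀ := by cases ε <;> cases ε₀ <;> simp
  · rw [coord_sec_self, coord_sec_self]
  · rw [coord_sec_not _ hi, coord_sec_not _ hi, mul_assoc]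

end

section

variable {v : Fin 6 → ℍ} {H : IsHexFrame v} {ε₀ : Bool}

/-! ### Lifting paths, and the lower bound for their lengths -/

/-- The germ `e'` is the continuation of the germ `e` along the paths of the class `q`. -/
def Continues {x y : Pants v} (q : Path.Homotopic.Quotient x y) (e e' : DevSpace H ε₀) : Prop :=
  ∃ b : Path x y, Path.Homotopic.Quotient.mk b = q ∧
    ∃ Γ : C(I, DevSpace H ε₀), (∀ t, (Γ t).proj = b t) ∧ Γ 0 = e ∧ Γ 1 = e'

theorem exists_lift {x y : Pants v} (b : Path x y) {e : DevSpace H ε₀} (he : e.proj = x) :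
    ∃ Γ : C(I, DevSpace H ε₀), (∀ t, (Γ t).proj = b t) ∧ Γ 0 = e := by
  have h0 : (b : C(I, Pants v)) 0 = e.proj := b.source.trans he.symm
  exact ⟨(isCoveringMap_proj H ε₀).liftPath b e h0,
    fun t => congrFun ((isCoveringMap_proj H ε₀).liftPath_lifts b e h0) t,
    (isCoveringMap_proj H ε₀).liftPath_zero b e h0⟩

namespace Continues

variable {x y z : Pants v} {q : Path.Homotopic.Quotient x y} {e e' e'' : DevSpace H ε₀}

theorem proj_left (h : Continues q e e') : e.proj = x := by
  obtain ⟨b, -, Γ, h, rfl, -⟩ := h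
  rw [h, b.source]

theorem unique (h : Continues q e e') (h' : Continues q e e'') : e' = e'' := by
  obtain ⟨b, rfl, Γ, h1, h2, rfl⟩ := h
  obtain ⟨b', hb, Γ', h1', h2', rfl⟩ := h'
  have cov := isCoveringMap_proj H ε₀
  have h0 : (b : C(I, Pants v)) 0 = e.proj := by rw [← h2]; exact (h1 0).symm
  have h0' : (b' : C(I, Pants v)) 0 = e.proj := by rw [← h2']; exact (h1' 0).symm
  have e1 := (cov.eq_liftPath_iff' (Γ := Γ) h0).2 ⟨funext h1, h2⟩
  have e2 := (cov.eq_liftPath_iff' (Γ := Γ') h0').2 ⟨funext h1', h2'⟩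
  rw [e1, e2]
  exact (cov.liftPath_apply_one_eq_of_homotopicRel (Path.Homotopic.Quotient.exact hb) e h0' h0).symm

theorem refl (x : Pants v) (h : e.proj = x) : Continues (.refl x) e e :=
  ⟨Path.refl x, rfl, ContinuousMap.const I e, fun _ => h, rfl, rfl⟩

theorem trans {q' : Path.Homotopic.Quotient y z} (h : Continues q e e') (h' : Continues q' e' e'') :
    Continues (q.trans q') e e'' := by
  obtain ⟨b, rfl, Γ, h1, h2, h3⟩ := h
  obtain ⟨b', rfl, Γ', h1', h2', h3'⟩ := h'
  let P : Path e e' := ⟨Γ, h2, h3⟩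
  let P' : Path e' e'' := ⟨Γ', h2', h3'⟩
  refine ⟨b.trans b', rfl, (P.trans P').toContinuousMap, fun t => ?_, (P.trans P').source,
    (P.trans P').target⟩
  change ((P.trans P') t).proj = _
  rw [Path.trans_apply, Path.trans_apply]
  split_ifs
  · exact h1 _
  · exact h1' _

theorem symm (h : Continues q e e') : Continues q.symm e' e := by
  obtain ⟨b, rfl, Γ, h1, h2, h3⟩ := h
  exact ⟨b.symm, rfl, Γ.comp ⟨unitInterval.symm, unitInterval.continuous_symm⟩, fun t => h1 _,
    by simpa using h3, by simpa using h2⟩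

theorem leftMul (g : ℍ ≃ᵢ ℍ) (h : Continues q e e') :
    Continues q (leftMul g e) (leftMul g e') := by
  obtain ⟨b, rfl, Γ, h1, h2, h3⟩ := h
  exact ⟨b, rfl, ⟨fun t => PantsLength.leftMul g (Γ t), (continuous_leftMul g).comp Γ.continuous⟩,
    fun t => h1 t, congrArg (PantsLength.leftMul g) h2, congrArg (PantsLength.leftMul g) h3⟩

end Continues

/-- Along a lift the developing map is locally nonexpanding. -/
theorem exists_nhds_dist_dev_le {x y : Pants v} {b : Path x y} {Γ : C(I, DevSpace H ε₀)}
    (h : ∀ t, (Γ t).proj = b t) (t₀ : I) :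
    ∃ U ∈ 𝓝 t₀, ∀ t ∈ U, ∀ t' ∈ U, dist (dev (Γ t)) (dev (Γ t')) ≤ dist (b t) (b t') := by
  obtain ⟨i, hi⟩ := H.exists_mem_seamNhd (Γ t₀).proj
  have hi' := hi
  rw [h] at hi'
  obtain ⟨r, hr, hdist⟩ := exists_localDev_nonexpanding H ε₀ hi'
  have h1 := eventually_coord_eq Γ.continuous hi
  have h2 : ∀ᶠ t in 𝓝 t₀, b t ∈ Metric.ball (b t₀) r :=
    b.continuous.continuousAt.preimage_mem_nhds (Metric.ball_mem_nhds _ hr)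
  refine ⟨_, h1.and h2, fun t ht t' ht' => ?_⟩
  rw [dev_eq (i := i), dev_eq (i := i) (e := Γ t'), ht.1.2, ht'.1.2, IsometryEquiv.dist_eq, h, h]
  refine hdist _ ht.2 _ ht'.2 ?_ ?_
  · rw [← h]; exact ht.1.1
  · rw [← h]; exact ht'.1.1

theorem continuous_dev_lift {x y : Pants v} {b : Path x y} {Γ : C(I, DevSpace H ε₀)}
    (h : ∀ t, (Γ t).proj = b t) : Continuous fun t => dev (Γ t) := by
  refine continuous_iff_continuousAt.2 fun t₀ => ?_
  obtain ⟨U, hU, hd⟩ := exists_nhds_dist_dev_le h t₀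
  rw [ContinuousAt, tendsto_iff_dist_tendsto_zero]
  have hb := tendsto_iff_dist_tendsto_zero.1 (b.continuous.continuousAt (x := t₀))
  refine squeeze_zero' (Filter.Eventually.of_forall fun _ => dist_nonneg) ?_ hb
  filter_upwards [hU] with t ht
  exact hd t ht t₀ (mem_of_mem_nhds hU)

/-- The developing map does not increase lengths. -/
theorem edist_dev_le_length {x y : Pants v} (b : Path x y) {e e' : DevSpace H ε₀}
    (h : Continues (Path.Homotopic.Quotient.mk b) e e') :
    edist (dev e) (dev e') ≤ Pants.length b := by
  obtain ⟨Γ, h1, h2⟩ := exists_lift b h.proj_left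
  have h3 : Γ 1 = e' := Continues.unique ⟨b, rfl, Γ, h1, h2, rfl⟩ h
  choose U hU hd using exists_nhds_dist_dev_le h1
  have hU' : ∀ t, t ∈ interior (U t) := fun t => mem_interior_iff_mem_nhds.2 (hU t)
  obtain ⟨s, hs0, hsm, ⟨N, hN⟩, hs⟩ :=
    exists_monotone_Icc_subset_open_cover_unitInterval (c := fun t => interior (U t))
      (fun t => isOpen_interior) (fun t _ => mem_iUnion.2 ⟨t, hU' t⟩)
  have hstep : ∀ n, edist (dev (Γ (s n))) (dev (Γ (s (n + 1)))) ≤ edist (b (s (n + 1))) (b (s n)) := by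
    intro n
    obtain ⟨t, ht⟩ := hs n
    have hle := hsm n.le_succ
    have := hd t _ (interior_subset (ht ⟨le_rfl, hle⟩)) _ (interior_subset (ht ⟨hle, le_rfl⟩))
    rw [edist_dist, edist_comm, edist_dist]
    exact ENNReal.ofReal_le_ofReal this
  have hsum : edist (dev (Γ (s 0))) (dev (Γ (s N))) ≤
      ∑ n ∈ Finset.range N, edist (b (s (n + 1))) (b (s n)) :=
    (edist_le_range_sum_edist (fun n => dev (Γ (s n))) N).trans
      (Finset.sum_le_sum fun n _ => hstep n)
  rw [hs0, hN N le_rfl, h2, h3] at hsum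
  exact hsum.trans (eVariationOn.sum_le hsm fun _ => mem_univ _)

/-! ### Paths in the faces -/

theorem hexLerp_zero (z w : hexRegion v) : hexLerp z w 0 = z := Subtype.ext (lerp_zero _ _)

theorem hexLerp_one (z w : hexRegion v) : hexLerp z w 1 = w := Subtype.ext (lerp_one _ _)

/-- The geodesic path in the face `ε` between two of its points. -/
def facePath (ε : Bool) (z w : hexRegion v) {x y : Pants v} (hx : x = inFace ε z)
    (hy : y = inFace ε w) : Path x y where
  toFun t := inFace ε (hexLerp z w t)
  continuous_toFun := (isometry_inFace ε).continuous.comp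
    (continuous_hexLerp.comp (continuous_const.prodMk (continuous_const.prodMk continuous_id)))
  source' := by rw [hx, hexLerp_zero]
  target' := by rw [hy, hexLerp_one]

theorem Continues.facePath {ε : Bool} {z w : hexRegion v} {x y : Pants v} (hx : x = inFace ε z)
    (hy : y = inFace ε w) (g : ℍ ≃ᵢ ℍ) :
    Continues (.mk (facePath ε z w hx hy)) (sec H ε₀ ε g z) (sec H ε₀ ε g w) := by
  refine ⟨_, rfl, ⟨fun t => sec H ε₀ ε g (hexLerp z w t), (continuous_sec ε g).comp
    (continuous_hexLerp.comp (continuous_const.prodMk (continuous_const.prodMk continuous_id)))⟩,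
    fun t => rfl, ?_, ?_⟩
  · exact congrArg (sec H ε₀ ε g) (hexLerp_zero z w)
  · exact congrArg (sec H ε₀ ε g) (hexLerp_one z w)

theorem range_facePath_subset_seamNhd {ε : Bool} {z w : hexRegion v} {x y : Pants v}
    (hx : x = inFace ε z) (hy : y = inFace ε w) {k : Fin 3} (hxk : x ∈ seamNhd v k)
    (hyk : y ∈ seamNhd v k) : range (facePath ε z w hx hy) ⊆ seamNhd v k := by
  rintro _ ⟨t, rfl⟩ l hl
  change 0 < seamFn v l (fold (inFace ε (hexLerp z w t)))
  rw [fold_inFace]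
  have h1 := hxk l hl
  have h2 := hyk l hl
  rw [hx, fold_inFace] at h1
  rw [hy, fold_inFace] at h2
  exact seamFn_lerp_pos h1 h2 t

/-! ### The fundamental groupoid is generated by the crossings of the seams -/

/-- A base point `o` of the hexagon which is on no seam, and a crossing point on each seam. -/
structure CrossingPoints (v : Fin 6 → ℍ) where
  /-- the base point -/
  o : hexRegion v
  /-- the crossing points -/
  m : Fin 3 → hexRegion v
  pos_o : ∀ k, 0 < seamFn v k o
  mem_m : ∀ k, (m k : ℍ) ∈ seamSide v k

namespace CrossingPoints

variable (B : CrossingPoints v)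

theorem o_mem_seamNhd (ε : Bool) (k : Fin 3) : inFace ε B.o ∈ seamNhd v k := fun l _ => by
  rw [fold_inFace]; exact B.pos_o l

theorem m_mem_seamNhd (H : IsHexFrame v) (ε : Bool) (k : Fin 3) : inFace ε (B.m k) ∈ seamNhd v k :=
  fun l hl => by rw [fold_inFace]; exact H.seamFn_pos_of_mem_seamSide (B.mem_m k) hl

theorem inFace_m (ε ε' : Bool) (k : Fin 3) : inFace ε (B.m k) = inFace ε' (B.m k) :=
  inFace_eq_of_mem_seams (mem_iUnion.2 ⟨k, B.mem_m k⟩) _ _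

/-- The path from the base point of one face to that of the other face, through the crossing point
of the `k`-th seam. -/
def crossing (ε : Bool) (k : Fin 3) : Path (inFace ε B.o) (inFace (!ε) B.o) :=
  (facePath ε B.o (B.m k) rfl rfl).trans
    (facePath (!ε) (B.m k) B.o (B.inFace_m _ _ k) rfl)

theorem crossing_subset (H : IsHexFrame v) (ε : Bool) (k : Fin 3) :
    range (B.crossing ε k) ⊆ seamNhd v k := by
  rw [crossing, Path.trans_range, union_subset_iff]
  exact ⟨range_facePath_subset_seamNhd _ _ (B.o_mem_seamNhd _ k) (B.m_mem_seamNhd H _ k),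
    range_facePath_subset_seamNhd _ _ (B.m_mem_seamNhd H _ k) (B.o_mem_seamNhd _ k)⟩

/-- `q` is the class of a path which successively crosses the seams of the list `l`. -/
inductive IsWord : (ε ε' : Bool) → List (Fin 3) →
    Path.Homotopic.Quotient (inFace ε B.o) (inFace ε' B.o) → Prop
  | nil (ε : Bool) : IsWord ε ε [] (.refl _)
  | cons (ε : Bool) {ε' : Bool} (k : Fin 3) {l : List (Fin 3)}
      {q : Path.Homotopic.Quotient (inFace (!ε) B.o) (inFace ε' B.o)} (h : IsWord (!ε) ε' l q) :
      IsWord ε ε' (k :: l) (Path.Homotopic.Quotient.trans (.mk (B.crossing ε k)) q)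

end CrossingPoints

end

section

variable {v : Fin 6 → ℍ} {H : IsHexFrame v} {ε₀ : Bool}

namespace CrossingPoints

variable (B : CrossingPoints v)

theorem IsWord.append {B : CrossingPoints v} {ε ε' ε'' : Bool} {l l' : List (Fin 3)}
    {q : Path.Homotopic.Quotient (inFace ε B.o) (inFace ε' B.o)}
    {q' : Path.Homotopic.Quotient (inFace ε' B.o) (inFace ε'' B.o)} (h : B.IsWord ε ε' l q)
    (h' : B.IsWord ε' ε'' l' q') : B.IsWord ε ε'' (l ++ l') (q.trans q') := by
  induction h with
  | nil ε => rw [Path.Homotopic.Quotient.refl_trans]; exact h'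
  | cons ε k h ih =>
    rw [Path.Homotopic.Quotient.trans_assoc]
    exact .cons ε k (ih h')

theorem crossing_trans_crossing (H : IsHexFrame v) (k : Fin 3) :
    (∀ ε' (q : Path.Homotopic.Quotient (inFace true B.o) (inFace ε' B.o)),
      Path.Homotopic.Quotient.trans (.mk (B.crossing true k))
        (Path.Homotopic.Quotient.trans (.mk (B.crossing false k)) q) = q) ∧
    ∀ ε' (q : Path.Homotopic.Quotient (inFace false B.o) (inFace ε' B.o)),
      Path.Homotopic.Quotient.trans (.mk (B.crossing false k))
        (Path.Homotopic.Quotient.trans (.mk (B.crossing true k)) q) = q := by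
  have key : ∀ {x y : Pants v} (b : Path x y) (b' : Path y x), range b ⊆ seamNhd v k →
      range b' ⊆ seamNhd v k → ∀ {w : Pants v} (q : Path.Homotopic.Quotient x w),
      Path.Homotopic.Quotient.trans (.mk b) (Path.Homotopic.Quotient.trans (.mk b') q) = q := by
    intro x y b b' hb hb' w q
    have : (b.trans b').Homotopic (Path.refl x) := by
      refine H.homotopic_of_range_subset (k := k) ?_ ?_
      · rw [Path.trans_range]; exact union_subset hb hb'
      · rintro _ ⟨t, rfl⟩; exact hb ⟨0, b.source⟩
    rw [← Path.Homotopic.Quotient.trans_assoc, ← Path.Homotopic.Quotient.mk_trans,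
      Path.Homotopic.Quotient.eq.2 this, Path.Homotopic.Quotient.mk_refl,
      Path.Homotopic.Quotient.refl_trans]
  exact ⟨fun _ q => key _ _ (B.crossing_subset H _ k) (B.crossing_subset H _ k) q,
    fun _ q => key _ _ (B.crossing_subset H _ k) (B.crossing_subset H _ k) q⟩

/-- Every word can be reduced: crossing a seam twice in a row is homotopic to doing nothing. -/
theorem IsWord.exists_reduced {B : CrossingPoints v} (H : IsHexFrame v) {ε ε' : Bool}
    {l : List (Fin 3)} {q : Path.Homotopic.Quotient (inFace ε B.o) (inFace ε' B.o)}
    (h : B.IsWord ε ε' l q) : ∃ l', l'.IsChain (· ≠ ·) ∧ B.IsWord ε ε' l' q := by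
  induction h with
  | nil ε => exact ⟨[], .nil, .nil ε⟩
  | @cons ε ε' k l q h ih =>
    obtain ⟨l', hl', h'⟩ := ih
    cases h' with
    | nil => exact ⟨[k], .singleton k, .cons ε k (.nil _)⟩
    | @cons _ _ k' l'' q'' h'' =>
      by_cases hk : k = k'
      · subst hk
        refine ⟨l'', hl'.tail, ?_⟩
        cases ε with
        | true =>
          exact ((B.crossing_trans_crossing H k).1 _ q'').symm ▸ h''
        | false =>
          exact ((B.crossing_trans_crossing H k).2 _ q'').symm ▸ h''
      · exact ⟨k :: k' :: l'', List.isChain_cons_cons.2 ⟨hk, hl'⟩, .cons ε k (.cons _ k' h'')⟩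

/-- The class `q` is the class of a path that runs in a face to the base point, crosses some seams,
and runs in a face to its end. -/
def Generated {x y : Pants v} (q : Path.Homotopic.Quotient x y) : Prop :=
  ∀ (ε : Bool) (z : hexRegion v) (hx : x = inFace ε z) (ε' : Bool) (z' : hexRegion v)
    (hy : y = inFace ε' z'), ∃ l q', B.IsWord ε ε' l q' ∧
      q = Path.Homotopic.Quotient.trans (.mk (facePath ε z B.o hx rfl))
        (q'.trans (.mk (facePath ε' B.o z' rfl hy)))

theorem generated_of_range_subset (H : IsHexFrame v) {x y : Pants v} {b : Path x y} {k : Fin 3}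
    (hb : range b ⊆ seamNhd v k) : B.Generated (.mk b) := by
  intro ε z hx ε' z' hy
  have hxk : x ∈ seamNhd v k := hb ⟨0, b.source⟩
  have hyk : y ∈ seamNhd v k := hb ⟨1, b.target⟩
  have h1 : range (facePath ε z B.o hx rfl) ⊆ seamNhd v k :=
    range_facePath_subset_seamNhd _ _ hxk (B.o_mem_seamNhd _ k)
  have h2 : range (facePath ε' B.o z' rfl hy) ⊆ seamNhd v k :=
    range_facePath_subset_seamNhd _ _ (B.o_mem_seamNhd _ k) hyk
  by_cases h : ε' = ε
  · subst h
    refine ⟨[], _, .nil ε', ?_⟩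
    rw [Path.Homotopic.Quotient.refl_trans, ← Path.Homotopic.Quotient.mk_trans]
    refine Path.Homotopic.Quotient.eq.2 (H.homotopic_of_range_subset (k := k) hb ?_)
    rw [Path.trans_range]; exact union_subset h1 h2
  · obtain rfl : ε' = !ε := by cases ε <;> cases ε' <;> simp_all
    refine ⟨[k], _, .cons ε k (.nil _), ?_⟩
    rw [Path.Homotopic.Quotient.trans_refl, ← Path.Homotopic.Quotient.mk_trans,
      ← Path.Homotopic.Quotient.mk_trans]
    refine Path.Homotopic.Quotient.eq.2 (H.homotopic_of_range_subset (k := k) hb ?_)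
    rw [Path.trans_range, Path.trans_range]
    exact union_subset h1 (union_subset (B.crossing_subset H _ k) h2)

variable {B} in
theorem Generated.trans (H : IsHexFrame v) {x y w : Pants v} {q : Path.Homotopic.Quotient x y}
    {q' : Path.Homotopic.Quotient y w} (h : B.Generated q) (h' : B.Generated q') :
    B.Generated (q.trans q') := by
  intro ε z hx ε' z' hw
  obtain ⟨ε'', z'', hy⟩ := exists_eq_inFace y
  obtain ⟨l, p, hp, e⟩ := h ε z hx ε'' z'' hy
  obtain ⟨l', p', hp', e'⟩ := h' ε'' z'' hy ε' z' hw
  refine ⟨l ++ l', p.trans p', hp.append hp', ?_⟩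
  obtain ⟨k, hk⟩ := H.exists_mem_seamNhd y
  have h0 : ((facePath ε'' B.o z'' rfl hy).trans (facePath ε'' z'' B.o hy rfl)).Homotopic
      (Path.refl _) := by
    refine H.homotopic_of_range_subset (k := k) ?_ ?_
    · rw [Path.trans_range]
      exact union_subset (range_facePath_subset_seamNhd _ _ (B.o_mem_seamNhd _ k) hk)
        (range_facePath_subset_seamNhd _ _ hk (B.o_mem_seamNhd _ k))
    · rintro _ ⟨t, rfl⟩; exact B.o_mem_seamNhd _ k
  have h1 := Path.Homotopic.Quotient.eq.2 h0
  rw [Path.Homotopic.Quotient.mk_trans, Path.Homotopic.Quotient.mk_refl] at h1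
  rw [e, e']
  simp only [Path.Homotopic.Quotient.trans_assoc]
  congr 2
  rw [← Path.Homotopic.Quotient.trans_assoc (.mk (facePath ε'' B.o z'' rfl hy)), h1,
    Path.Homotopic.Quotient.refl_trans]

variable {B} in
theorem generated_of_cast {x y x' y' : Pants v} {b : Path x y} (hx : x' = x) (hy : y' = y)
    (h : B.Generated (.mk (b.cast hx hy))) : B.Generated (.mk b) := by
  subst hx
  subst hy
  exact h

theorem generated (H : IsHexFrame v) {x y : Pants v} (q : Path.Homotopic.Quotient x y) :
    B.Generated q := by
  obtain ⟨b, rfl⟩ := Path.Homotopic.Quotient.mk_surjective q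
  obtain ⟨s, hs0, hsm, ⟨N, hN⟩, hs⟩ :=
    exists_monotone_Icc_subset_open_cover_unitInterval (c := fun k => b ⁻¹' seamNhd v k)
      (fun k => (isOpen_seamNhd k).preimage b.continuous)
      (fun t _ => mem_iUnion.2 (H.exists_mem_seamNhd (b t)))
  have key : ∀ n, B.Generated (.mk (b.subpath (s 0) (s n))) := by
    intro n
    induction n with
    | zero =>
      obtain ⟨k, hk⟩ := H.exists_mem_seamNhd (b (s 0))
      refine B.generated_of_range_subset H (k := k) ?_
      rw [Path.subpath_self]
      rintro _ ⟨t, rfl⟩; exact hk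
    | succ n ih =>
      rw [← Path.Homotopic.Quotient.eq.2 ⟨Path.Homotopy.subpathTransSubpath b (s 0) (s n) (s (n + 1))⟩,
        Path.Homotopic.Quotient.mk_trans]
      obtain ⟨k, hk⟩ := hs n
      refine ih.trans H (B.generated_of_range_subset H (k := k) ?_)
      rw [Path.range_subpath_of_le _ _ _ (hsm n.le_succ)]
      exact image_subset_iff.2 hk
  have h := key N
  rw [hs0, hN N le_rfl, Path.subpath_zero_one] at h
  exact generated_of_cast b.source b.target h

/-- The continuation of a germ along a word. -/
theorem IsWord.continues {B : CrossingPoints v} {ε ε' : Bool} {l : List (Fin 3)}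
    {q : Path.Homotopic.Quotient (inFace ε B.o) (inFace ε' B.o)} (h : B.IsWord ε ε' l q)
    (g : ℍ ≃ᵢ ℍ) :
    Continues q (sec H ε₀ ε g B.o) (sec H ε₀ ε' (g * (l.map (seamRefl H)).prod) B.o) := by
  induction h generalizing g with
  | nil ε =>
    rw [List.map_nil, List.prod_nil, mul_one]
    exact Continues.refl _ rfl
  | @cons ε ε' k l q h ih =>
    rw [List.map_cons, List.prod_cons, ← mul_assoc]
    refine Continues.trans ?_ (ih (g * seamRefl H k))
    rw [crossing, Path.Homotopic.Quotient.mk_trans]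
    refine (Continues.facePath _ _ g).trans ?_
    rw [sec_eq_sec_not (B.mem_m k)]
    exact Continues.facePath _ _ _

end CrossingPoints

/-! ### Paths with endpoints on a boundary curve -/

theorem seamFn_lerp_pos_of_left {z w : ℍ} {l : Fin 3} (hz : 0 < seamFn v l z)
    (hw : 0 ≤ seamFn v l w) {t : I} (ht : t < 1) : 0 < seamFn v l (lerp z w t) := by
  obtain ⟨c, hc, h⟩ := vec_lerp z w t
  have h0 := t.2.1
  have h1 : (0 : ℝ) < 1 - t := sub_pos.2 (show (t : ℝ) < 1 from ht)
  rw [seamFn, h, mink_add_left, mink_smul_left, mink_smul_left]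
  change 0 < c * (1 - t : ℝ) * seamFn v l z + c * t * seamFn v l w
  positivity

theorem seamFn_lerp_pos_of_right {z w : ℍ} {l : Fin 3} (hz : 0 ≤ seamFn v l z)
    (hw : 0 < seamFn v l w) {t : I} (ht : 0 < t) : 0 < seamFn v l (lerp z w t) := by
  obtain ⟨c, hc, h⟩ := vec_lerp z w t
  have h0 : (0 : ℝ) < t := show (0 : ℝ) < t from ht
  have h1 : (0 : ℝ) ≤ 1 - t := sub_nonneg.2 t.2.2
  rw [seamFn, h, mink_add_left, mink_smul_left, mink_smul_left]
  change 0 < c * (1 - t : ℝ) * seamFn v l z + c * t * seamFn v l w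
  positivity

theorem vs_mem_boundarySide (i : Fin 3) : vs v i ∈ boundarySide v i := by
  rw [boundarySide_eq]; exact self_mem_geodSegment_left _ _

theorem ve_mem_boundarySide (i : Fin 3) : ve v i ∈ boundarySide v i := by
  rw [boundarySide_eq]; exact self_mem_geodSegment_right _ _

theorem boundarySide_subset_hexRegion (i : Fin 3) : boundarySide v i ⊆ hexRegion v := by
  rintro z hz S ⟨hS, hv⟩
  exact hS _ (hv ⟨_, rfl⟩) _ (hv ⟨_, rfl⟩) hz

theorem mem_seamSide_ve (k : Fin 3) : ve v k ∈ seamSide v k := by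
  rw [seamSide_eq]; exact self_mem_geodSegment_left _ _

theorem mem_seamSide_vs (k : Fin 3) : vs v k ∈ seamSide v (k + 2) := by
  rw [seamSide_eq, show k + 2 + 1 = k by fin_cases k <;> rfl]
  exact self_mem_geodSegment_right _ _

/-- The crossing points adapted to the `i`-th boundary curve: as many of them as possible are on
it. -/
def sidePoints (H : IsHexFrame v) (i : Fin 3) : CrossingPoints v where
  o := ⟨lerp (vs v i) (ve v i) ⟨1 / 2, by norm_num, by norm_num⟩,
    boundarySide_subset_hexRegion i (by rw [boundarySide_eq]; exact lerp_mem_geodSegment _ _ _)⟩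
  m k := if k = i + 2 then ⟨vs v i, boundarySide_subset_hexRegion i (vs_mem_boundarySide i)⟩ else
    ⟨ve v k, boundarySide_subset_hexRegion k (ve_mem_boundarySide k)⟩
  pos_o k := by
    have h1 : (⟨1 / 2, by norm_num, by norm_num⟩ : I) < 1 :=
      show (1 / 2 : ℝ) < 1 by norm_num
    have h0 : 0 < (⟨1 / 2, by norm_num, by norm_num⟩ : I) :=
      show (0 : ℝ) < 1 / 2 by norm_num
    rcases fin3_cases i k with rfl | rfl | rfl
    · refine seamFn_lerp_pos_of_left ?_ (H.seamFn_ve_nonneg _ _) h1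
      rw [H.seamFn_vs_self]; exact shA_pos
    · refine seamFn_lerp_pos_of_left ?_ (H.seamFn_ve_nonneg _ _) h1
      rw [H.seamFn_vs_opp]
      have := shA_pos; have := one_lt_chA
      positivity
    · refine seamFn_lerp_pos_of_right (H.seamFn_vs_nonneg _ _) ?_ h0
      rw [H.seamFn_ve_prev]; exact shA_pos
  mem_m k := by
    by_cases h : k = i + 2
    · subst h; simp only [if_true]; exact mem_seamSide_vs i
    · simp only [if_neg h]; exact mem_seamSide_ve k

theorem inFace_mem_bdry {ε : Bool} {z : hexRegion v} {i : Fin 3} (hz : (z : ℍ) ∈ boundarySide v i) :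
    inFace ε z ∈ Pants.bdry v i := by
  cases ε
  · exact Or.inr ⟨z, hz, rfl⟩
  · exact Or.inl ⟨z, hz, rfl⟩

theorem range_facePath_subset_bdry {ε : Bool} {z w : hexRegion v} {x y : Pants v}
    (hx : x = inFace ε z) (hy : y = inFace ε w) {i : Fin 3} (hz : (z : ℍ) ∈ boundarySide v i)
    (hw : (w : ℍ) ∈ boundarySide v i) : range (facePath ε z w hx hy) ⊆ Pants.bdry v i := by
  rintro _ ⟨t, rfl⟩
  refine inFace_mem_bdry ?_
  rw [boundarySide_eq] at *
  exact geodConvex_geodSegment _ _ _ hz _ hw (lerp_mem_geodSegment _ _ _)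

theorem sidePoints_o (i : Fin 3) : ((sidePoints H i).o : ℍ) ∈ boundarySide v i := by
  rw [boundarySide_eq]; exact lerp_mem_geodSegment _ _ _

theorem sidePoints_m {i k : Fin 3} (hk : k ≠ i + 1) :
    ((sidePoints H i).m k : ℍ) ∈ boundarySide v i := by
  change ((if k = i + 2 then (⟨vs v i, _⟩ : hexRegion v) else ⟨ve v k, _⟩ : hexRegion v) : ℍ) ∈ _
  split_ifs with h
  · exact vs_mem_boundarySide i
  · obtain rfl : k = i := by
      rcases fin3_cases i k with h' | h' | h'
      · exact h'
      · exact absurd h' hk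
      · exact absurd h' h
    exact ve_mem_boundarySide k

/-- A word without the seam opposite to the `i`-th boundary curve is the class of a path in this
curve. -/
theorem exists_path_bdry_of_isWord {i : Fin 3} {ε ε' : Bool} {l : List (Fin 3)}
    {q : Path.Homotopic.Quotient (inFace ε (sidePoints H i).o) (inFace ε' (sidePoints H i).o)}
    (h : (sidePoints H i).IsWord ε ε' l q) (hl : i + 1 ∉ l) :
    ∃ b, Path.Homotopic.Quotient.mk b = q ∧ range b ⊆ Pants.bdry v i := by
  induction h with
  | nil ε =>
    refine ⟨Path.refl _, rfl, ?_⟩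
    rintro _ ⟨t, rfl⟩
    exact inFace_mem_bdry (sidePoints_o i)
  | cons ε k h ih =>
    obtain ⟨b, rfl, hb⟩ := ih fun h' => hl (List.mem_cons_of_mem _ h')
    refine ⟨_, Path.Homotopic.Quotient.mk_trans _ _, ?_⟩
    have hk : k ≠ i + 1 := fun h' => hl (h' ▸ List.mem_cons_self)
    rw [CrossingPoints.crossing, Path.trans_range, Path.trans_range]
    exact union_subset (union_subset (range_facePath_subset_bdry _ _ (sidePoints_o i)
      (sidePoints_m hk)) (range_facePath_subset_bdry _ _ (sidePoints_m hk) (sidePoints_o i))) hb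

/-- Every class of paths is described by a reduced word of seam reflections. If the paths have
their endpoints on the `i`-th boundary curve and are not homotopic into it, then the reflection in
the opposite seam occurs. -/
theorem exists_reduced_word (H : IsHexFrame v) (ε₀ : Bool) {x y : Pants v}
    (q : Path.Homotopic.Quotient x y) {ε ε' : Bool} {z z' : hexRegion v} (hx : x = inFace ε z)
    (hy : y = inFace ε' z') (i : Fin 3) :
    ∃ l : List (Fin 3), l.IsChain (· ≠ ·) ∧
      (∀ g : ℍ ≃ᵢ ℍ, Continues q (sec H ε₀ ε g z)
        (sec H ε₀ ε' (g * (l.map (seamRefl H)).prod) z')) ∧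
      ((z : ℍ) ∈ boundarySide v i → (z' : ℍ) ∈ boundarySide v i →
        (¬ ∃ b : Path x y, Path.Homotopic.Quotient.mk b = q ∧ range b ⊆ Pants.bdry v i) →
        i + 1 ∈ l) := by
  obtain ⟨l₀, q', hq', rfl⟩ := (sidePoints H i).generated H q ε z hx ε' z' hy
  obtain ⟨l, hl, hw⟩ := hq'.exists_reduced H
  refine ⟨l, hl, fun g => ?_, fun hz hz' hb => ?_⟩
  · exact (Continues.facePath hx rfl g).trans ((hw.continues g).trans (Continues.facePath rfl hy _))
  · by_contra hil
    obtain ⟨b, rfl, hb'⟩ := exists_path_bdry_of_isWord hw hil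
    refine hb ⟨_, (Path.Homotopic.Quotient.mk_trans _ _).trans
      (congrArg _ (Path.Homotopic.Quotient.mk_trans _ _)), ?_⟩
    rw [Path.trans_range, Path.trans_range]
    exact union_subset (range_facePath_subset_bdry _ _ hz (sidePoints_o i))
      (union_subset hb' (range_facePath_subset_bdry _ _ (sidePoints_o i) hz'))

end

section

variable {v : Fin 6 → ℍ}

theorem fin3_add_two_ne (i : Fin 3) : i + 2 ≠ i := by revert i; decide

theorem fin3_add_one_add_one (i : Fin 3) : i + 1 + 1 = i + 2 := by revert i; decide

theorem fin3_add_two_add_one (i : Fin 3) : i + 2 + 1 = i := by revert i; decide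

theorem fin3_add_two_add_two (i : Fin 3) : i + 2 + 2 = i + 1 := by revert i; decide

/-! ### The lines that carry the boundary sides -/

/-- The arc length parametrization of the line that carries the `i`-th boundary side, on the
hyperboloid; the parameters `0` and `9 / 20` give the two vertices. -/
def lineVec (v : Fin 6 → ℍ) (i : Fin 3) (x : ℝ) : Vec :=
  Real.cosh x • vec (vs v i) - Real.sinh x • seamNormal v (i + 2)

/-- The arc length parametrization of the line that carries the `i`-th boundary side. -/
def line (v : Fin 6 → ℍ) (i : Fin 3) (x : ℝ) : ℍ := ofVec (lineVec v i x)

namespace IsHexFrame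

variable (H : IsHexFrame v)
include H

theorem seamNormal_eq (i : Fin 3) :
    seamNormal v i = shA • vec (vs v i) - chA • seamNormal v (i + 2) := by
  have := shA_pos.ne'
  rw [H.vs_eq, smul_smul, mul_inv_cancel₀ this]; module

theorem mink_lineVec_self (i : Fin 3) (x : ℝ) : mink (lineVec v i x) (lineVec v i x) = 1 := by
  have h := H.seamFn_vs_prev i
  rw [seamFn] at h
  simp only [lineVec, mink_sub_left, mink_sub_right, mink_smul_left, mink_smul_right, mink_vec_self,
    H.self, h, mink_comm (seamNormal v (i + 2)) (vec (vs v i))]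
  linear_combination Real.cosh_sq x

theorem vec_line (i : Fin 3) (x : ℝ) : vec (line v i x) = lineVec v i x := by
  refine vec_ofVec_of_unit (future_of_mink_pos (u := vec (vs v i)) ?_ (future_vec _) ?_).1
    (H.mink_lineVec_self i x)
  · rw [H.mink_lineVec_self]; exact one_pos
  · have h := H.seamFn_vs_prev i
    rw [seamFn] at h
    rw [lineVec, mink_sub_left, mink_smul_left, mink_smul_left, mink_vec_self,
      mink_comm (seamNormal v (i + 2)), h]
    have := Real.cosh_pos x
    linarith

theorem seamFn_prev_line (i : Fin 3) (x : ℝ) : seamFn v (i + 2) (line v i x) = Real.sinh x := by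
  have h := H.seamFn_vs_prev i
  rw [seamFn] at h
  rw [seamFn, H.vec_line, lineVec, mink_sub_left, mink_smul_left, mink_smul_left, H.self, h]
  ring

theorem seamFn_self_line (i : Fin 3) (x : ℝ) :
    seamFn v i (line v i x) = Real.sinh (9 / 20 - x) := by
  have h := H.seamFn_vs_self i
  rw [seamFn] at h
  rw [seamFn, H.vec_line, lineVec, mink_sub_left, mink_smul_left, mink_smul_left,
    H.ne _ _ (fin3_add_two_ne i), h, Real.sinh_sub, shA, chA]
  ring

theorem line_injective (i : Fin 3) : Function.Injective (line v i) := fun x y h => by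
  have := H.seamFn_prev_line i x
  rw [h, H.seamFn_prev_line] at this
  exact (Real.sinh_injective this).symm

theorem line_zero (i : Fin 3) : line v i 0 = vs v i :=
  vec_injective (by rw [H.vec_line, lineVec]; simp)

theorem seamRefl_prev_line (i : Fin 3) (x : ℝ) :
    seamRefl H (i + 2) (line v i x) = line v i (-x) := by
  apply vec_injective
  have h := H.seamFn_prev_line i x
  rw [seamFn] at h
  rw [vec_seamRefl, reflect, h, H.vec_line, H.vec_line, lineVec, lineVec, Real.cosh_neg,
    Real.sinh_neg]
  module

theorem seamRefl_self_line (i : Fin 3) (x : ℝ) :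
    seamRefl H i (line v i x) = line v i (9 / 10 - x) := by
  apply vec_injective
  have h := H.seamFn_self_line i x
  rw [seamFn] at h
  rw [vec_seamRefl, reflect, h, H.vec_line, H.vec_line, lineVec, lineVec, H.seamNormal_eq i]
  obtain ⟨y, rfl⟩ : ∃ y, x = 9 / 20 - y := ⟨9 / 20 - x, by ring⟩
  rw [show (9 / 10 - (9 / 20 - y) : ℝ) = 9 / 20 + y by ring, sub_sub_cancel]
  have e1 : Real.cosh (9 / 20 + y) = Real.cosh (9 / 20 - y) + 2 * Real.sinh y * shA := by
    rw [Real.cosh_add, Real.cosh_sub, shA]; ring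
  have e2 : Real.sinh (9 / 20 + y) = Real.sinh (9 / 20 - y) + 2 * Real.sinh y * chA := by
    rw [Real.sinh_add, Real.sinh_sub, chA]; ring
  rw [e1, e2]
  module

/-- The points of a boundary side are the points of its line with parameter in `[0, 9 / 20]`. -/
theorem exists_eq_line {i : Fin 3} {z : ℍ} (hz : z ∈ boundarySide v i) :
    ∃ x, 0 ≤ x ∧ x ≤ 9 / 20 ∧ z = line v i x := by
  have hs : 0 ≤ seamFn v i z := H.seamFn_nonneg (boundarySide_subset_hexRegion i hz) i
  rw [boundarySide_eq] at hz
  obtain ⟨α, β, hα, hβ, h⟩ := exists_comb_of_mem_geodSegment hz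
  have hsh := shA_pos
  have hch := one_lt_chA
  have hve : vec (ve v i) = chA • vec (vs v i) - shA • seamNormal v (i + 2) := by
    have h1 : shA ≠ 0 := hsh.ne'
    rw [H.ve_eq, H.seamNormal_eq i, smul_add, smul_sub, smul_sub, smul_smul, smul_smul, smul_smul,
      smul_smul]
    have e1 : shA⁻¹ * chA * shA = chA := by field_simp
    have e2 : shA⁻¹ = shA⁻¹ * chA * chA - shA := by
      field_simp; linear_combination -chA_sq
    rw [e1]
    nth_rw 2 [e2]
    module
  have hz' : vec z = (α + β * chA) • vec (vs v i) - (β * shA) • seamNormal v (i + 2) := by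
    rw [h, hve]; module
  have hvs := H.seamFn_vs_prev i
  rw [seamFn] at hvs
  have hunit : (α + β * chA) ^ 2 - (β * shA) ^ 2 = 1 := by
    have := mink_vec_self z
    rw [hz'] at this
    simp only [mink_sub_left, mink_sub_right, mink_smul_left, mink_smul_right, mink_vec_self,
      H.self, hvs, mink_comm (seamNormal v (i + 2)) (vec (vs v i))] at this
    linear_combination this
  have hsx : Real.sinh (Real.arsinh (β * shA)) = β * shA := Real.sinh_arsinh _
  have hcx : Real.cosh (Real.arsinh (β * shA)) = α + β * chA := by
    refine (pow_left_inj₀ (Real.cosh_pos _).le (by positivity) two_ne_zero).1 ?_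
    rw [Real.cosh_sq, hsx]; linarith
  have heq : z = line v i (Real.arsinh (β * shA)) := by
    apply vec_injective
    rw [H.vec_line, lineVec, hsx, hcx, hz']
  refine ⟨Real.arsinh (β * shA), Real.arsinh_nonneg_iff.2 (by positivity), ?_, heq⟩
  rw [heq, H.seamFn_self_line, Real.sinh_nonneg_iff] at hs
  linarith

end IsHexFrame

/-! ### Reduced words of seam reflections -/

/-- The linear action of a word of seam reflections. -/
def wordAct (v : Fin 6 → ℍ) (l : List (Fin 3)) (u : Vec) : Vec :=
  l.foldr (fun k u => reflect (seamNormal v k) u) u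

theorem wordAct_cons (k : Fin 3) (l : List (Fin 3)) (u : Vec) :
    wordAct v (k :: l) u = reflect (seamNormal v k) (wordAct v l u) := rfl

theorem vec_prod_seamRefl (H : IsHexFrame v) (l : List (Fin 3)) (z : ℍ) :
    vec ((l.map (seamRefl H)).prod z) = wordAct v l (vec z) := by
  induction l with
  | nil => rfl
  | cons k l ih =>
    rw [List.map_cons, List.prod_cons, wordAct_cons, ← ih, ← vec_seamRefl H]; rfl

theorem wordAct_add (l : List (Fin 3)) (u w : Vec) :
    wordAct v l (u + w) = wordAct v l u + wordAct v l w := by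
  induction l with
  | nil => rfl
  | cons k l ih => rw [wordAct_cons, ih, reflect_add]; rfl

theorem wordAct_smul (l : List (Fin 3)) (c : ℝ) (u : Vec) :
    wordAct v l (c • u) = c • wordAct v l u := by
  induction l with
  | nil => rfl
  | cons k l ih => rw [wordAct_cons, ih, reflect_smul]; rfl

theorem mink_wordAct (H : IsHexFrame v) (l : List (Fin 3)) (u w : Vec) :
    mink (wordAct v l u) (wordAct v l w) = mink u w := by
  induction l with
  | nil => rfl
  | cons k l ih => rw [wordAct_cons, wordAct_cons, mink_reflect (H.self k), ih]

/-- The factor that normalizes `sideNormal`. -/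
def sideFactor : ℝ := (√((chA - 1) * (chA + 1) * (2 * chA - 1)))⁻¹

theorem sideFactor_pos : 0 < sideFactor := by
  have := one_lt_chA
  have h1 : 0 < chA - 1 := by linarith
  have h2 : 0 < 2 * chA - 1 := by linarith
  rw [sideFactor]; positivity

theorem sideFactor_sq : sideFactor ^ 2 * ((chA - 1) * (chA + 1) * (2 * chA - 1)) = 1 := by
  have := one_lt_chA
  have h1 : 0 < chA - 1 := by linarith
  have h2 : 0 < 2 * chA - 1 := by linarith
  have h3 : 0 < (chA - 1) * (chA + 1) * (2 * chA - 1) := by positivity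
  rw [sideFactor, inv_pow, Real.sq_sqrt h3.le, inv_mul_cancel₀ h3.ne']

/-- The unit normal vector of the line that carries the `i`-th boundary side, on the side of the
hexagon. -/
def sideNormal (v : Fin 6 → ℍ) (i : Fin 3) : Vec :=
  sideFactor • (chA • (seamNormal v i + seamNormal v (i + 2)) - (chA - 1) • seamNormal v (i + 1))

theorem mink_sideNormal (u : Vec) (i : Fin 3) : mink u (sideNormal v i) =
    sideFactor * (chA * (mink u (seamNormal v i) + mink u (seamNormal v (i + 2))) -
      (chA - 1) * mink u (seamNormal v (i + 1))) := by
  simp only [sideNormal, mink_sub_right, mink_add_right, mink_smul_right]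

/-- The product of the unit normals of a boundary side and of the opposite seam. -/
def sideSeam : ℝ := sideFactor * ((2 * chA - 1) * (chA + 1))

theorem sideSeam_pos : 0 < sideSeam := by
  have := one_lt_chA
  have h2 : 0 < 2 * chA - 1 := by linarith
  have := sideFactor_pos
  rw [sideSeam]; positivity

theorem sideSeam_sq : sideSeam ^ 2 = (chA + 1) * (2 * chA - 1) / (chA - 1) := by
  have h1 : chA - 1 ≠ 0 := by linarith [one_lt_chA]
  rw [sideSeam, eq_div_iff h1]
  linear_combination (2 * chA - 1) * (chA + 1) * sideFactor_sq

namespace IsHexFrame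

variable (H : IsHexFrame v)
include H

theorem mink_sideNormal_self (i : Fin 3) : mink (sideNormal v i) (seamNormal v i) = 0 := by
  simp only [sideNormal, mink_sub_left, mink_add_left, mink_smul_left, H.self]
  rw [H.ne _ _ (by revert i; decide), H.ne _ _ (by revert i; decide)]
  ring

theorem mink_sideNormal_prev (i : Fin 3) : mink (sideNormal v i) (seamNormal v (i + 2)) = 0 := by
  simp only [sideNormal, mink_sub_left, mink_add_left, mink_smul_left, H.self]
  rw [H.ne _ _ (by revert i; decide), H.ne _ _ (by revert i; decide)]
  ring

theorem mink_sideNormal_opp (i : Fin 3) :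
    mink (sideNormal v i) (seamNormal v (i + 1)) = sideSeam := by
  simp only [sideNormal, mink_sub_left, mink_add_left, mink_smul_left, H.self]
  rw [H.ne _ _ (by revert i; decide), H.ne _ _ (by revert i; decide), sideSeam]
  ring

theorem mink_sideNormal_sideNormal_self (i : Fin 3) :
    mink (sideNormal v i) (sideNormal v i) = -1 := by
  rw [mink_sideNormal, H.mink_sideNormal_self, H.mink_sideNormal_prev, H.mink_sideNormal_opp,
    sideSeam]
  linear_combination -sideFactor_sq

theorem mink_sideNormal_sideNormal {i j : Fin 3} (hij : i ≠ j) :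
    mink (sideNormal v j) (sideNormal v i) = chA / (chA - 1) := by
  have h1 : chA - 1 ≠ 0 := by linarith [one_lt_chA]
  have key : sideFactor * (chA * sideSeam) = chA / (chA - 1) := by
    rw [sideSeam, eq_div_iff h1]
    linear_combination chA * sideFactor_sq
  rcases fin3_cases i j with rfl | rfl | rfl
  · exact absurd rfl hij
  · have h1 := H.mink_sideNormal_self (i + 1)
    have h2 := H.mink_sideNormal_opp (i + 1)
    have h3 := H.mink_sideNormal_prev (i + 1)
    rw [fin3_add_one_add_one] at h2
    rw [fin3_add_one_add_two] at h3
    rw [mink_sideNormal, h1, h2, h3, ← key]; ring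
  · have h1 := H.mink_sideNormal_self (i + 2)
    have h2 := H.mink_sideNormal_opp (i + 2)
    have h3 := H.mink_sideNormal_prev (i + 2)
    rw [fin3_add_two_add_one] at h2
    rw [fin3_add_two_add_two] at h3
    rw [mink_sideNormal, h1, h2, h3, ← key]; ring

theorem mink_sideNormal_seamNormal_nonneg (i m : Fin 3) :
    0 ≤ mink (sideNormal v i) (seamNormal v m) := by
  rcases fin3_cases i m with rfl | rfl | rfl
  · rw [H.mink_sideNormal_self]
  · rw [H.mink_sideNormal_opp]; exact sideSeam_pos.le
  · rw [H.mink_sideNormal_prev]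

theorem mink_reflect_seamNormal (u : Vec) (k m : Fin 3) :
    mink (reflect (seamNormal v k) u) (seamNormal v m) =
      if k = m then -mink u (seamNormal v m)
      else mink u (seamNormal v m) + 2 * chA * mink u (seamNormal v k) := by
  rw [reflect, mink_add_left, mink_smul_left]
  split_ifs with h
  · rw [h, H.self]; ring
  · rw [H.ne _ _ h]; ring

/-- A ping-pong argument: after a reduced word that begins with the reflection `k`, the image of a
side normal is behind the seam `k`, and in front of each other seam by at least as much. -/
theorem wordAct_sideNormal_pingpong (j : Fin 3) {l : List (Fin 3)} (hl : l.IsChain (· ≠ ·)) :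
    (∀ k, l.head? = some k → ∀ m, m ≠ k →
      mink (wordAct v l (sideNormal v j)) (seamNormal v k) ≤ 0 ∧
      -mink (wordAct v l (sideNormal v j)) (seamNormal v k) ≤
        mink (wordAct v l (sideNormal v j)) (seamNormal v m)) ∧
    ∀ m, l.head? ≠ some m → 0 ≤ mink (wordAct v l (sideNormal v j)) (seamNormal v m) := by
  induction l with
  | nil =>
    refine ⟨fun k hk => by simp at hk, fun m _ => H.mink_sideNormal_seamNormal_nonneg j m⟩
  | cons k l ih =>
    obtain ⟨ih1, ih2⟩ := ih hl.tail
    have hk : l.head? ≠ some k := by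
      cases l with
      | nil => simp
      | cons k' l =>
        rw [List.head?_cons, Ne, Option.some.injEq]
        exact fun h => (List.isChain_cons_cons.1 hl).1 h.symm
    have hk0 := ih2 k hk
    have hch := one_lt_chA
    set u := wordAct v l (sideNormal v j)
    have main : ∀ m, m ≠ k → mink u (seamNormal v k) ≤
        mink (wordAct v (k :: l) (sideNormal v j)) (seamNormal v m) := by
      intro m hm
      rw [wordAct_cons, H.mink_reflect_seamNormal, if_neg (Ne.symm hm)]
      change _ ≤ mink u (seamNormal v m) + 2 * chA * mink u (seamNormal v k)
      by_cases h : l.head? = some m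
      · have := (ih1 m h k (Ne.symm hm)).2
        nlinarith
      · have := ih2 m h
        nlinarith
    have hself : mink (wordAct v (k :: l) (sideNormal v j)) (seamNormal v k) =
        -mink u (seamNormal v k) := by
      rw [wordAct_cons, H.mink_reflect_seamNormal, if_pos rfl]
    refine ⟨fun k' hk' m hm => ?_, fun m hm => ?_⟩
    · obtain rfl : k = k' := by simpa using hk'
      rw [hself]
      exact ⟨by linarith, by rw [neg_neg]; exact main m hm⟩
    · exact hk0.trans (main m fun h => hm (by rw [h]; rfl))

theorem wordAct_seamNormal_nonneg_of_cons (j : Fin 3) {k : Fin 3} {l : List (Fin 3)}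
    (hl : (k :: l).IsChain (· ≠ ·)) :
    0 ≤ mink (wordAct v l (sideNormal v j)) (seamNormal v k) := by
  refine (H.wordAct_sideNormal_pingpong j (l := l) hl.tail).2 k ?_
  cases l with
  | nil => simp
  | cons k' l =>
    rw [List.head?_cons, Ne, Option.some.injEq]
    exact fun h => (List.isChain_cons_cons.1 hl).1 h.symm

theorem mink_reflect_sideNormal_of_ne (u : Vec) {i k : Fin 3} (hk : k ≠ i + 1) :
    mink (reflect (seamNormal v k) u) (sideNormal v i) = mink u (sideNormal v i) := by
  rw [reflect, mink_add_left, mink_smul_left, mink_comm (seamNormal v k)]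
  rcases fin3_cases i k with rfl | rfl | rfl
  · rw [H.mink_sideNormal_self]; ring
  · exact absurd rfl hk
  · rw [H.mink_sideNormal_prev]; ring

theorem mink_reflect_sideNormal_opp (u : Vec) (i : Fin 3) :
    mink (reflect (seamNormal v (i + 1)) u) (sideNormal v i) =
      mink u (sideNormal v i) + 2 * mink u (seamNormal v (i + 1)) * sideSeam := by
  rw [reflect, mink_add_left, mink_smul_left, mink_comm (seamNormal v _), H.mink_sideNormal_opp]

theorem le_mink_wordAct_sideNormal (i j : Fin 3) {l : List (Fin 3)} (hl : l.IsChain (· ≠ ·)) :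
    mink (sideNormal v j) (sideNormal v i) ≤
      mink (wordAct v l (sideNormal v j)) (sideNormal v i) := by
  induction l with
  | nil => exact le_rfl
  | cons k l ih =>
    refine (ih hl.tail).trans ?_
    rw [wordAct_cons]
    by_cases hk : k = i + 1
    · subst hk
      have h1 := H.wordAct_seamNormal_nonneg_of_cons j hl
      have h2 := sideSeam_pos
      rw [H.mink_reflect_sideNormal_opp, le_add_iff_nonneg_right]
      positivity
    · rw [H.mink_reflect_sideNormal_of_ne _ hk]

theorem wordAct_sideNormal_of_notMem {i : Fin 3} {l : List (Fin 3)} (hl : i + 1 ∉ l) :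
    wordAct v l (sideNormal v i) = sideNormal v i := by
  induction l with
  | nil => rfl
  | cons k l ih =>
    rw [List.mem_cons, not_or] at hl
    rw [wordAct_cons, ih hl.2, reflect]
    have : mink (sideNormal v i) (seamNormal v k) = 0 := by
      rcases fin3_cases i k with rfl | rfl | rfl
      · exact H.mink_sideNormal_self _
      · exact absurd rfl hl.1
      · exact H.mink_sideNormal_prev _
    rw [this]; simp

theorem le_mink_wordAct_sideNormal_self {i : Fin 3} {l : List (Fin 3)} (hl : l.IsChain (· ≠ ·))
    (hi : i + 1 ∈ l) :
    2 * sideSeam ^ 2 - 1 ≤ mink (wordAct v l (sideNormal v i)) (sideNormal v i) := by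
  induction l with
  | nil => simp at hi
  | cons k l ih =>
    rw [wordAct_cons]
    by_cases hil : i + 1 ∈ l
    · refine (ih hl.tail hil).trans ?_
      by_cases hk : k = i + 1
      · subst hk
        have h1 := H.wordAct_seamNormal_nonneg_of_cons i hl
        have h2 := sideSeam_pos
        rw [H.mink_reflect_sideNormal_opp, le_add_iff_nonneg_right]
        positivity
      · rw [H.mink_reflect_sideNormal_of_ne _ hk]
    · obtain rfl : i + 1 = k := (List.mem_cons.1 hi).resolve_right hil
      rw [H.wordAct_sideNormal_of_notMem hil, H.mink_reflect_sideNormal_opp,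
        H.mink_sideNormal_sideNormal_self, H.mink_sideNormal_opp]
      linarith [sq_nonneg sideSeam]

end IsHexFrame

end

section

variable {v : Fin 6 → ℍ} {H : IsHexFrame v} {ε₀ : Bool}

/-! ### The holonomy of the boundary curves -/

theorem fold_mem_boundarySide {i : Fin 3} {x : Pants v} (hx : x ∈ Pants.bdry v i) :
    (fold x : ℍ) ∈ boundarySide v i := by
  rcases hx with ⟨z, hz, rfl⟩ | ⟨z, hz, rfl⟩
  · exact (congrArg (· ∈ boundarySide v i) (congrArg Subtype.val (fold_inFace true z))).mpr hz
  · exact (congrArg (· ∈ boundarySide v i) (congrArg Subtype.val (fold_inFace false z))).mpr hz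

theorem IsHexFrame.seamFn_opp_line_pos (H : IsHexFrame v) (i : Fin 3) (x : ℝ) :
    0 < seamFn v (i + 1) (line v i x) := by
  have h := H.seamFn_vs_opp i
  rw [seamFn] at h
  rw [seamFn, H.vec_line, lineVec, mink_sub_left, mink_smul_left, mink_smul_left,
    H.ne (i + 2) (i + 1) (by simp), h]
  have h1 := one_lt_chA
  have h2 := shA_pos
  have h3 : shA < chA := Real.sinh_lt_cosh _
  have h4 := Real.sinh_lt_cosh x
  have h5 := Real.cosh_pos x
  have h6 : chA < chA * (chA + 1) / shA := by
    rw [lt_div_iff₀ h2]; nlinarith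
  nlinarith

/-- The neighbourhoods of two of the seams cover a boundary curve. -/
theorem IsHexFrame.mem_seamNhd_of_mem_bdry (H : IsHexFrame v) {i : Fin 3} {x : Pants v}
    (hx : x ∈ Pants.bdry v i) : x ∈ seamNhd v i ∨ x ∈ seamNhd v (i + 2) := by
  obtain ⟨y, hy0, hy1, hy⟩ := H.exists_eq_line (fold_mem_boundarySide hx)
  have h1 := H.seamFn_opp_line_pos i y
  rcases hy0.eq_or_lt with h | h
  · right
    intro l hl
    rw [hy]
    rcases fin3_cases i l with rfl | rfl | rfl
    · rw [H.seamFn_self_line, Real.sinh_pos_iff, ← h]; norm_num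
    · exact h1
    · exact absurd rfl hl
  · left
    intro l hl
    rw [hy]
    rcases fin3_cases i l with rfl | rfl | rfl
    · exact absurd rfl hl
    · exact h1
    · rwa [H.seamFn_prev_line, Real.sinh_pos_iff]

theorem inv_apply_eq_iff {g : ℍ ≃ᵢ ℍ} {x y : ℍ} : g⁻¹ x = y ↔ x = g y :=
  g.toEquiv.symm_apply_eq

/-- The isometries that translate the line of the `i`-th boundary side by a multiple of the length
of the `i`-th boundary curve. -/
def lineShift (v : Fin 6 → ℍ) (i : Fin 3) : Subgroup (ℍ ≃ᵢ ℍ) where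
  carrier := {g | ∃ n : ℤ, ∀ x, g (line v i x) = line v i (x + 9 / 10 * n)}
  one_mem' := ⟨0, fun x => by simp⟩
  mul_mem' := by
    rintro g g' ⟨n, hn⟩ ⟨n', hn'⟩
    refine ⟨n + n', fun x => ?_⟩
    rw [IsometryEquiv.mul_apply, hn', hn]; push_cast; ring_nf
  inv_mem' := by
    rintro g ⟨n, hn⟩
    refine ⟨-n, fun x => ?_⟩
    rw [inv_apply_eq_iff, hn]; push_cast; ring_nf

theorem seamRefl_mul_seamRefl_mem_lineShift (H : IsHexFrame v) (i : Fin 3) :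
    seamRefl H i * seamRefl H (i + 2) ∈ lineShift v i :=
  ⟨1, fun x => by
    rw [IsometryEquiv.mul_apply, H.seamRefl_prev_line, H.seamRefl_self_line]; push_cast; ring_nf⟩

theorem coord_mem_lineShift_iff (i : Fin 3) (e : DevSpace H ε₀) :
    coord i e ∈ lineShift v i ↔ coord (i + 2) e ∈ lineShift v i := by
  by_cases h : e.proj ∈ range (inFace ε₀)
  · rw [coord_inFace_self h, coord_inFace_self h]
  · rw [coord_inFace_not h (i + 2) i]
    exact (Subgroup.mul_mem_cancel_right _ (seamRefl_mul_seamRefl_mem_lineShift H i)).symm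

/-- The germs continued along a boundary curve map it to a single line. -/
theorem coord_lift_mem_lineShift {i : Fin 3} {Γ : C(I, DevSpace H ε₀)}
    (hb : ∀ t, (Γ t).proj ∈ Pants.bdry v i) (h0 : coord i (Γ 0) ∈ lineShift v i) (t : I) :
    coord i (Γ t) ∈ lineShift v i := by
  have key : ∀ t, ∀ᶠ t' in 𝓝 t,
      (coord i (Γ t') ∈ lineShift v i ↔ coord i (Γ t) ∈ lineShift v i) := by
    intro t
    rcases H.mem_seamNhd_of_mem_bdry (hb t) with h | h
    · filter_upwards [eventually_coord_eq Γ.continuous h] with t' ht'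
      rw [ht'.2]
    · filter_upwards [eventually_coord_eq Γ.continuous h] with t' ht'
      rw [coord_mem_lineShift_iff, coord_mem_lineShift_iff, ht'.2]
  have hclopen : IsClopen {t | coord i (Γ t) ∈ lineShift v i} := by
    constructor
    · rw [← isOpen_compl_iff, isOpen_iff_mem_nhds]
      intro t ht
      filter_upwards [key t] with t' ht'
      exact fun h => ht (ht'.1 h)
    · rw [isOpen_iff_mem_nhds]
      intro t ht
      filter_upwards [key t] with t' ht'
      exact ht'.2 ht
  exact eq_univ_iff_forall.1 (hclopen.eq_univ ⟨0, h0⟩) t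

/-- The parameters on the line of the `i`-th boundary side of the developed images of a point of
the `i`-th boundary curve. -/
theorem exists_localDev_eq_line (H : IsHexFrame v) (ε₀ : Bool) {i : Fin 3} {p : Pants v}
    (hp : p ∈ Pants.bdry v i) : ∃ x, 0 ≤ x ∧ x ≤ 9 / 20 ∧ (fold p : ℍ) = line v i x ∧
      ((p ∈ range (inFace ε₀) ∧ localDev H ε₀ i p = line v i x) ∨
        (p ∉ range (inFace ε₀) ∧ localDev H ε₀ i p = line v i (9 / 10 - x))) := by
  obtain ⟨x, h0, h1, hx⟩ := H.exists_eq_line (fold_mem_boundarySide hp)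
  refine ⟨x, h0, h1, hx, ?_⟩
  by_cases h : p ∈ range (inFace ε₀)
  · exact Or.inl ⟨h, by rw [localDev, if_pos h, hx]⟩
  · exact Or.inr ⟨h, by rw [localDev, if_neg h, hx, H.seamRefl_self_line]⟩

theorem fold_notMem_seams_of_notMem_range {p : Pants v} (h : p ∉ range (inFace ε₀)) :
    (fold p : ℍ) ∉ seams v := fun hs => h ⟨fold p, by
  conv_rhs => rw [eq_inFace_not_fold h]
  exact inFace_eq_of_mem_seams hs _ _⟩

theorem line_eq_ve (H : IsHexFrame v) (i : Fin 3) : line v i (9 / 20) = ve v i := by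
  obtain ⟨x, hx0, hx1, hx⟩ := H.exists_eq_line (ve_mem_boundarySide (v := v) i)
  have h := H.seamFn_ve_self i
  rw [hx, H.seamFn_self_line, Real.sinh_eq_zero] at h
  rw [hx]; congr 1; linarith

/-- A point of a boundary curve is determined by its developed image modulo translations. -/
theorem eq_of_localDev_eq (H : IsHexFrame v) (ε₀ : Bool) {i : Fin 3} {p p' : Pants v}
    (hp : p ∈ Pants.bdry v i) (hp' : p' ∈ Pants.bdry v i) {X X' : ℝ}
    (hX : localDev H ε₀ i p = line v i X) (hX' : localDev H ε₀ i p' = line v i X') {n : ℤ}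
    (h : X = X' + 9 / 10 * n) : p = p' := by
  obtain ⟨x, h0, h1, hf, hx⟩ := exists_localDev_eq_line H ε₀ hp
  obtain ⟨x', h0', h1', hf', hx'⟩ := exists_localDev_eq_line H ε₀ hp'
  have hinj := H.line_injective i
  -- in the face other than `ε₀` the parameter lies strictly between the two vertices
  have hlt : ∀ {q : Pants v} {y : ℝ}, q ∉ range (inFace ε₀) → (fold q : ℍ) = line v i y →
      0 ≤ y → y ≤ 9 / 20 → 0 < y ∧ y < 9 / 20 := by
    intro q y hq hy hy0 hy1
    have hs := fold_notMem_seams_of_notMem_range hq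
    constructor
    · refine lt_of_le_of_ne hy0 fun h => hs ?_
      rw [hy, ← h, H.line_zero]
      exact mem_iUnion.2 ⟨_, mem_seamSide_vs i⟩
    · refine lt_of_le_of_ne hy1 fun h => hs ?_
      rw [hy, h, line_eq_ve H]
      exact mem_iUnion.2 ⟨_, mem_seamSide_ve i⟩
  have hn : ∀ r : ℝ, |r| < 9 / 10 → r = 9 / 10 * n → n = 0 := by
    intro r hr h
    rw [h, abs_lt] at hr
    have h1 : (-1 : ℝ) < n := by linarith
    have h2 : (n : ℝ) < 1 := by linarith
    have h1' : -1 < n := by exact_mod_cast h1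
    have h2' : n < 1 := by exact_mod_cast h2
    omega
  rcases hx with ⟨hm, hx⟩ | ⟨hm, hx⟩ <;> rcases hx' with ⟨hm', hx'⟩ | ⟨hm', hx'⟩ <;>
    rw [hX] at hx <;> rw [hX'] at hx' <;> have e := hinj hx <;> have e' := hinj hx'
  · have := hn (x - x') (abs_lt.2 ⟨by linarith, by linarith⟩) (by linarith)
    rw [this] at h
    rw [eq_inFace_fold hm, eq_inFace_fold hm']
    congr 1
    apply Subtype.ext
    rw [hf, hf', ← e, ← e', h]; simp
  · obtain ⟨l1, l2⟩ := hlt hm' hf' h0' h1'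
    have := hn (x + x' - 9 / 10) (abs_lt.2 ⟨by linarith, by linarith⟩) (by linarith)
    rw [this] at h
    push_cast at h
    linarith
  · obtain ⟨l1, l2⟩ := hlt hm hf h0 h1
    have := hn (9 / 10 - x - x') (abs_lt.2 ⟨by linarith, by linarith⟩) (by linarith)
    rw [this] at h
    push_cast at h
    linarith
  · obtain ⟨l1, l2⟩ := hlt hm' hf' h0' h1'
    obtain ⟨l1', l2'⟩ := hlt hm hf h0 h1
    have := hn (x' - x) (abs_lt.2 ⟨by linarith, by linarith⟩) (by linarith)
    rw [this] at h
    rw [eq_inFace_not_fold hm, eq_inFace_not_fold hm']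
    congr 1
    apply Subtype.ext
    rw [hf, hf']
    congr 1
    push_cast at h
    linarith

/-- A continuous function on the interval which, up to the endpoints, is injective modulo the
period `9 / 10` increases or decreases by exactly one period. -/
theorem eq_one_or_eq_neg_one_of_injective_mod {X : I → ℝ} (hX : Continuous X) {n : ℤ}
    (h1 : X 1 = X 0 + 9 / 10 * n)
    (hinj : ∀ (s t : I) (m : ℤ), X s = X t + 9 / 10 * m →
      s = t ∨ (s = 0 ∧ t = 1) ∨ (s = 1 ∧ t = 0)) :
    n = 1 ∨ n = -1 := by
  have ivt : ∀ (s t : I) (y : ℝ), s ≤ t → y ∈ uIcc (X s) (X t) → ∃ r ∈ Icc s t, X r = y := by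
    intro s t y hst hy
    have := intermediate_value_uIcc (a := s) (b := t) hX.continuousOn hy
    rwa [uIcc_of_le hst] at this
  have h01 : (0 : I) ≠ 1 := zero_ne_one
  by_contra! hn
  rcases lt_trichotomy n 0 with hn0 | hn0 | hn0
  · have h2 : n ≤ -2 := by omega
    have h2' : (n : ℝ) ≤ -2 := by exact_mod_cast h2
    obtain ⟨r, -, hr⟩ := ivt 0 1 (X 0 - 9 / 10) zero_le_one
      (mem_uIcc.2 (Or.inr ⟨by linarith, by linarith⟩))
    rcases hinj r 0 (-1) (by rw [hr]; push_cast; ring) with h | ⟨-, h⟩ | ⟨h, -⟩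
    · rw [h] at hr; linarith
    · exact h01 h
    · rw [h] at hr; linarith
  · rw [hn0] at h1
    have hmid : ∀ t : I, X t = X 0 → t = 0 ∨ t = 1 := fun t ht => by
      rcases hinj t 0 0 (by simp [ht]) with h | ⟨-, h⟩ | ⟨h, -⟩
      · exact Or.inl h
      · exact absurd h h01
      · exact Or.inr h
    set c : I := ⟨1 / 2, by norm_num, by norm_num⟩
    have hc0 : c ≠ 0 := fun h => by have := congrArg Subtype.val h; norm_num [c] at this
    have hc1 : c ≠ 1 := fun h => by have := congrArg Subtype.val h; norm_num [c] at this
    have hXc : X c ≠ X 0 := fun h => (hmid c h).elim hc0 hc1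
    have e1 : X 1 = X 0 := by rw [h1]; simp
    have hy : (X 0 + X c) / 2 ∈ uIcc (X 0) (X c) := by
      rcases le_total (X 0) (X c) with h | h
      · exact mem_uIcc.2 (Or.inl ⟨by linarith, by linarith⟩)
      · exact mem_uIcc.2 (Or.inr ⟨by linarith, by linarith⟩)
    have hyne : (X 0 + X c) / 2 ≠ X c := fun h => hXc (by linarith)
    have hyne0 : (X 0 + X c) / 2 ≠ X 0 := fun h => hXc (by linarith)
    obtain ⟨r, hr, hr'⟩ := ivt 0 c _ c.2.1 hy
    obtain ⟨s, hs, hs'⟩ := ivt c 1 ((X 0 + X c) / 2) c.2.2 (by rwa [e1, uIcc_comm])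
    have hrs : r ≠ s := fun h => by
      rw [← h] at hs
      have : r = c := le_antisymm hr.2 hs.1
      rw [this] at hr'
      exact hyne hr'.symm
    rcases hinj r s 0 (by rw [hr', hs']; simp) with h | ⟨h, -⟩ | ⟨-, h⟩
    · exact hrs h
    · rw [h] at hr'; exact hyne0 hr'.symm
    · rw [h] at hs'; exact hyne0 hs'.symm
  · have h2 : 2 ≤ n := by omega
    have h2' : (2 : ℝ) ≤ n := by exact_mod_cast h2
    obtain ⟨r, -, hr⟩ := ivt 0 1 (X 0 + 9 / 10) zero_le_one
      (mem_uIcc.2 (Or.inl ⟨by linarith, by linarith⟩))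
    rcases hinj r 0 1 (by rw [hr]; push_cast; ring) with h | ⟨-, h⟩ | ⟨h, -⟩
    · rw [h] at hr; linarith
    · exact h01 h
    · rw [h] at hr; linarith

theorem eq_sec_of_proj {e : DevSpace H ε₀} {z : hexRegion v} (h : e.proj = inFace ε₀ z) :
    e = sec H ε₀ ε₀ (germ e) z := by
  obtain ⟨k, hk⟩ := H.exists_mem_seamNhd e.proj
  refine ext_of_coord h hk ?_
  rw [coord_sec_self, coord_inFace_self (h ▸ ⟨z, rfl⟩)]

/-- The holonomy of a loop in a boundary curve translates the line of this curve. -/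
theorem exists_lineShift_of_range_subset (H : IsHexFrame v) (ε₀ : Bool) {i : Fin 3} {p : Pants v}
    {z : hexRegion v} (hz : p = inFace ε₀ z) {b : Path p p} (hb : range b ⊆ Pants.bdry v i)
    {Γ : C(I, DevSpace H ε₀)} (h1 : ∀ t, (Γ t).proj = b t) (h2 : Γ 0 = sec H ε₀ ε₀ 1 z) :
    Γ 1 = sec H ε₀ ε₀ (germ (Γ 1)) z ∧ ∀ t, coord i (Γ t) ∈ lineShift v i := by
  constructor
  · refine eq_sec_of_proj ?_
    rw [h1, b.target, hz]
  · refine coord_lift_mem_lineShift (fun t => hb ⟨t, (h1 t).symm⟩) ?_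
    rw [h2, coord_sec_self]
    exact one_mem _

/-- The holonomy of a simple loop around a boundary curve translates the line of this curve by its
length. -/
theorem exists_continues_of_isSimple (H : IsHexFrame v) (ε₀ : Bool) {i : Fin 3} {p : Pants v}
    {z : hexRegion v} (hz : p = inFace ε₀ z) {b : Path p p} (hb : range b ⊆ Pants.bdry v i)
    (hs : Pants.IsSimple b) : ∃ (h : ℍ ≃ᵢ ℍ) (n : ℤ), (n = 1 ∨ n = -1) ∧
      (∀ x, h (line v i x) = line v i (x + 9 / 10 * n)) ∧
      Continues (.mk b) (sec H ε₀ ε₀ 1 z) (sec H ε₀ ε₀ h z) := by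
  obtain ⟨Γ, h1, h2⟩ := exists_lift (H := H) (ε₀ := ε₀) b (e := sec H ε₀ ε₀ 1 z) hz.symm
  obtain ⟨h3, h4⟩ := exists_lineShift_of_range_subset H ε₀ hz hb h1 h2
  have hbt : ∀ t, b t ∈ Pants.bdry v i := fun t => hb ⟨t, rfl⟩
  -- the parameter of the developed path
  have hX : ∀ t, ∃ (x : ℝ) (n : ℤ), localDev H ε₀ i (b t) = line v i x ∧
      dev (Γ t) = line v i (x + 9 / 10 * n) := by
    intro t
    obtain ⟨n, hn⟩ := h4 t
    obtain ⟨x, -, -, -, ⟨-, hx⟩ | ⟨-, hx⟩⟩ := exists_localDev_eq_line H ε₀ (hbt t)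
    · exact ⟨_, n, hx, by rw [dev_eq (i := i), h1, hx, hn]⟩
    · exact ⟨_, n, hx, by rw [dev_eq (i := i), h1, hx, hn]⟩
  set X : I → ℝ := fun t => Real.arsinh (seamFn v (i + 2) (dev (Γ t))) with hXdef
  have hXc : Continuous X := Real.continuous_arsinh.comp
    ((continuous_seamFn _).comp (continuous_dev_lift h1))
  have hXeq : ∀ {t : I} {x : ℝ}, dev (Γ t) = line v i x → X t = x := fun h => by
    simp only [hXdef]; rw [h, H.seamFn_prev_line, Real.arsinh_sinh]
  have hinj : ∀ (s t : I) (m : ℤ), X s = X t + 9 / 10 * m →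
      s = t ∨ (s = 0 ∧ t = 1) ∨ (s = 1 ∧ t = 0) := by
    intro s t m hm
    refine hs s t ?_
    obtain ⟨x, n, hx, hn⟩ := hX s
    obtain ⟨x', n', hx', hn'⟩ := hX t
    rw [hXeq hn, hXeq hn'] at hm
    refine eq_of_localDev_eq H ε₀ (hbt s) (hbt t) hx hx' (n := n' + m - n) ?_
    push_cast; linarith
  obtain ⟨n, hn⟩ := h4 1
  have hg : germ (Γ 1) = coord i (Γ 1) := by rw [h3, coord_sec_self]; rw [← h3]
  rw [← hg] at hn
  refine ⟨germ (Γ 1), n, ?_, hn, b, rfl, Γ, h1, h2, h3⟩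
  refine eq_one_or_eq_neg_one_of_injective_mod hXc ?_ hinj
  obtain ⟨x, m, hx, hm⟩ := hX 0
  rw [hXeq hm]
  refine hXeq ?_
  have hz0 : dev (Γ 0) = z := by rw [h2, dev_sec]; rfl
  rw [h3, dev_sec, ← hz0, hm, hn]

/-- The continuation along a power of a loop. -/
theorem continues_loopPow {p : Pants v} {z : hexRegion v} {b : Path p p} {h : ℍ ≃ᵢ ℍ}
    (hb : Continues (.mk b) (sec H ε₀ ε₀ 1 z) (sec H ε₀ ε₀ h z)) (s : ℤ) :
    Continues (Pants.loopPow b s) (sec H ε₀ ε₀ 1 z) (sec H ε₀ ε₀ (h ^ s) z) := by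
  set q : FundamentalGroup (Pants v) p := FundamentalGroup.fromPath (.mk b) with hq
  change Continues (FundamentalGroup.toPath (q ^ s)) _ _
  induction s with
  | zero =>
    rw [zpow_zero, zpow_zero]
    exact Continues.refl p hb.proj_left
  | succ n ih =>
    rw [zpow_add_one, add_comm, zpow_one_add]
    have := ih.leftMul h
    rw [leftMul_sec, leftMul_sec, mul_one] at this
    exact hb.trans this
  | pred n ih =>
    rw [zpow_sub_one, sub_eq_neg_add, zpow_add, zpow_neg_one]
    have h1 := hb.symm.leftMul h⁻¹
    have := ih.leftMul h⁻¹
    rw [leftMul_sec, leftMul_sec, mul_one] at this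
    rw [leftMul_sec, leftMul_sec, mul_one, inv_mul_cancel] at h1
    exact h1.trans this

theorem zpow_line {i : Fin 3} {h : ℍ ≃ᵢ ℍ} {n : ℤ}
    (hh : ∀ x, h (line v i x) = line v i (x + 9 / 10 * n)) (s : ℤ) (x : ℝ) :
    (h ^ s) (line v i x) = line v i (x + 9 / 10 * (n * s)) := by
  induction s generalizing x with
  | zero => simp
  | succ m ih =>
    rw [zpow_add_one, IsometryEquiv.mul_apply, hh, ih]; push_cast; ring_nf
  | pred m ih =>
    have : h⁻¹ (line v i x) = line v i (x - 9 / 10 * n) := by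
      rw [inv_apply_eq_iff, hh]; ring_nf
    rw [zpow_sub_one, IsometryEquiv.mul_apply, this, ih]; push_cast; ring_nf

end

section

variable {v : Fin 6 → ℍ} {H : IsHexFrame v} {ε₀ : Bool}

/-! ### Distances between the points of two disjoint lines -/

/-- The product of the points with parameters `x` and `y` of two geodesics in the hyperboloid, whose
frames have the Gram matrix `!![α, β; γ, δ]`. -/
def lineGram (α β γ δ x y : ℝ) : ℝ :=
  α * (Real.cosh x * Real.cosh y) + β * (Real.cosh x * Real.sinh y) +
    γ * (Real.sinh x * Real.cosh y) + δ * (Real.sinh x * Real.sinh y)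

theorem lineGram_eq_exp (α β γ δ x y : ℝ) : lineGram α β γ δ x y =
    (α + β + γ + δ) / 4 * Real.exp (x + y) + (α - β + γ - δ) / 4 * Real.exp (x - y) +
    (α + β - γ - δ) / 4 * Real.exp (y - x) + (α - β - γ + δ) / 4 * Real.exp (-(x + y)) := by
  rw [sub_eq_add_neg x, sub_eq_add_neg y, neg_add, Real.exp_add, Real.exp_add, Real.exp_add,
    Real.exp_add, lineGram, Real.cosh_eq, Real.cosh_eq, Real.sinh_eq, Real.sinh_eq]
  ring

/-- The coefficients of the four exponentials are nonnegative, and the two products of opposite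
coefficients are bounded below in terms of the product `C` of the normals of the lines. -/
theorem lineGram_coeff {α β γ δ C : ℝ} (hα : 0 < α) (hC : 1 ≤ C)
    (h1 : α ^ 2 + δ ^ 2 - β ^ 2 - γ ^ 2 = 1 + C ^ 2) (h2 : (α * δ - β * γ) ^ 2 = C ^ 2)
    (h3 : δ ^ 2 ≤ α ^ 2) :
    0 ≤ (α + β + γ + δ) / 4 ∧ 0 ≤ (α - β + γ - δ) / 4 ∧ 0 ≤ (α + β - γ - δ) / 4 ∧
    0 ≤ (α - β - γ + δ) / 4 ∧
    ((C - 1) / 4) ^ 2 ≤ (α + β + γ + δ) / 4 * ((α - β - γ + δ) / 4) ∧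
    ((C - 1) / 4) ^ 2 ≤ (α - β + γ - δ) / 4 * ((α + β - γ - δ) / 4) := by
  obtain ⟨hδ1, hδ2⟩ := abs_le.1 (abs_le_of_sq_le_sq h3 hα.le)
  have hp : ((C - 1) / 4) ^ 2 ≤ (α + β + γ + δ) / 4 * ((α - β - γ + δ) / 4) := by
    rcases sq_eq_sq_iff_eq_or_eq_neg.1 h2 with h | h <;> nlinarith
  have hq : ((C - 1) / 4) ^ 2 ≤ (α - β + γ - δ) / 4 * ((α + β - γ - δ) / 4) := by
    rcases sq_eq_sq_iff_eq_or_eq_neg.1 h2 with h | h <;> nlinarith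
  have key : ∀ {a b : ℝ}, 0 ≤ a + b → 0 ≤ a * b → 0 ≤ a := by
    intro a b hs hm
    by_contra! ha
    nlinarith
  have hp0 := (sq_nonneg _).trans hp
  have hq0 := (sq_nonneg _).trans hq
  refine ⟨key (b := (α - β - γ + δ) / 4) (by linarith) hp0,
    key (b := (α + β - γ - δ) / 4) (by linarith) hq0,
    key (b := (α - β + γ - δ) / 4) (by linarith) (by rwa [mul_comm]),
    key (b := (α + β + γ + δ) / 4) (by linarith) (by rwa [mul_comm]), hp, hq⟩

theorem lineGram_bounds {α β γ δ C : ℝ} (hα : 0 < α) (hC : 1 ≤ C)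
    (h1 : α ^ 2 + δ ^ 2 - β ^ 2 - γ ^ 2 = 1 + C ^ 2) (h2 : (α * δ - β * γ) ^ 2 = C ^ 2)
    (h3 : δ ^ 2 ≤ α ^ 2) (x y : ℝ) :
    C - 1 ≤ lineGram α β γ δ x y ∧ ∀ X Y, Real.exp (|X| + |Y|) * ((C - 1) / 4) ^ 2 ≤
      lineGram α β γ δ (x + X) (y + Y) * lineGram α β γ δ x y := by
  obtain ⟨hp, hq, hr, hs, hps, hqr⟩ := lineGram_coeff hα hC h1 h2 h3
  have e := lineGram_eq_exp α β γ δ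
  set p := (α + β + γ + δ) / 4
  set q := (α - β + γ - δ) / 4
  set r := (α + β - γ - δ) / 4
  set s := (α - β - γ + δ) / 4
  set k := (C - 1) / 4
  have hk : 0 ≤ k := by simp only [k]; linarith
  set P := p * Real.exp (x + y) with hP
  set Q := q * Real.exp (x - y) with hQ
  set R := r * Real.exp (y - x) with hR
  set S := s * Real.exp (-(x + y)) with hS
  have hP0 : 0 ≤ P := mul_nonneg hp (Real.exp_pos _).le
  have hQ0 : 0 ≤ Q := mul_nonneg hq (Real.exp_pos _).le
  have hR0 : 0 ≤ R := mul_nonneg hr (Real.exp_pos _).le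
  have hS0 : 0 ≤ S := mul_nonneg hs (Real.exp_pos _).le
  have hPS : k ^ 2 ≤ P * S := by
    have : P * S = p * s := by
      rw [hP, hS, Real.exp_neg]; field_simp
    rwa [this]
  have hQR : k ^ 2 ≤ Q * R := by
    have : Q * R = q * r := by
      rw [hQ, hR, show y - x = -(x - y) by ring, Real.exp_neg]; field_simp
    rwa [this]
  have amgm : ∀ {a b : ℝ}, 0 ≤ a → 0 ≤ b → k ^ 2 ≤ a * b → 2 * k ≤ a + b := by
    intro a b ha hb h
    nlinarith [sq_nonneg (a - b)]
  constructor
  · rw [e]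
    have h1 := amgm hP0 hS0 hPS
    have h2 := amgm hQ0 hR0 hQR
    have : C - 1 = 4 * k := by simp only [k]; ring
    linarith
  · intro X Y
    rw [e, e]
    have eP : p * Real.exp (x + X + (y + Y)) = P * Real.exp (X + Y) := by
      rw [hP, mul_assoc, ← Real.exp_add]; ring_nf
    have eQ : q * Real.exp (x + X - (y + Y)) = Q * Real.exp (X - Y) := by
      rw [hQ, mul_assoc, ← Real.exp_add]; ring_nf
    have eR : r * Real.exp (y + Y - (x + X)) = R * Real.exp (Y - X) := by
      rw [hR, mul_assoc, ← Real.exp_add]; ring_nf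
    have eS : s * Real.exp (-(x + X + (y + Y))) = S * Real.exp (-(X + Y)) := by
      rw [hS, mul_assoc, ← Real.exp_add]; ring_nf
    rw [eP, eQ, eR, eS]
    have gP : 0 ≤ P * Real.exp (X + Y) := mul_nonneg hP0 (Real.exp_pos _).le
    have gQ : 0 ≤ Q * Real.exp (X - Y) := mul_nonneg hQ0 (Real.exp_pos _).le
    have gR : 0 ≤ R * Real.exp (Y - X) := mul_nonneg hR0 (Real.exp_pos _).le
    have gS : 0 ≤ S * Real.exp (-(X + Y)) := mul_nonneg hS0 (Real.exp_pos _).le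
    have fin : ∀ {a b u : ℝ}, 0 ≤ a → 0 ≤ b → k ^ 2 ≤ a * b →
        a * Real.exp u ≤ P * Real.exp (X + Y) + Q * Real.exp (X - Y) + R * Real.exp (Y - X) +
          S * Real.exp (-(X + Y)) → b ≤ P + Q + R + S → Real.exp u * k ^ 2 ≤
        (P * Real.exp (X + Y) + Q * Real.exp (X - Y) + R * Real.exp (Y - X) +
          S * Real.exp (-(X + Y))) * (P + Q + R + S) := by
      intro a b u ha hb hab h h'
      calc Real.exp u * k ^ 2 ≤ Real.exp u * (a * b) := by gcongr
        _ = a * Real.exp u * b := by ring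
        _ ≤ _ := mul_le_mul h h' hb (by linarith)
    rcases abs_cases X with ⟨hX, -⟩ | ⟨hX, -⟩ <;> rcases abs_cases Y with ⟨hY, -⟩ | ⟨hY, -⟩ <;>
      rw [hX, hY]
    · exact fin hP0 hS0 hPS (by linarith) (by linarith)
    · rw [← sub_eq_add_neg]
      exact fin hQ0 hR0 hQR (by linarith) (by linarith)
    · rw [add_comm (-X), ← sub_eq_add_neg]
      exact fin hR0 hQ0 (by rwa [mul_comm]) (by linarith) (by linarith)
    · rw [← neg_add]
      exact fin hS0 hP0 (by rwa [mul_comm]) (by linarith) (by linarith)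

/-- The relations between the Gram matrix of the frames of two lines and the product `C` of their
normals: both frames are orthonormal. -/
theorem frame_relations {F M n F' M' n' : Vec} (hF : mink F F = 1) (hM : mink M M = -1)
    (hn : mink n n = -1) (hFM : mink F M = 0) (hFn : mink F n = 0) (hMn : mink M n = 0)
    (hF' : mink F' F' = 1) (hM' : mink M' M' = -1) (hn' : mink n' n' = -1) (hFM' : mink F' M' = 0)
    (hFn' : mink F' n' = 0) (hMn' : mink M' n' = 0) :
    mink F F' ^ 2 + mink M M' ^ 2 - mink F M' ^ 2 - mink M F' ^ 2 = 1 + mink n' n ^ 2 ∧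
    (mink F F' * mink M M' - mink F M' * mink M F') ^ 2 = mink n' n ^ 2 ∧
    mink M M' ^ 2 ≤ mink F F' ^ 2 := by
  have e1 := mink_eq_frame hF' hM' hn' hFM' hFn' hMn' F F
  have e2 := mink_eq_frame hF' hM' hn' hFM' hFn' hMn' M M
  have e3 := mink_eq_frame hF' hM' hn' hFM' hFn' hMn' F M
  have e4 := mink_eq_frame hF hM hn hFM hFn hMn n' n'
  have e5 := mink_eq_frame hF hM hn hFM hFn hMn F' F'
  rw [hF] at e1
  rw [hM] at e2
  rw [hFM] at e3
  rw [hn', mink_comm n' F, mink_comm n' M] at e4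
  rw [hF', mink_comm F' F, mink_comm F' M] at e5
  refine ⟨?_, ?_, ?_⟩
  · linear_combination -e1 + e2 - e4
  · have h : mink n' n ^ 2 = 1 + mink F n' ^ 2 - mink M n' ^ 2 := by linear_combination e4
    rw [h]
    have h1 : mink F F' ^ 2 - mink F M' ^ 2 = 1 + mink F n' ^ 2 := by linear_combination -e1
    have h2 : mink M M' ^ 2 - mink M F' ^ 2 = 1 - mink M n' ^ 2 := by linear_combination e2
    have h3 : mink F F' * mink M F' - mink F M' * mink M M' = mink F n' * mink M n' := by
      linear_combination -e3
    calc _ = (mink F F' * mink M F' - mink F M' * mink M M') ^ 2 +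
        (mink F F' ^ 2 - mink F M' ^ 2) * (mink M M' ^ 2 - mink M F' ^ 2) := by ring
      _ = _ := by rw [h1, h2, h3]; ring
  · nlinarith [sq_nonneg (mink M n'), sq_nonneg (mink F' n)]

theorem mink_vs_sideNormal (H : IsHexFrame v) (i : Fin 3) :
    mink (vec (vs v i)) (sideNormal v i) = 0 := by
  rw [H.vs_eq, mink_smul_left, mink_add_left, mink_smul_left, mink_comm, H.mink_sideNormal_prev,
    mink_comm, H.mink_sideNormal_self]
  ring

/-- The estimate of distances along two disjoint lines. -/
theorem cosh_dist_line_bounds (H : IsHexFrame v) (i j : Fin 3) (l : List (Fin 3)) {C : ℝ}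
    (hC1 : 1 ≤ C) (hC : C ≤ mink (wordAct v l (sideNormal v j)) (sideNormal v i)) (x y : ℝ) :
    C - 1 ≤ Real.cosh (dist (line v i x) ((l.map (seamRefl H)).prod (line v j y))) ∧
    ∀ X Y, Real.exp (|X| + |Y|) * ((C - 1) / 4) ^ 2 ≤
      Real.cosh (dist (line v i (x + X)) ((l.map (seamRefl H)).prod (line v j (y + Y)))) *
      Real.cosh (dist (line v i x) ((l.map (seamRefl H)).prod (line v j y))) := by
  have h0 : ∀ i, mink (vec (vs v i)) (-seamNormal v (i + 2)) = 0 := fun i => by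
    have := H.seamFn_vs_prev i
    rw [seamFn] at this
    rw [mink_neg_right, this, neg_zero]
  have h1 : ∀ i, mink (-seamNormal v (i + 2)) (-seamNormal v (i + 2)) = -1 := fun i => by
    rw [mink_neg_right, mink_neg_left, H.self]; ring
  have h2 : ∀ i, mink (-seamNormal v (i + 2)) (sideNormal v i) = 0 := fun i => by
    rw [mink_neg_left, mink_comm, H.mink_sideNormal_prev, neg_zero]
  have hw := mink_wordAct H l
  obtain ⟨r1, r2, r3⟩ := frame_relations (F := vec (vs v i)) (M := -seamNormal v (i + 2))
    (n := sideNormal v i) (F' := wordAct v l (vec (vs v j)))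
    (M' := wordAct v l (-seamNormal v (j + 2))) (n' := wordAct v l (sideNormal v j))
    (mink_vec_self _) (h1 i) (H.mink_sideNormal_sideNormal_self i) (h0 i) (mink_vs_sideNormal H i)
    (h2 i) (by rw [hw, mink_vec_self]) (by rw [hw, h1])
    (by rw [hw, H.mink_sideNormal_sideNormal_self]) (by rw [hw, h0])
    (by rw [hw, mink_vs_sideNormal H]) (by rw [hw, h2])
  have hB : ∀ x y, Real.cosh (dist (line v i x) ((l.map (seamRefl H)).prod (line v j y))) =
      lineGram (mink (vec (vs v i)) (wordAct v l (vec (vs v j))))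
        (mink (vec (vs v i)) (wordAct v l (-seamNormal v (j + 2))))
        (mink (-seamNormal v (i + 2)) (wordAct v l (vec (vs v j))))
        (mink (-seamNormal v (i + 2)) (wordAct v l (-seamNormal v (j + 2)))) x y := by
    intro x y
    have e : ∀ k x, lineVec v k x =
        Real.cosh x • vec (vs v k) + Real.sinh x • -seamNormal v (k + 2) := fun k x => by
      rw [lineVec]; module
    rw [cosh_dist_eq, vec_prod_seamRefl, H.vec_line, H.vec_line, e, e, wordAct_add, wordAct_smul,
      wordAct_smul, lineGram]
    simp only [mink_add_left, mink_add_right, mink_smul_left, mink_smul_right]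
    ring
  have hα : 0 < mink (vec (vs v i)) (wordAct v l (vec (vs v j))) := by
    rw [← vec_prod_seamRefl H, ← cosh_dist_eq]; exact Real.cosh_pos _
  have key := lineGram_bounds hα (hC1.trans hC) r1 r2 r3 x y
  simp only [hB]
  refine ⟨by linarith [key.1], fun X Y => le_trans ?_ (key.2 X Y)⟩
  have h4 : 0 ≤ (C - 1) / 4 := by linarith
  gcongr

/-! ### Numerical estimates -/

theorem exp_bounds : 1.5683 < Real.exp (9 / 20) ∧ Real.exp (9 / 20) < 1.56832 := by
  have h : Real.exp (9 / 20) ^ 20 = Real.exp 1 ^ 9 := by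
    rw [← Real.exp_nat_mul, ← Real.exp_nat_mul]; norm_num
  have hl := Real.exp_one_gt_d9
  have hu := Real.exp_one_lt_d9
  constructor
  · refine lt_of_pow_lt_pow_left₀ 20 (Real.exp_pos _).le ?_
    rw [h]
    calc (1.5683 : ℝ) ^ 20 < 2.7182818283 ^ 9 := by norm_num
      _ ≤ _ := by gcongr
  · refine lt_of_pow_lt_pow_left₀ 20 (by norm_num) ?_
    rw [h]
    calc Real.exp 1 ^ 9 ≤ 2.7182818286 ^ 9 := by gcongr
      _ < _ := by norm_num

theorem chA_bounds : 1.1029 < chA ∧ chA < 1.103 := by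
  obtain ⟨h1, h2⟩ := exp_bounds
  have h0 := Real.exp_pos (9 / 20)
  rw [chA, Real.cosh_eq, Real.exp_neg]
  have h3 : (Real.exp (9 / 20))⁻¹ < 1 / 1.5683 := by
    rw [one_div]; exact inv_strictAnti₀ (by norm_num) h1
  have h4 : 1 / 1.56832 < (Real.exp (9 / 20))⁻¹ := by
    rw [one_div]; exact inv_strictAnti₀ h0 h2
  norm_num at h3 h4 ⊢
  constructor <;> linarith

/-- The numerical value of the product of the normals of two boundary sides. -/
theorem le_chA_div : 10.7 ≤ chA / (chA - 1) := by
  obtain ⟨h1, h2⟩ := chA_bounds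
  rw [le_div_iff₀ (by linarith)]; linarith

/-- The numerical value of the product of the normals of a boundary side and of its reflection in
the opposite seam. -/
theorem le_sideSeam_sq : 48.2 ≤ 2 * sideSeam ^ 2 - 1 := by
  obtain ⟨h1, h2⟩ := chA_bounds
  have : 24.6 ≤ sideSeam ^ 2 := by
    rw [sideSeam_sq, le_div_iff₀ (by linarith)]; nlinarith
  linarith

/-- The numerical value of the bound for the products of the vertices of the hexagon. -/
theorem chA_mul_div_le : chA * (chA + 1) / (chA - 1) ≤ 22.6 := by
  obtain ⟨h1, h2⟩ := chA_bounds
  rw [div_le_iff₀ (by linarith)]; nlinarith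

theorem exp_nat_mul_eq (T : ℕ) : Real.exp (9 / 10 * T) = Real.exp (9 / 20) ^ (2 * T) := by
  rw [← Real.exp_nat_mul]; push_cast; ring_nf

theorem exp_add_nat_mul_eq (T : ℕ) :
    Real.exp (9 / 10 + 9 / 20 * T) = Real.exp (9 / 20) ^ (T + 2) := by
  rw [← Real.exp_nat_mul]; push_cast; ring_nf

theorem cosh_add_nat_mul_le {T : ℕ} (hT : 2 ≤ T) :
    Real.cosh (9 / 10 + 9 / 20 * T) ≤ 0.6 * Real.exp (9 / 10 + 9 / 20 * T) := by
  have h1 := exp_bounds.1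
  have h2 : 5 ≤ Real.exp (9 / 10 + 9 / 20 * T) := by
    rw [exp_add_nat_mul_eq]
    calc (5 : ℝ) ≤ 1.5683 ^ 4 := by norm_num
      _ ≤ Real.exp (9 / 20) ^ 4 := by gcongr
      _ ≤ _ := pow_le_pow_right₀ (by linarith) (by omega)
  rw [Real.cosh_eq, Real.exp_neg]
  have h3 : (Real.exp (9 / 10 + 9 / 20 * T))⁻¹ ≤ 1 := inv_le_one_of_one_le₀ (by linarith)
  norm_num
  linarith

/-- The comparison of a distance along two lines with the linear bound `9 / 10 + 9 / 20 * T`: when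
`T` is small, the distance of the lines suffices, and when `T` is large, the exponential growth. -/
theorem le_of_cosh_bounds {B L k : ℝ} {T m : ℕ} (hB : 0 < B) (hL : 0 ≤ L)
    (h1 : 4 * k ≤ Real.cosh L) (h2 : Real.exp (9 / 10 * T) * k ^ 2 ≤ Real.cosh L * B)
    (hm : Real.cosh (9 / 10 + 9 / 20 * (m + 1 : ℕ)) ≤ 4 * k) (hm1 : 2 ≤ m)
    (hB' : 0.6 * B ≤ Real.exp (9 / 20) ^ m * k ^ 2) :
    9 / 10 + 9 / 20 * T ≤ L := by
  have h0 : (0 : ℝ) ≤ 9 / 10 + 9 / 20 * T := by positivity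
  have hE : 1 ≤ Real.exp (9 / 20) := by linarith [exp_bounds.1]
  suffices h : Real.cosh (9 / 10 + 9 / 20 * T) ≤ Real.cosh L by
    rwa [Real.cosh_le_cosh, abs_of_nonneg h0, abs_of_nonneg hL] at h
  by_cases hT : T ≤ m + 1
  · refine le_trans ?_ (hm.trans h1)
    rw [Real.cosh_le_cosh, abs_of_nonneg h0, abs_of_nonneg (by positivity)]
    have : (T : ℝ) ≤ (m + 1 : ℕ) := by exact_mod_cast hT
    linarith
  · refine le_of_mul_le_mul_right (le_trans ?_ h2) hB
    have hT' : m + 2 ≤ T := by omega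
    calc Real.cosh (9 / 10 + 9 / 20 * T) * B
        ≤ 0.6 * Real.exp (9 / 10 + 9 / 20 * T) * B := by
          gcongr; exact cosh_add_nat_mul_le (by omega)
      _ = Real.exp (9 / 20) ^ (T + 2) * (0.6 * B) := by rw [exp_add_nat_mul_eq]; ring
      _ ≤ Real.exp (9 / 20) ^ (T + 2) * (Real.exp (9 / 20) ^ m * k ^ 2) := by gcongr
      _ = Real.exp (9 / 20) ^ (T + 2 + m) * k ^ 2 := by ring
      _ ≤ _ := by
          rw [exp_nat_mul_eq]
          gcongr
          omega

theorem cosh_le_of_exp_le {u c : ℝ} (hu : 0 ≤ u) (h : Real.exp u ≤ c) :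
    Real.cosh u ≤ (c + 1) / 2 := by
  rw [Real.cosh_eq]
  have : Real.exp (-u) ≤ 1 := Real.exp_le_one_iff.2 (by linarith)
  linarith

/-- The lower bound for the distance of two boundary points on translates of different lines. Up to
four turns the distance `arcosh 9.7` of the lines is large enough, as `arcosh 9.7 > 27 / 10`. -/
theorem le_dist_line_of_ne (H : IsHexFrame v) {i j : Fin 3} (hij : i ≠ j) {l : List (Fin 3)}
    (hl : l.IsChain (· ≠ ·)) {x y X Y : ℝ} {T : ℕ} (hT : |X| + |Y| = 9 / 10 * T)
    (hK : Real.cosh (dist (line v i x) ((l.map (seamRefl H)).prod (line v j y))) ≤ 22.6) :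
    9 / 10 + 9 / 20 * T ≤
      dist (line v i (x + X)) ((l.map (seamRefl H)).prod (line v j (y + Y))) := by
  have hC : 10.7 ≤ mink (wordAct v l (sideNormal v j)) (sideNormal v i) :=
    le_chA_div.trans ((H.mink_sideNormal_sideNormal hij).symm.le.trans
      (H.le_mink_wordAct_sideNormal i j hl))
  have hb := cosh_dist_line_bounds H i j l (by norm_num) hC
  have h2 := (hb x y).2 X Y
  rw [hT] at h2
  have hE := exp_bounds
  refine le_of_cosh_bounds (k := (10.7 - 1) / 4) (m := 3) (Real.cosh_pos _) dist_nonneg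
    ?_ h2 ?_ (by norm_num) ?_
  · have := (hb (x + X) (y + Y)).1
    linarith
  · refine (cosh_le_of_exp_le (c := 1.56832 ^ 6) (by norm_num) ?_).trans (by norm_num)
    rw [exp_add_nat_mul_eq]
    have := hE.2.le
    gcongr
  · have h3 : (1.5683 : ℝ) ^ 3 ≤ Real.exp (9 / 20) ^ 3 := by have := hE.1.le; gcongr
    norm_num at h3 hK ⊢
    linarith

/-- The lower bound for the distance of two boundary points on different translates of one line. Up
to seven turns the distance `arcosh 47.2` of the lines is large enough, as
`arcosh 47.2 > 81 / 20`. -/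
theorem le_dist_line_self (H : IsHexFrame v) {i : Fin 3} {l : List (Fin 3)}
    (hl : l.IsChain (· ≠ ·)) (hil : i + 1 ∈ l) {x y X Y : ℝ} {T : ℕ}
    (hT : |X| + |Y| = 9 / 10 * T)
    (hK : Real.cosh (dist (line v i x) ((l.map (seamRefl H)).prod (line v i y))) ≤
      (45.2 ^ 2 * 1.56832 + 1) / 2) :
    9 / 10 + 9 / 20 * T ≤
      dist (line v i (x + X)) ((l.map (seamRefl H)).prod (line v i (y + Y))) := by
  have hC := le_sideSeam_sq.trans (H.le_mink_wordAct_sideNormal_self hl hil)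
  have hb := cosh_dist_line_bounds H i i l (by norm_num) hC
  have h2 := (hb x y).2 X Y
  rw [hT] at h2
  have hE := exp_bounds
  refine le_of_cosh_bounds (k := (48.2 - 1) / 4) (m := 6) (Real.cosh_pos _) dist_nonneg
    ?_ h2 ?_ (by norm_num) ?_
  · have := (hb (x + X) (y + Y)).1
    linarith
  · refine (cosh_le_of_exp_le (c := 1.56832 ^ 9) (by norm_num) ?_).trans (by norm_num)
    rw [exp_add_nat_mul_eq]
    have := hE.2.le
    gcongr
  · have h3 : (1.5683 : ℝ) ^ 6 ≤ Real.exp (9 / 20) ^ 6 := by have := hE.1.le; gcongr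
    norm_num at h3 hK ⊢
    linarith

end

section

variable {v : Fin 6 → ℍ} {H : IsHexFrame v} {ε₀ : Bool}

/-! ### Lengths of paths -/

theorem length_trans_le {x y z : Pants v} (a : Path x y) (b : Path y z) :
    Pants.length (a.trans b) ≤ Pants.length a + Pants.length b := by
  set c : I := ⟨1 / 2, by norm_num, by norm_num⟩ with hc
  have hu : (univ : Set I) = Iic c ∪ Ici c := by rw [Iic_union_Ici]
  rw [Pants.length, hu, eVariationOn.union _ isGreatest_Iic isLeast_Ici]
  have hmono : ∀ r : ℝ, Monotone fun t : I => projIcc (0 : ℝ) 1 zero_le_one (2 * t - r) :=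
    fun r s t hst => monotone_projIcc _ (by have : (s : ℝ) ≤ t := hst; linarith)
  refine add_le_add ?_ ?_
  · refine le_trans (eVariationOn.congr ?_).le (eVariationOn.comp_le_of_monotoneOn a
      (fun t : I => projIcc (0 : ℝ) 1 zero_le_one (2 * t - 0)) ((hmono 0).monotoneOn _)
      (mapsTo_univ _ _))
    intro t ht
    have ht' : (t : ℝ) ≤ 1 / 2 := ht
    rw [Path.trans_apply, dif_pos ht']
    simp only [Function.comp_apply, sub_zero]
    rw [projIcc_of_mem]
  · refine le_trans (eVariationOn.congr ?_).le (eVariationOn.comp_le_of_monotoneOn b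
      (fun t : I => projIcc (0 : ℝ) 1 zero_le_one (2 * t - 1)) ((hmono 1).monotoneOn _)
      (mapsTo_univ _ _))
    intro t ht
    have ht' : 1 / 2 ≤ (t : ℝ) := ht
    simp only [Function.comp_apply]
    rcases ht'.eq_or_lt with h | h
    · have e1 : (a.trans b) t = y := by
        rw [Path.trans_apply, dif_pos h.symm.le]
        have : (⟨2 * t, (unitInterval.mul_pos_mem_iff zero_lt_two).2 ⟨t.2.1, h.symm.le⟩⟩ : I) = 1 :=
          Subtype.ext (by change 2 * (t : ℝ) = 1; linarith)
        rw [this, a.target]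
      have e2 : projIcc (0 : ℝ) 1 zero_le_one (2 * t - 1) = 0 := by
        rw [← h]; norm_num
      rw [e1, e2, b.source]
    · rw [Path.trans_apply, dif_neg (not_le.2 h), projIcc_of_mem]

theorem lerp_mem_geodSegment_lerp (z w : ℍ) {s t : I} (hst : s ≤ t) :
    lerp z w s ∈ geodSegment z (lerp z w t) := by
  have hst' : (s : ℝ) ≤ t := hst
  rcases t.2.1.eq_or_lt with h | h
  · have hs : s = 0 := Subtype.ext (le_antisymm (hst'.trans h.symm.le) s.2.1)
    rw [hs, lerp_zero]
    exact self_mem_geodSegment_left _ _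
  · obtain ⟨c, hc, hs⟩ := vec_lerp z w s
    obtain ⟨c', hc', ht⟩ := vec_lerp z w t
    have h0 := s.2.1
    have h1 : 0 ≤ (t : ℝ) - s := sub_nonneg.2 hst'
    refine mem_geodSegment_of_comb (α := c * ((t - s) / t)) (β := c * (s / (t * c')))
      (by positivity) (by positivity) ?_
    rw [hs, ht, smul_add, smul_smul, smul_smul, ← add_assoc, ← add_smul]
    congr 2
    · field_simp; ring
    · field_simp

theorem length_facePath_le {ε : Bool} {z w : hexRegion v} {x y : Pants v} (hx : x = inFace ε z)
    (hy : y = inFace ε w) :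
    Pants.length (facePath ε z w hx hy) ≤ ENNReal.ofReal (dist (z : ℍ) w) := by
  set f : I → ℍ := fun t => lerp z w t with hf
  have hd : ∀ {s t : I}, s ≤ t → dist (f t) (f s) = dist (z : ℍ) (f t) - dist (z : ℍ) (f s) :=
    fun {s t} hst => by
      have : dist (z : ℍ) (f s) + dist (f s) (f t) = dist (z : ℍ) (f t) :=
        lerp_mem_geodSegment_lerp z w hst
      rw [dist_comm (f t)]; linarith
  have hle : ∀ t, dist (z : ℍ) (f t) ≤ dist (z : ℍ) w := fun t => by
    have : dist (z : ℍ) (f t) + dist (f t) w = dist (z : ℍ) w := lerp_mem_geodSegment z w t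
    linarith [dist_nonneg (x := f t) (y := w)]
  refine iSup_le fun p => ?_
  obtain ⟨n, u, hu, -⟩ := p
  change ∑ i ∈ Finset.range n, edist (inFace ε (hexLerp z w (u (i + 1))))
    (inFace ε (hexLerp z w (u i))) ≤ _
  have hsum : ∀ n, ∑ i ∈ Finset.range n, edist (inFace ε (hexLerp z w (u (i + 1))))
      (inFace ε (hexLerp z w (u i))) =
      ENNReal.ofReal (dist (z : ℍ) (f (u n)) - dist (z : ℍ) (f (u 0))) := by
    intro n
    induction n with
    | zero => simp
    | succ n ih =>
      have h1 := hd (hu n.le_succ)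
      have h2 := hd (hu (Nat.zero_le n))
      have h3 : edist (inFace ε (hexLerp z w (u (n + 1)))) (inFace ε (hexLerp z w (u n))) =
          ENNReal.ofReal (dist (f (u (n + 1))) (f (u n))) := by
        rw [edist_dist, dist_inFace]; rfl
      rw [Finset.sum_range_succ, ih, h3, h1, ← ENNReal.ofReal_add (h2 ▸ dist_nonneg)
        (h1 ▸ dist_nonneg)]
      congr 1; ring
  rw [hsum]
  refine ENNReal.ofReal_le_ofReal ?_
  linarith [hle (u n), dist_nonneg (x := (z : ℍ)) (y := f (u 0))]

/-! ### Simple paths -/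

theorem lerp_injective {z w : ℍ} (hzw : z ≠ w) : Function.Injective (lerp z w) := by
  intro s t hst
  obtain ⟨c, hc, hs⟩ := vec_lerp z w s
  obtain ⟨c', hc', ht⟩ := vec_lerp z w t
  rw [hst, ht] at hs
  have hC : 1 < Real.cosh (dist z w) := Real.one_lt_cosh.2 (dist_ne_zero.2 hzw)
  have e1 := congrArg (fun u => mink u (vec z)) hs
  have e2 := congrArg (fun u => mink u (vec w)) hs
  simp only [mink_add_left, mink_smul_left, mink_vec_self, mink_comm (vec w) (vec z),
    ← cosh_dist_eq] at e1 e2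
  set C := Real.cosh (dist z w)
  have hC' : C ^ 2 - 1 ≠ 0 := by nlinarith
  have a1 : c' * (t : ℝ) - c * s = 0 := by
    refine (mul_eq_zero.1 (?_ : (c' * (t : ℝ) - c * s) * (C ^ 2 - 1) = 0)).resolve_right hC'
    linear_combination C * e1 - e2
  have a2 : c' * (1 - t : ℝ) - c * (1 - s) = 0 := by
    refine (mul_eq_zero.1 (?_ : (c' * (1 - t : ℝ) - c * (1 - s)) * (C ^ 2 - 1) = 0)).resolve_right hC'
    linear_combination C * e2 - e1
  have hcc : c' = c := by linarith
  rw [hcc] at a1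
  have : c * ((t : ℝ) - s) = 0 := by linarith
  have := (mul_eq_zero.1 this).resolve_left hc.ne'
  exact Subtype.ext (by linarith)

theorem injective_facePath {ε : Bool} {z w : hexRegion v} {x y : Pants v} (hx : x = inFace ε z)
    (hy : y = inFace ε w) (hzw : z ≠ w) : Function.Injective (facePath ε z w hx hy) := by
  intro s t hst
  have : hexLerp z w s = hexLerp z w t := eq_of_inFace_eq hst
  exact lerp_injective (fun h => hzw (Subtype.ext h)) (congrArg Subtype.val this)

theorem isSimple_of_injective {x y : Pants v} {a : Path x y} (ha : Function.Injective a) :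
    Pants.IsSimple a := fun _ _ h => Or.inl (ha h)

/-- Values of a concatenation of paths. -/
theorem trans_cases {x y z : Pants v} (a : Path x y) (b : Path y z) (t : I) :
    (∃ s : I, (a.trans b) t = a s ∧ (s : ℝ) = 2 * t) ∨
      ∃ s : I, (a.trans b) t = b s ∧ (s : ℝ) = 2 * t - 1 := by
  rw [Path.trans_apply]
  split_ifs with h
  · exact Or.inl ⟨_, rfl, rfl⟩
  · exact Or.inr ⟨_, rfl, rfl⟩

theorem injective_trans {x y z : Pants v} {a : Path x y} {b : Path y z}
    (ha : Function.Injective a) (hb : Function.Injective b)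
    (hab : ∀ s t, a s = b t → s = 1 ∧ t = 0) : Function.Injective (a.trans b) := by
  intro s t hst
  rcases trans_cases a b s with ⟨s', h1, h2⟩ | ⟨s', h1, h2⟩ <;>
    rcases trans_cases a b t with ⟨t', h1', h2'⟩ | ⟨t', h1', h2'⟩ <;> rw [h1, h1'] at hst
  · rw [ha hst] at h2
    exact Subtype.ext (by linarith)
  · obtain ⟨rfl, rfl⟩ := hab _ _ hst
    simp only [Icc.coe_one, Icc.coe_zero] at h2 h2'
    exact Subtype.ext (by linarith)
  · obtain ⟨rfl, rfl⟩ := hab _ _ hst.symm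
    simp only [Icc.coe_one, Icc.coe_zero] at h2 h2'
    exact Subtype.ext (by linarith)
  · rw [hb hst] at h2
    exact Subtype.ext (by linarith)

theorem isSimple_trans {x y : Pants v} {a : Path x y} {b : Path y x}
    (ha : Function.Injective a) (hb : Function.Injective b)
    (hab : ∀ s t, a s = b t → (s = 1 ∧ t = 0) ∨ (s = 0 ∧ t = 1)) : Pants.IsSimple (a.trans b) := by
  intro s t hst
  rcases trans_cases a b s with ⟨s', h1, h2⟩ | ⟨s', h1, h2⟩ <;>
    rcases trans_cases a b t with ⟨t', h1', h2'⟩ | ⟨t', h1', h2'⟩ <;> rw [h1, h1'] at hst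
  · rw [ha hst] at h2
    exact Or.inl (Subtype.ext (by linarith))
  · rcases hab _ _ hst with ⟨rfl, rfl⟩ | ⟨rfl, rfl⟩ <;>
      simp only [Icc.coe_one, Icc.coe_zero] at h2 h2'
    · exact Or.inl (Subtype.ext (by linarith))
    · exact Or.inr (Or.inl ⟨Subtype.ext (by rw [Icc.coe_zero]; linarith),
        Subtype.ext (by rw [Icc.coe_one]; linarith)⟩)
  · rcases hab _ _ hst.symm with ⟨rfl, rfl⟩ | ⟨rfl, rfl⟩ <;>
      simp only [Icc.coe_one, Icc.coe_zero] at h2 h2'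
    · exact Or.inl (Subtype.ext (by linarith))
    · exact Or.inr (Or.inr ⟨Subtype.ext (by rw [Icc.coe_one]; linarith),
        Subtype.ext (by rw [Icc.coe_zero]; linarith)⟩)
  · rw [hb hst] at h2
    exact Or.inl (Subtype.ext (by linarith))

/-! ### The boundary curves are disjoint -/

theorem mink_sideNormal_of_mem_boundarySide (H : IsHexFrame v) {i : Fin 3} {z : ℍ}
    (hz : z ∈ boundarySide v i) : mink (vec z) (sideNormal v i) = 0 := by
  obtain ⟨x, -, -, rfl⟩ := H.exists_eq_line hz
  rw [H.vec_line, lineVec, mink_sub_left, mink_smul_left, mink_smul_left, mink_vs_sideNormal H,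
    mink_comm, H.mink_sideNormal_prev]
  ring

theorem mink_sideNormal_ne_zero (H : IsHexFrame v) {i j : Fin 3} (hij : i ≠ j) {z : ℍ}
    (hz : z ∈ boundarySide v j) : mink (vec z) (sideNormal v i) ≠ 0 := by
  intro h
  have h' := mink_sideNormal_of_mem_boundarySide H hz
  have h0 := mink_self_nonpos_of_orthogonal (w := sideNormal v i + sideNormal v j) (future_vec z)
    (by rw [mink_add_right, h, h', add_zero])
  rw [mink_add_left, mink_add_right, mink_add_right, H.mink_sideNormal_sideNormal_self,
    H.mink_sideNormal_sideNormal_self, H.mink_sideNormal_sideNormal hij,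
    H.mink_sideNormal_sideNormal hij.symm] at h0
  linarith [le_chA_div]

theorem bdry_eq_preimage (i : Fin 3) :
    Pants.bdry v i = (fun x => (fold x : ℍ)) ⁻¹' boundarySide v i := by
  ext x
  refine ⟨fun h => fold_mem_boundarySide h, fun h => ?_⟩
  obtain ⟨ε, z, rfl⟩ := exists_eq_inFace x
  rw [mem_preimage, fold_inFace] at h
  exact inFace_mem_bdry h

theorem isClosed_bdry (i : Fin 3) : IsClosed (Pants.bdry v i) := by
  rw [bdry_eq_preimage]
  exact (isClosed_geodSegment _ _).preimage (continuous_subtype_val.comp continuous_fold)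

theorem disjoint_bdry (H : IsHexFrame v) {i j : Fin 3} (hij : i ≠ j) :
    Disjoint (Pants.bdry v i) (Pants.bdry v j) := by
  rw [Set.disjoint_left]
  intro x hi hj
  exact mink_sideNormal_ne_zero H hij (fold_mem_boundarySide hj)
    (mink_sideNormal_of_mem_boundarySide H (fold_mem_boundarySide hi))

/-- A path in the boundary stays in one boundary curve. -/
theorem range_subset_bdry (H : IsHexFrame v) {i : Fin 3} {x y : Pants v} {b : Path x y}
    (hb : range b ⊆ ⋃ k, Pants.bdry v k) (hx : x ∈ Pants.bdry v i) : range b ⊆ Pants.bdry v i := by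
  have hclopen : IsClopen (b ⁻¹' Pants.bdry v i) := by
    refine ⟨(isClosed_bdry i).preimage b.continuous, ?_⟩
    have : b ⁻¹' Pants.bdry v i = (b ⁻¹' (Pants.bdry v (i + 1) ∪ Pants.bdry v (i + 2)))ᶜ := by
      ext t
      constructor
      · rintro h (h' | h')
        · exact (disjoint_bdry H (by simp : i ≠ i + 1)).ne_of_mem h h' rfl
        · exact (disjoint_bdry H (by simp : i ≠ i + 2)).ne_of_mem h h' rfl
      · intro h
        obtain ⟨k, hk⟩ := mem_iUnion.1 (hb ⟨t, rfl⟩)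
        rcases fin3_cases i k with rfl | rfl | rfl
        · exact hk
        · exact absurd (Or.inl hk) h
        · exact absurd (Or.inr hk) h
    rw [this]
    exact (((isClosed_bdry _).union (isClosed_bdry _)).preimage b.continuous).isOpen_compl
  have h := hclopen.eq_univ ⟨0, by rw [mem_preimage, b.source]; exact hx⟩
  rintro _ ⟨t, rfl⟩
  exact eq_univ_iff_forall.1 h t

/-! ### Short simple essential arcs -/

/-- A geodesic in a face that joins two boundary curves is a simple essential arc. -/
theorem exists_arc_of_ne (H : IsHexFrame v) {i j : Fin 3} (hij : i ≠ j) {ε : Bool}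
    {z w : hexRegion v} (hz : (z : ℍ) ∈ boundarySide v i) (hw : (w : ℍ) ∈ boundarySide v j)
    {x y : Pants v} (hx : x = inFace ε z) (hy : y = inFace ε w) :
    ∃ a : Path x y, Pants.IsSimple a ∧ Pants.IsEssential a ∧
      Pants.length a ≤ ENNReal.ofReal (dist (z : ℍ) w) := by
  refine ⟨facePath ε z w hx hy, isSimple_of_injective (injective_facePath _ _ ?_), ?_,
    length_facePath_le _ _⟩
  · rintro rfl
    exact mink_sideNormal_ne_zero H hij hw (mink_sideNormal_of_mem_boundarySide H hz)
  · rintro ⟨b, -, hb⟩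
    have h := range_subset_bdry H hb (hx ▸ inFace_mem_bdry hz) ⟨1, b.target⟩
    exact (disjoint_bdry H hij).ne_of_mem h (hy ▸ inFace_mem_bdry hw) rfl

theorem vec_hexLerp (z w : hexRegion v) (t : I) : ∃ c > 0, vec (hexLerp z w t : ℍ) =
    (c * (1 - t : ℝ)) • vec (z : ℍ) + (c * (t : ℝ)) • vec (w : ℍ) := vec_lerp _ _ _

theorem seamFn_opp_pos (H : IsHexFrame v) {i : Fin 3} {z : ℍ} (hz : z ∈ boundarySide v i) :
    0 < seamFn v (i + 1) z := by
  obtain ⟨x, -, -, rfl⟩ := H.exists_eq_line hz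
  exact H.seamFn_opp_line_pos i x

/-- The reflection in the seam opposite to a boundary curve moves the line of this curve, so its
product with a reflection that preserves the line is not a translation along it. -/
theorem seamRefl_mul_notMem_lineShift (H : IsHexFrame v) {i k : Fin 3} (hk : k = i ∨ k = i + 2) :
    seamRefl H (i + 1) * seamRefl H k ∉ lineShift v i := by
  rintro ⟨n, hn⟩
  have h0 := hn 0
  rw [IsometryEquiv.mul_apply] at h0
  obtain ⟨y, hy⟩ : ∃ y, seamRefl H k (line v i 0) = line v i y := by
    rcases hk with rfl | rfl
    · exact ⟨_, H.seamRefl_self_line _ _⟩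
    · exact ⟨_, H.seamRefl_prev_line _ _⟩
  rw [hy] at h0
  have h1 := H.seamFn_opp_line_pos i (0 + 9 / 10 * n)
  rw [← h0, seamFn, vec_seamRefl, H.mink_reflect_seamNormal, if_pos rfl] at h1
  have h2 := H.seamFn_opp_line_pos i y
  rw [seamFn] at h2
  linarith

/-- An arc that runs in one face from a boundary curve to a point `m` of the opposite seam, back in
the other face to a vertex `u`, and along the boundary curve to its starting point, is simple and
essential. -/
theorem exists_arc_self (H : IsHexFrame v) {i k : Fin 3} (hk : k = i ∨ k = i + 2) {ε : Bool}
    {z u m : hexRegion v} (hz : (z : ℍ) ∈ boundarySide v i) (hu : (u : ℍ) ∈ boundarySide v i)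
    (huk : (u : ℍ) ∈ seamSide v k) (hm : (m : ℍ) ∈ boundarySide v (i + 1))
    (hmk : (m : ℍ) ∈ seamSide v (i + 1)) (hzu : z ≠ u) {x : Pants v} (hx : x = inFace ε z) :
    ∃ a : Path x x, Pants.IsSimple a ∧ Pants.IsEssential a ∧ Pants.length a ≤
      ENNReal.ofReal (dist (z : ℍ) m + dist (m : ℍ) u + dist (u : ℍ) z) := by
  have hmi : mink (vec (m : ℍ)) (sideNormal v i) ≠ 0 := mink_sideNormal_ne_zero H (by simp) hm
  have hzi := mink_sideNormal_of_mem_boundarySide H hz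
  have hui := mink_sideNormal_of_mem_boundarySide H hu
  have hzm : z ≠ m := fun h => hmi (h ▸ hzi)
  have hmu : m ≠ u := fun h => hmi (h ▸ hui)
  have em : inFace ε m = inFace (!ε) m := inFace_eq_of_mem_seams (mem_iUnion.2 ⟨_, hmk⟩) _ _
  have eu : inFace ε u = inFace (!ε) u := inFace_eq_of_mem_seams (mem_iUnion.2 ⟨_, huk⟩) _ _
  set A : Path x (inFace ε m) := facePath ε z m hx rfl
  set B : Path (inFace ε m) (inFace ε u) := facePath (!ε) m u em eu
  set D : Path (inFace ε u) x := facePath ε u z rfl hx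
  have hA : Function.Injective A := injective_facePath _ _ hzm
  have hB : Function.Injective B := injective_facePath _ _ hmu
  have hD : Function.Injective D := injective_facePath _ _ hzu.symm
  -- the points of the segments that are on the line of the boundary side
  have onA : ∀ t, mink (vec (hexLerp z m t : ℍ)) (sideNormal v i) = 0 → t = 0 := fun t ht => by
    obtain ⟨c, hc, h⟩ := vec_hexLerp z m t
    rw [h, mink_add_left, mink_smul_left, mink_smul_left, hzi, mul_zero, zero_add] at ht
    rcases mul_eq_zero.1 ht with h' | h'
    · exact Subtype.ext ((mul_eq_zero.1 h').resolve_left hc.ne')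
    · exact absurd h' hmi
  have onB : ∀ t, mink (vec (hexLerp m u t : ℍ)) (sideNormal v i) = 0 → t = 1 := fun t ht => by
    obtain ⟨c, hc, h⟩ := vec_hexLerp m u t
    rw [h, mink_add_left, mink_smul_left, mink_smul_left, hui, mul_zero, add_zero] at ht
    rcases mul_eq_zero.1 ht with h' | h'
    · have := (mul_eq_zero.1 h').resolve_left hc.ne'
      exact Subtype.ext (show (t : ℝ) = 1 by linarith)
    · exact absurd h' hmi
  have onD : ∀ t, mink (vec (hexLerp u z t : ℍ)) (sideNormal v i) = 0 := fun t => by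
    obtain ⟨c, hc, h⟩ := vec_hexLerp u z t
    rw [h, mink_add_left, mink_smul_left, mink_smul_left, hzi, hui]; ring
  have hAB : ∀ s t, A s = B t → s = 1 ∧ t = 0 := by
    intro s t h
    have h1 : hexLerp z m s = hexLerp m u t := eq_of_inFace_eq h
    have h2 : (hexLerp z m s : ℍ) ∈ seams v := by
      refine mem_seams_of_inFace_eq (ε := ε) (y := hexLerp m u t) h
    have hs1 : s = 1 := by
      by_contra hs1
      rcases eq_or_ne s 0 with hs0 | hs0
      · rw [hs0, hexLerp_zero] at h1
        have := onB t (by rw [← h1]; exact hzi)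
        rw [this, hexLerp_one] at h1
        exact hzu h1
      · obtain ⟨l, hl⟩ := mem_iUnion.1 h2
        have h0 := H.seamFn_eq_zero hl
        refine absurd h0 (ne_of_gt ?_)
        change 0 < seamFn v l (lerp z m s)
        by_cases hli : l = i + 1
        · subst hli
          exact seamFn_lerp_pos_of_left (seamFn_opp_pos H hz) (H.seamFn_nonneg m.2 _)
            (lt_of_le_of_ne s.2.2 hs1)
        · exact seamFn_lerp_pos_of_right (H.seamFn_nonneg z.2 _)
            (H.seamFn_pos_of_mem_seamSide hmk hli) (lt_of_le_of_ne s.2.1 (Ne.symm hs0))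
    refine ⟨hs1, hB ?_⟩
    rw [← h, hs1, A.target, B.source]
  have hABD : ∀ s t, (A.trans B) s = D t → (s = 1 ∧ t = 0) ∨ (s = 0 ∧ t = 1) := by
    intro s t h
    rcases trans_cases A B s with ⟨s', h1, h2⟩ | ⟨s', h1, h2⟩ <;> rw [h1] at h
    · have h3 : hexLerp z m s' = hexLerp u z t := eq_of_inFace_eq h
      have h4 := onA s' (by rw [h3]; exact onD t)
      rw [h4, Icc.coe_zero] at h2
      refine Or.inr ⟨Subtype.ext (show (s : ℝ) = 0 by linarith), hD ?_⟩
      rw [← h, h4, A.source, D.target]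
    · have h3 : hexLerp m u s' = hexLerp u z t := eq_of_inFace_eq h
      have h4 := onB s' (by rw [h3]; exact onD t)
      rw [h4, Icc.coe_one] at h2
      refine Or.inl ⟨Subtype.ext (show (s : ℝ) = 1 by linarith), hD ?_⟩
      rw [← h, h4, B.target, D.source]
  refine ⟨(A.trans B).trans D, isSimple_trans (injective_trans hA hB hAB) hD hABD, ?_, ?_⟩
  · rintro ⟨b, hab, hb⟩
    have hb' := range_subset_bdry H hb (hx ▸ inFace_mem_bdry hz)
    obtain ⟨Γ, h1, h2⟩ := exists_lift (H := H) (ε₀ := ε) b (e := sec H ε ε 1 z) hx.symm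
    obtain ⟨-, h4⟩ := exists_lineShift_of_range_subset H ε hx hb' h1 h2
    have c1 : Continues (.mk ((A.trans B).trans D)) (sec H ε ε 1 z) (Γ 1) := by
      rw [Path.Homotopic.Quotient.eq.2 hab]; exact ⟨b, rfl, Γ, h1, h2, rfl⟩
    have c2 : Continues (.mk ((A.trans B).trans D)) (sec H ε ε 1 z)
        (sec H ε ε (seamRefl H (i + 1) * seamRefl H k) z) := by
      have cA : Continues (.mk A) (sec H ε ε 1 z) (sec H ε ε 1 m) := Continues.facePath _ _ 1
      have cB : Continues (.mk B) (sec H ε (!ε) (seamRefl H (i + 1)) m)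
        (sec H ε (!ε) (seamRefl H (i + 1)) u) := Continues.facePath _ _ _
      have cD : Continues (.mk D) (sec H ε ε (seamRefl H (i + 1) * seamRefl H k) u)
        (sec H ε ε (seamRefl H (i + 1) * seamRefl H k) z) := Continues.facePath _ _ _
      rw [sec_eq_sec_not hmk, one_mul] at cA
      rw [sec_eq_sec_not huk, mul_assoc, seamRefl_mul_self, mul_one] at cD
      rw [Path.Homotopic.Quotient.mk_trans, Path.Homotopic.Quotient.mk_trans]
      exact (cA.trans cB).trans cD
    have h5 := h4 1
    rw [c1.unique c2, coord_sec_self] at h5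
    exact seamRefl_mul_notMem_lineShift H hk h5
  · refine (length_trans_le _ _).trans ?_
    rw [ENNReal.ofReal_add (by positivity) (by positivity),
      ENNReal.ofReal_add (by positivity) (by positivity)]
    exact add_le_add ((length_trans_le _ _).trans
      (add_le_add (length_facePath_le _ _) (length_facePath_le _ _))) (length_facePath_le _ _)

/-! ### Distances in the hexagon -/

theorem mink_le_of_boundarySide {i : Fin 3} {u : Vec} {c : ℝ} (hc : 0 ≤ c)
    (hs : mink (vec (vs v i)) u ≤ c) (he : mink (vec (ve v i)) u ≤ c) {z : ℍ}
    (hz : z ∈ boundarySide v i) : mink (vec z) u ≤ c := by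
  rw [boundarySide_eq] at hz
  obtain ⟨α, β, hα, hβ, h⟩ := exists_comb_of_mem_geodSegment hz
  have h1 := mink_vec_self z
  rw [h] at h1
  simp only [mink_add_left, mink_add_right, mink_smul_left, mink_smul_right, mink_vec_self,
    mink_comm (vec (ve v i)) (vec (vs v i)), ← cosh_dist_eq] at h1
  have h2 := Real.one_le_cosh (dist (vs v i) (ve v i))
  have h3 : α + β ≤ 1 := by
    by_contra! h3
    have h4 := mul_nonneg (mul_nonneg hα hβ) (sub_nonneg.2 h2)
    nlinarith
  rw [h, mink_add_left, mink_smul_left, mink_smul_left]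
  nlinarith [mul_nonneg hα (sub_nonneg.2 hs), mul_nonneg hβ (sub_nonneg.2 he)]

theorem mink_vertex_le (H : IsHexFrame v) (a b c d : Fin 3) :
    mink (shA⁻¹ • (chA • seamNormal v a + seamNormal v b))
      (shA⁻¹ • (chA • seamNormal v c + seamNormal v d)) ≤ 22.6 := by
  have hN : ∀ k l, mink (seamNormal v k) (seamNormal v l) ≤ chA := fun k l => by
    by_cases h : k = l
    · rw [h, H.self]; linarith [one_lt_chA]
    · rw [H.ne _ _ h]
  have h1 := one_lt_chA
  have h2 := shA_pos
  refine le_trans ?_ chA_mul_div_le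
  have h3 : chA * (chA + 1) / (chA - 1) = shA⁻¹ * (shA⁻¹ * (chA * (chA + 1) ^ 2)) := by
    have h4 : chA - 1 ≠ 0 := by linarith
    field_simp
    linear_combination -chA_sq
  rw [h3, mink_smul_left, mink_smul_right]
  gcongr
  simp only [mink_add_left, mink_add_right, mink_smul_left, mink_smul_right]
  have e1 : chA * (chA * mink (seamNormal v a) (seamNormal v c)) ≤ chA * (chA * chA) := by
    gcongr; exact hN _ _
  have e2 : chA * mink (seamNormal v a) (seamNormal v d) ≤ chA * chA := by gcongr; exact hN _ _
  have e3 : chA * mink (seamNormal v b) (seamNormal v c) ≤ chA * chA := by gcongr; exact hN _ _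
  have e4 := hN b d
  linarith

/-- A bound for the distances of the points of the boundary sides. -/
theorem cosh_dist_boundarySide_le (H : IsHexFrame v) {i j : Fin 3} {z w : ℍ}
    (hz : z ∈ boundarySide v i) (hw : w ∈ boundarySide v j) : Real.cosh (dist z w) ≤ 22.6 := by
  rw [cosh_dist_eq]
  refine mink_le_of_boundarySide (by norm_num) ?_ ?_ hz <;> rw [mink_comm] <;>
    refine mink_le_of_boundarySide (by norm_num) ?_ ?_ hw <;> simp only [H.vs_eq, H.ve_eq] <;>
    exact mink_vertex_le H _ _ _ _

theorem exp_dist_boundarySide_le (H : IsHexFrame v) {i j : Fin 3} {z w : ℍ}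
    (hz : z ∈ boundarySide v i) (hw : w ∈ boundarySide v j) : Real.exp (dist z w) ≤ 45.2 := by
  have h := cosh_dist_boundarySide_le H hz hw
  rw [Real.cosh_eq] at h
  have := Real.exp_pos (-dist z w)
  linarith

theorem cosh_dist_line_line (H : IsHexFrame v) (i : Fin 3) (x y : ℝ) :
    Real.cosh (dist (line v i x) (line v i y)) = Real.cosh (x - y) := by
  have h := H.seamFn_vs_prev i
  rw [seamFn] at h
  rw [cosh_dist_eq, H.vec_line, H.vec_line, lineVec, lineVec, Real.cosh_sub]
  simp only [mink_sub_left, mink_sub_right, mink_smul_left, mink_smul_right, mink_vec_self, H.self,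
    h, mink_comm (seamNormal v (i + 2)) (vec (vs v i))]
  ring

theorem dist_boundarySide_self_le (H : IsHexFrame v) {i : Fin 3} {z w : ℍ}
    (hz : z ∈ boundarySide v i) (hw : w ∈ boundarySide v i) : dist z w ≤ 9 / 20 := by
  obtain ⟨x, h1, h2, rfl⟩ := H.exists_eq_line hz
  obtain ⟨y, h3, h4, rfl⟩ := H.exists_eq_line hw
  have h := cosh_dist_line_line H i x y
  have h' := Real.cosh_le_cosh.1 h.le
  rw [abs_of_nonneg dist_nonneg] at h'
  exact h'.trans (abs_le.2 ⟨by linarith, by linarith⟩)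

/-- A bound for the length of a shortest simple essential arc that returns to its boundary curve.
The arc of `exists_arc_self` consists of two geodesics of length at most `log 45.2` and of a piece of
the boundary side, of length at most `9 / 20 < log 1.56832`. -/
theorem exists_short_arc_self (H : IsHexFrame v) (i : Fin 3) {ε : Bool} {z : hexRegion v}
    (hz : (z : ℍ) ∈ boundarySide v i) {x : Pants v} (hx : x = inFace ε z) :
    ∃ (a : Path x x) (L : ℝ), Pants.IsSimple a ∧ Pants.IsEssential a ∧ 0 ≤ L ∧
      Pants.length a ≤ ENNReal.ofReal L ∧ Real.cosh L ≤ (45.2 ^ 2 * 1.56832 + 1) / 2 := by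
  have hm := ve_mem_boundarySide (v := v) (i + 1)
  obtain ⟨k, u, hk, hu, huk, hzu⟩ : ∃ (k : Fin 3) (u : hexRegion v), (k = i ∨ k = i + 2) ∧
      (u : ℍ) ∈ boundarySide v i ∧ (u : ℍ) ∈ seamSide v k ∧ z ≠ u := by
    by_cases h : (z : ℍ) = vs v i
    · have hu := ve_mem_boundarySide (v := v) i
      refine ⟨i, ⟨_, boundarySide_subset_hexRegion i hu⟩, Or.inl rfl, hu, mem_seamSide_ve i, ?_⟩
      intro h'
      have h'' := congrArg Subtype.val h'
      change (z : ℍ) = ve v i at h''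
      rw [h, ← H.line_zero, ← line_eq_ve H] at h''
      have := H.line_injective i h''
      norm_num at this
    · have hu := vs_mem_boundarySide (v := v) i
      exact ⟨i + 2, ⟨_, boundarySide_subset_hexRegion i hu⟩, Or.inr rfl, hu, mem_seamSide_vs i,
        fun h' => h (congrArg Subtype.val h')⟩
  obtain ⟨a, ha, ha', hL⟩ := exists_arc_self H hk hz hu huk
    (m := ⟨_, boundarySide_subset_hexRegion _ hm⟩) hm (mem_seamSide_ve _) hzu hx
  refine ⟨a, _, ha, ha', by positivity, hL, cosh_le_of_exp_le (by positivity) ?_⟩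
  rw [Real.exp_add, Real.exp_add]
  have h1 := exp_dist_boundarySide_le H hz hm
  have h2 := exp_dist_boundarySide_le H hm hu
  have h3 := (Real.exp_le_exp.2 (dist_boundarySide_self_le H hu hz)).trans exp_bounds.2.le
  rw [pow_two]
  gcongr

end

section

variable {v : Fin 6 → ℍ} {H : IsHexFrame v} {ε₀ : Bool}

/-! ### The estimate for one arc, and for a multiarc -/

theorem isom_one_apply (z : ℍ) : (1 : ℍ ≃ᵢ ℍ) z = z := rfl

/-- The marked points lie in one face, on the boundary sides. -/
theorem exists_marking {p : Fin 3 → Pants v} (hp : Pants.IsMarking p) :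
    ∃ (ε : Bool) (z : Fin 3 → hexRegion v), ∀ k, p k = inFace ε (z k) ∧
      (z k : ℍ) ∈ boundarySide v k := by
  obtain ⟨hb, hf⟩ := hp
  obtain ⟨ε, hε⟩ : ∃ ε, ∀ k, p k ∈ range (inFace (v := v) ε) := by
    rcases hf with h | h
    · exact ⟨true, h⟩
    · exact ⟨false, h⟩
  exact ⟨ε, fun k => fold (p k), fun k => ⟨eq_inFace_fold (hε k), fold_mem_boundarySide (hb k)⟩⟩

theorem length_symm {x y : Pants v} (a : Path x y) : Pants.length a.symm = Pants.length a := by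
  have h : ∀ {x y : Pants v} (a : Path x y), Pants.length a.symm ≤ Pants.length a := fun a =>
    eVariationOn.comp_le_of_antitoneOn a _ (fun _ _ _ _ h => unitInterval.symm_le_symm.2 h)
      (mapsTo_univ _ _)
  exact le_antisymm (h a) (by conv_lhs => rw [← a.symm_symm]
                              exact h a.symm)

theorem isEssential_symm {x y : Pants v} {a : Path x y} (h : Pants.IsEssential a) :
    Pants.IsEssential a.symm := by
  rintro ⟨b, hab, hb⟩
  refine h ⟨b.symm, ?_, by rwa [Path.symm_range]⟩
  have := hab.symm₂
  rwa [Path.symm_symm] at this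

/-- The lower bound for the length of the paths homotopic to an arc which turns `s` and `r` times
around its boundary curves. -/
theorem le_length_of_isCarried (H : IsHexFrame v) {p : Fin 3 → Pants v} (hp : Pants.IsMarking p)
    {d : ∀ k, Path (p k) (p k)} (hd : Pants.IsBdryLoops d) {c : ∀ i j, Path (p i) (p j)}
    (hc : Pants.IsCanonical c) {a : Pants.MarkedArc p} {s r : ℤ} (ha : a.IsCarried d c s r)
    {b : Path (p a.src) (p a.tgt)} (hb : Path.Homotopic a.path b) :
    ENNReal.ofReal (9 / 10 + 9 / 20 * (s.natAbs + r.natAbs : ℕ)) ≤ Pants.length b := by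
  obtain ⟨i, j, path⟩ := a
  obtain ⟨e, he, heq⟩ := ha
  simp only at b hb e he heq
  rw [Path.Homotopic.Quotient.eq.2 hb] at heq
  obtain ⟨ε, z, hz⟩ := exists_marking hp
  -- the essential path `e` has the length of a canonical arc
  have hec : Pants.IsEssential e ∧ ∃ L : ℝ, 0 ≤ L ∧ Pants.length e ≤ ENNReal.ofReal L ∧
      Real.cosh L ≤ if i = j then (45.2 ^ 2 * 1.56832 + 1) / 2 else 22.6 := by
    have main : ∀ i j, ∃ L : ℝ, 0 ≤ L ∧ Pants.length (c i j) ≤ ENNReal.ofReal L ∧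
        Real.cosh L ≤ if i = j then (45.2 ^ 2 * 1.56832 + 1) / 2 else 22.6 := by
      intro i j
      obtain ⟨-, -, hmin⟩ := hc.1 i j
      by_cases hij : i = j
      · subst hij
        obtain ⟨a, L, h1, h2, h3, h4, h5⟩ := exists_short_arc_self H i (hz i).2 (hz i).1
        exact ⟨L, h3, (hmin a h1 h2).trans h4, by rwa [if_pos rfl]⟩
      · obtain ⟨a, h1, h2, h3⟩ := exists_arc_of_ne H hij (hz i).2 (hz j).2 (hz i).1 (hz j).1
        refine ⟨_, dist_nonneg, (hmin a h1 h2).trans h3, ?_⟩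
        rw [if_neg hij]
        exact cosh_dist_boundarySide_le H (hz i).2 (hz j).2
    rcases he with rfl | rfl
    · exact ⟨(hc.1 i j).2.1, main i j⟩
    · refine ⟨isEssential_symm (hc.1 j i).2.1, ?_⟩
      rw [length_symm]
      simpa only [eq_comm] using main j i
  obtain ⟨hess, L, hL0, hL, hcosh⟩ := hec
  obtain ⟨l, hl, hcont, hmem⟩ :=
    exists_reduced_word H ε (Path.Homotopic.Quotient.mk e) (hz i).1 (hz j).1 i
  obtain ⟨h, n, hn, hh, hcd⟩ := exists_continues_of_isSimple H ε (hz i).1 (hd i).2.subset (hd i).1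
  obtain ⟨h', n', hn', hh', hcd'⟩ :=
    exists_continues_of_isSimple H ε (hz j).1 (hd j).2.subset (hd j).1
  set w := (l.map (seamRefl H)).prod
  obtain ⟨x, -, -, hx⟩ := H.exists_eq_line (hz i).2
  obtain ⟨y, -, -, hy⟩ := H.exists_eq_line (hz j).2
  -- the continuation along `b`
  have hcb : Continues (.mk b) (sec H ε ε 1 (z i)) (sec H ε ε (h ^ s * w * h' ^ r) (z j)) := by
    rw [heq]
    have h1 := continues_loopPow hcd s
    have h2 := hcont (h ^ s)
    have h3 := (continues_loopPow hcd' r).leftMul (h ^ s * w)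
    rw [leftMul_sec, leftMul_sec, mul_one] at h3
    exact (h1.trans h2).trans h3
  -- the length of `e` bounds the distance of the lifted marked points
  have hK : Real.cosh (dist (line v i x) (w (line v j y))) ≤ Real.cosh L := by
    have h1 := (edist_dev_le_length e (hcont 1)).trans hL
    rw [dev_sec, dev_sec, edist_dist, one_mul, isom_one_apply, hx, hy,
      ENNReal.ofReal_le_ofReal_iff hL0] at h1
    rw [Real.cosh_le_cosh, abs_of_nonneg dist_nonneg, abs_of_nonneg hL0]
    exact h1
  refine le_trans ?_ (edist_dev_le_length b hcb)
  rw [dev_sec, dev_sec, edist_dist, hx, hy]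
  refine ENNReal.ofReal_le_ofReal ?_
  have hdist : dist ((1 : ℍ ≃ᵢ ℍ) (line v i x)) ((h ^ s * w * h' ^ r) (line v j y)) =
      dist (line v i (x + 9 / 10 * (n * (-s)))) (w (line v j (y + 9 / 10 * (n' * r)))) := by
    rw [IsometryEquiv.mul_apply, IsometryEquiv.mul_apply, zpow_line hh', isom_one_apply,
      ← (h ^ s).dist_eq (line v i (x + _)), zpow_line hh]
    congr 2
    ring
  have hT : |9 / 10 * ((n : ℝ) * (-s))| + |9 / 10 * ((n' : ℝ) * r)| =
      9 / 10 * (s.natAbs + r.natAbs : ℕ) := by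
    have e1 : |(n : ℝ)| = 1 := by rcases hn with rfl | rfl <;> simp
    have e2 : |(n' : ℝ)| = 1 := by rcases hn' with rfl | rfl <;> simp
    rw [abs_mul, abs_mul, abs_mul, abs_mul, abs_neg, e1, e2, Nat.cast_add, Nat.cast_natAbs,
      Nat.cast_natAbs, abs_of_pos (by norm_num : (0 : ℝ) < 9 / 10)]
    push_cast; ring
  rw [hdist]
  by_cases hij : i = j
  · subst hij
    rw [if_pos rfl] at hcosh
    refine le_dist_line_self H hl (hmem (hz i).2 (hz i).2 ?_) hT (hK.trans hcosh)
    rintro ⟨b', hb', hr⟩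
    exact hess ⟨b', (Path.Homotopic.Quotient.exact hb').symm, hr.trans (subset_iUnion _ i)⟩
  · rw [if_neg hij] at hcosh
    exact le_dist_line_of_ne H hij hl hT (hK.trans hcosh)

theorem le_hypLength_of_isCarried (H : IsHexFrame v) {p : Fin 3 → Pants v}
    (hp : Pants.IsMarking p) {d : ∀ k, Path (p k) (p k)} (hd : Pants.IsBdryLoops d)
    {c : ∀ i j, Path (p i) (p j)} (hc : Pants.IsCanonical c) {a : Pants.MarkedArc p} {s r : ℤ}
    (ha : a.IsCarried d c s r) :
    ((2 + s.natAbs + r.natAbs : ℕ) : ℝ≥0∞) ≤ 20 / 9 * Pants.hypLength a.path := by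
  have h : ENNReal.ofReal (9 / 10 + 9 / 20 * (s.natAbs + r.natAbs : ℕ)) ≤
      Pants.hypLength a.path :=
    le_iInf₂ fun b hb => le_length_of_isCarried H hp hd hc ha hb
  have h2 : (20 / 9 : ℝ≥0∞) = ENNReal.ofReal (20 / 9) := by
    rw [ENNReal.ofReal_div_of_pos (by norm_num)]; norm_num
  calc ((2 + s.natAbs + r.natAbs : ℕ) : ℝ≥0∞)
      = ENNReal.ofReal (20 / 9) * ENNReal.ofReal (9 / 10 + 9 / 20 * (s.natAbs + r.natAbs : ℕ)) := by
        rw [← ENNReal.ofReal_mul (by norm_num), ← ENNReal.ofReal_natCast]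
        congr 1; push_cast; ring
    _ ≤ _ := by rw [h2]; gcongr

/-- The combinatorial length is the sum of the contributions of the arcs. -/
theorem combLength_eq {p : Fin 3 → Pants v} {n : ℕ} {C : Fin n → Pants.MarkedArc p}
    {s r : Fin n → ℤ} {m t : Fin 3 → ℕ}
    (hm : ∀ k, m k = ∑ x, ((if (C x).src = k then 1 else 0) + (if (C x).tgt = k then 1 else 0)))
    (ht : ∀ k, t k = ∑ x, ((if (C x).src = k then (s x).natAbs else 0) +
      (if (C x).tgt = k then (r x).natAbs else 0))) :
    Pants.combLength m t = ∑ x, (2 + (s x).natAbs + (r x).natAbs) := by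
  rw [Pants.combLength, ← Finset.sum_add_distrib]
  simp only [hm, ht, ← Finset.sum_add_distrib]
  rw [Finset.sum_comm]
  refine Finset.sum_congr rfl fun x _ => ?_
  simp only [Finset.sum_add_distrib, Finset.sum_ite_eq, Finset.mem_univ, if_true]
  ring

theorem combLength_le (H : IsHexFrame v) {p : Fin 3 → Pants v}
    (hp : Pants.IsMarking p) {d : ∀ k, Path (p k) (p k)} (hd : Pants.IsBdryLoops d)
    {c : ∀ i j, Path (p i) (p j)} (hc : Pants.IsCanonical c) {n : ℕ}
    {C : Fin n → Pants.MarkedArc p} {m t : Fin 3 → ℕ} (h : Pants.IsDehnThurston d c C m t) :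
    (Pants.combLength m t : ℝ≥0∞) ≤ 20 / 9 * ∑ x, Pants.hypLength (C x).path := by
  obtain ⟨hm, s, r, hsr, ht⟩ := h
  rw [combLength_eq hm ht, Nat.cast_sum, Finset.mul_sum]
  exact Finset.sum_le_sum fun x _ => le_hypLength_of_isCarried H hp hd hc (hsr x)

end

end PantsLength

end

theorem proposition3p1 (v : Fin 6 → UpperHalfPlane) (hv : IsRightAngledHexagon v)
    (hlen : ∀ k, Pants.bdryLength v k = 9 / 10)
    (p : Fin 3 → Pants v) (hp : Pants.IsMarking p)
    (d : ∀ k, Path (p k) (p k)) (hd : Pants.IsBdryLoops d)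
    (c : ∀ i j, Path (p i) (p j)) (hc : Pants.IsCanonical c) :
    (∀ a : Pants.MarkedArc p, Pants.IsSimple a.path → Pants.IsEssential a.path →
      ∀ m t : Fin 3 → ℕ, Pants.IsDehnThurston d c (fun _ : Fin 1 => a) m t →
        (Pants.combLength m t : ENNReal) ≤ 20 / 9 * Pants.hypLength a.path) ∧
    (∀ (n : ℕ) (C : Fin n → Pants.MarkedArc p), Pants.IsMultiarc C →
      ∀ m t : Fin 3 → ℕ, Pants.IsDehnThurston d c C m t →
        (Pants.combLength m t : ENNReal) ≤ 20 / 9 * ∑ x, Pants.hypLength (C x).path) := by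
  have H := PantsLength.isHexFrame hv hlen
  refine ⟨fun a _ _ m t h => ?_, fun n C _ m t h => PantsLength.combLength_le H hp hd hc h⟩
  have := PantsLength.combLength_le H hp hd hc h
  rwa [Fin.sum_univ_one] at this
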